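/- Let $\mathcal K$ be a tt-category, i.e. an essentially small, idempotent-complete triangulated category with a symmetric monoidal structure $(\otimes,\mathbb 1)$ such that each functor $x\otimes-$ is exact, via isomorphisms $x\otimes\Sigma y\cong\Sigma(x\otimes y)$ that are natural in $x$ and $y$ and compatible with the unit and associativity constraints. Let $A$ be a tt-ring in $\mathcal K$: a commutative ring object $(A,\mu,\eta)$ such that $\mu:A\otimes A\to A$ has an $A,A$-bilinear section. Let $A\text{-Mod}_{\mathcal K}$ be the category of $A$-modules in $\mathcal K$, with the tensor product $\otimes_A$ and with the triangles whose underlying triangle in $\mathcal K$ is distinguished. For $\mathcal C=\mathcal K$ or a module category over a tt-ring, let $\operatorname{Spc}(\mathcal C)$ be the set of prime thick $\otimes$-ideals $\mathcal P\subsetneq\mathcal C$, with the topology having the sets $\{\mathcal P\mid x\in\mathcal P\}$, $x\in\mathcal C$, as a basis of open sets, and put $\operatorname{supp}(x)=\{\mathcal P\mid x\notin\mathcal P\}$, with the subspace topology. Assume that $A$ has finite degree, i.e. $A^{[n]}=0$ for some $n$ in the splitting tower $\mathbb 1=A^{[0]}\to A=A^{[1]}\to A^{[2]}\to\cdots$ of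 commutative ring objects, in which $A^{[n+1]}\otimes_{A^{[n]}}A^{[n+1]}\cong A^{[n+1]}\times A^{[n+2]}$ as ring objects, the first component of this isomorphism is induced by the multiplication of $A^{[n+1]}$, and the map $A^{[n+1]}\to A^{[n+2]}$ is the composite of $1\otimes\eta:A^{[n+1]}\to A^{[n+1]}\otimes_{A^{[n]}}A^{[n+1]}$ with the second component. Let $F_A:\mathcal K\to A\text{-Mod}_{\mathcal K}$, $x\mapsto A\otimes x$, and let $F_1,F_2:A\text{-Mod}_{\mathcal K}\to (A\otimes A)\text{-Mod}_{\mathcal K}$ be extension of scalars along $f_1=1\otimes\eta$ and $f_2=\eta\otimes1:A\to A\otimes A$. Then $\varphi_i(\mathcal Q)=F_i^{-1}(\mathcal Q)$ and $\varphi_A(\mathcal P)=F_A^{-1}(\mathcal P)$ define continuous maps, $\varphi_A$ takes values in $\operatorname{supp}(A)$, and $$\operatorname{Spc}\big((A\otimes A)\text{-Mod}_{\mathcal K}\big)\ \underset{\varphi_2}{\overset{\varphi_1}{\rightrightarrows}}\ \operatorname{Spc}(A\text{-Mod}_{\mathcal K})\ \xrightarrow{\ \varphi_A\ }\ \operatorname{supp}(A)$$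 is a coequalizer of topological spaces. -/

import Mathlib

open CategoryTheory Category MonoidalCategory Limits Pretriangulated MonObj

universe w v u

namespace TTGeometry

noncomputable section

/-! ### Spectra -/

/-- The data on a category `C` from which its tensor-triangular spectrum is built: the shifts, the
distinguished triangles `X ⟶ Y ⟶ Z ⟶ X⟦1⟧`, and the tensor product of objects. It is only used
for the two instances `ttData K` and `modTTData A` below. -/
structure TTData (C : Type u) [Category.{v} C] where
  /-- the `n`-fold suspension -/
  shift : ℤ → C → C
  /-- the distinguished triangles -/
  dist : ∀ {X Y Z : C}, (X ⟶ Y) → (Y ⟶ Z) → (Z ⟶ shift 1 X) → Prop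
  /-- the tensor product of objects -/
  tensor : C → C → C

/-- Prime thick tensor ideals: proper classes of objects which are closed under zero objects,
shifts, "two out of three" in distinguished triangles, direct summands and tensoring with arbitrary
objects, and such that `x ⊗ y ∈ 𝒫` implies `x ∈ 𝒫` or `y ∈ 𝒫`. -/
@[ext]
structure Spc {C : Type u} [Category.{v} C] (D : TTData C) where
  /-- the objects of the prime -/
  carrier : Set C
  zero_mem : ∀ X : C, IsZero X → X ∈ carrier
  shift_mem : ∀ (n : ℤ) (X : C), X ∈ carrier → D.shift n X ∈ carrier
  dist_mem₁ : ∀ {X Y Z : C} (f : X ⟶ Y) (g : Y ⟶ Z) (h : Z ⟶ D.shift 1 X), D.dist f g h →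
    Y ∈ carrier → Z ∈ carrier → X ∈ carrier
  dist_mem₂ : ∀ {X Y Z : C} (f : X ⟶ Y) (g : Y ⟶ Z) (h : Z ⟶ D.shift 1 X), D.dist f g h →
    X ∈ carrier → Z ∈ carrier → Y ∈ carrier
  dist_mem₃ : ∀ {X Y Z : C} (f : X ⟶ Y) (g : Y ⟶ Z) (h : Z ⟶ D.shift 1 X), D.dist f g h →
    X ∈ carrier → Y ∈ carrier → Z ∈ carrier
  retract_mem : ∀ {X Y : C}, Retract X Y → Y ∈ carrier → X ∈ carrier
  tensor_mem : ∀ X Y : C, Y ∈ carrier → D.tensor X Y ∈ carrier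
  ne_univ : carrier ≠ Set.univ
  prime : ∀ X Y : C, D.tensor X Y ∈ carrier → X ∈ carrier ∨ Y ∈ carrier

/-- The topology on the spectrum generated by the sets `U(x) = {𝒫 | x ∈ 𝒫}`. -/
instance {C : Type u} [Category.{v} C] (D : TTData C) : TopologicalSpace (Spc D) :=
  TopologicalSpace.generateFrom (Set.range fun x : C => {P : Spc D | x ∈ P.carrier})

/-- The support `supp(x) = {𝒫 | x ∉ 𝒫}`. -/
def supp {C : Type u} [Category.{v} C] (D : TTData C) (x : C) : Set (Spc D) :=
  {P | x ∉ P.carrier}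

/-! ### Tensor-triangulated categories -/

section TT

variable (K : Type u) [Category.{v} K] [Preadditive K] [HasZeroObject K] [HasShift K ℤ]
  [∀ n : ℤ, (shiftFunctor K n).Additive] [Pretriangulated K] [MonoidalCategory K]

/-- The compatibility of a tensor product with a triangulation: the functors `X ⊗ -` are exact,
where the isomorphisms `X ⊗ Y⟦n⟧ ≅ (X ⊗ Y)⟦n⟧` are natural in `X` (and `Y`) and compatible with
the unit and the associativity constraints. -/
class TensorTriangulated where
  commShift (X : K) : (tensorLeft X).CommShift ℤ
  exact (X : K) : (tensorLeft X).IsTriangulated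
  natural {X X' : K} (f : X ⟶ X') (n : ℤ) (Y : K) :
    f ▷ (Y⟦n⟧) ≫ ((tensorLeft X').commShiftIso n).hom.app Y =
      ((tensorLeft X).commShiftIso n).hom.app Y ≫ (f ▷ Y)⟦n⟧'
  unit (n : ℤ) (Y : K) :
    ((tensorLeft (𝟙_ K)).commShiftIso n).hom.app Y ≫ (λ_ Y).hom⟦n⟧' = (λ_ (Y⟦n⟧)).hom
  assoc (X X' : K) (n : ℤ) (Y : K) :
    ((tensorLeft (X ⊗ X')).commShiftIso n).hom.app Y ≫ (α_ X X' Y).hom⟦n⟧' =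
      (α_ X X' (Y⟦n⟧)).hom ≫ X ◁ ((tensorLeft X').commShiftIso n).hom.app Y ≫
        ((tensorLeft X).commShiftIso n).hom.app (X' ⊗ Y)

attribute [reducible] TensorTriangulated.commShift
attribute [instance] TensorTriangulated.commShift TensorTriangulated.exact

/-- The shifts, distinguished triangles and tensor product of `K`. -/
def ttData : TTData K where
  shift n X := X⟦n⟧
  dist f g h := Triangle.mk f g h ∈ distTriang K
  tensor X Y := X ⊗ Y

end TT

/-! ### Ring objects and modules -/

section Modules

variable {K : Type u} [Category.{v} K] [MonoidalCategory K]

/-- A ring object `A` is separable if `μ : A ⊗ A ⟶ A` has an `A,A`-bilinear section. -/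
class IsSeparableRing (A : K) [MonObj A] : Prop where
  exists_section : ∃ σ : A ⟶ A ⊗ A, σ ≫ μ = 𝟙 A ∧
    σ ▷ A ≫ (α_ A A A).hom ≫ A ◁ μ = μ ≫ σ ∧ A ◁ σ ≫ (α_ A A A).inv ≫ μ ▷ A = μ ≫ σ

/-- The action `A ⊗ M ⟶ M` of an `A`-module. -/
abbrev act {A : K} [MonObj A] (M : Mod K A) : A ⊗ M.X ⟶ M.X := ModObj.smul (M := A) (X := M.X)

lemma one_act {A : K} [MonObj A] (M : Mod K A) : η ▷ M.X ≫ act M = (λ_ M.X).hom :=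
  ModObj.one_smul (M := A) M.X

lemma mul_act {A : K} [MonObj A] (M : Mod K A) :
    μ ▷ M.X ≫ act M = (α_ _ _ _).hom ≫ A ◁ act M ≫ act M :=
  ModObj.mul_smul (M := A) M.X

lemma act_hom {A : K} [MonObj A] {M N : Mod K A} (f : M ⟶ N) :
    act M ≫ f.hom = A ◁ f.hom ≫ act N :=
  IsModHom.smul_hom (A := A) (f := f.hom)

/-- Constructor for modules. -/
def mkMod {A : K} [MonObj A] (X : K) (a : A ⊗ X ⟶ X) (h₁ : η ▷ X ≫ a = (λ_ X).hom)
    (h₂ : μ ▷ X ≫ a = (α_ _ _ _).hom ≫ A ◁ a ≫ a) : Mod K A :=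
  letI : ModObj A X := { smul := a, one_smul := h₁, mul_smul := h₂ }
  ⟨X⟩

/-- Constructor for linear maps. -/
def mkHom {A : K} [MonObj A] {M N : Mod K A} (f : M.X ⟶ N.X)
    (h : act M ≫ f = A ◁ f ≫ act N) : M ⟶ N :=
  Mod.Hom.mk' f h

/-- The `B`-module `M ⊗ X`, for a `B`-module `M` and an object `X`. -/
def tensorObject {B : K} [MonObj B] (M : Mod K B) (X : K) : Mod K B :=
  mkMod (M.X ⊗ X) ((α_ B M.X X).inv ≫ act M ▷ X)
    (by
      rw [associator_inv_naturality_left_assoc, ← comp_whiskerRight, one_act]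
      monoidal)
    (by
      rw [associator_inv_naturality_left_assoc, ← comp_whiskerRight, mul_act]
      simp)

/-- The free module functor (extension of scalars `K ⟶ A-Mod`) on objects: `A ⊗ X` with the action
`μ ⊗ 1`. -/
def freeMod (A : K) [MonObj A] (X : K) : Mod K A :=
  tensorObject (Mod.regular A) X

instance [IsIdempotentComplete K] {B : K} [MonObj B] : IsIdempotentComplete (Mod K B) where
  idempotents_split M p hp := by
    obtain ⟨Y, i, e, hie, hei⟩ := IsIdempotentComplete.idempotents_split M.X p.hom
      (by simpa using congrArg Mod.Hom.hom hp)
    have key : B ◁ e ≫ B ◁ i = B ◁ p.hom := by rw [← whiskerLeft_comp, hei]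
    have hip : i ≫ p.hom = i := by rw [← hei, reassoc_of% hie]
    have hpe : p.hom ≫ e = e := by rw [← hei, assoc, hie, comp_id]
    have act_e : act M ≫ e = B ◁ e ≫ B ◁ i ≫ act M ≫ e := by
      rw [reassoc_of% key, ← reassoc_of% (act_hom p), hpe]
    let N : Mod K B := mkMod Y (B ◁ i ≫ act M ≫ e)
      (by
        rw [← whisker_exchange_assoc, reassoc_of% (one_act M), leftUnitor_naturality_assoc, hie,
          comp_id])
      (by
        rw [← whisker_exchange_assoc, reassoc_of% (mul_act M)]
        simp only [tensor_whiskerLeft, whiskerLeft_comp, assoc, Iso.inv_hom_id_assoc, ← act_e])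
    refine ⟨N, mkHom i ?_, mkHom e ?_, ?_, ?_⟩
    · change (B ◁ i ≫ act M ≫ e) ≫ i = B ◁ i ≫ act M
      rw [assoc, assoc, hei, act_hom p, ← whiskerLeft_comp_assoc, hip]
    · exact act_e
    · ext; exact hie
    · ext; exact hei

/-- In an idempotent complete category, a pair `f, g` which admits `t` such that `t ≫ g = 1` and
`f ≫ t ≫ f = g ≫ t ≫ f` has a (split) coequalizer. -/
lemma hasCoequalizer_of_contractible {C : Type u} [Category.{v} C] [IsIdempotentComplete C]
    {X Y : C} (f g : X ⟶ Y) (t : Y ⟶ X) (h₁ : t ≫ g = 𝟙 Y) (h₂ : f ≫ t ≫ f = g ≫ t ≫ f) :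
    HasCoequalizer f g := by
  obtain ⟨Z, i, e, hie, hei⟩ := IsIdempotentComplete.idempotents_split Y (t ≫ f)
    (by rw [assoc, h₂, reassoc_of% h₁])
  have hc : f ≫ e = g ≫ e := by
    have := congrArg (· ≫ e) h₂
    simpa [← hei, hie] using this
  have s : IsSplitCoequalizer f g e :=
    { rightSection := i, leftSection := t, condition := hc, rightSection_π := hie,
      leftSection_bottom := h₁, leftSection_top := hei.symm }
  exact ⟨⟨⟨_, s.isCoequalizer⟩⟩⟩

/-- For a separable ring object `A`, the action on every `A`-module has an `A`-linear section. -/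
lemma exists_linear_section {A : K} [MonObj A] [IsSeparableRing A] (N : Mod K A) :
    ∃ s : N.X ⟶ A ⊗ N.X, s ≫ act N = 𝟙 N.X ∧
      act N ≫ s = A ◁ s ≫ (α_ A A N.X).inv ≫ μ ▷ N.X := by
  obtain ⟨σ, h₁, h₂, h₃⟩ := IsSeparableRing.exists_section (A := A)
  have e₂ : (λ_ A).inv ≫ (η ≫ σ) ▷ A ≫ (α_ A A A).hom ≫ A ◁ μ = σ := by
    rw [comp_whiskerRight, assoc, h₂, MonObj.one_mul_assoc, Iso.inv_hom_id_assoc]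
  have e₃ : (ρ_ A).inv ≫ A ◁ (η ≫ σ) ≫ (α_ A A A).inv ≫ μ ▷ A = σ := by
    rw [whiskerLeft_comp, assoc, h₃, MonObj.mul_one_assoc, Iso.inv_hom_id_assoc]
  refine ⟨(λ_ N.X).inv ≫ (η ≫ σ) ▷ N.X ≫ (α_ A A N.X).hom ≫ A ◁ act N, ?_, ?_⟩
  · have h : A ◁ act N ≫ act N = (α_ A A N.X).inv ≫ μ ▷ N.X ≫ act N := by
      rw [mul_act, Iso.inv_hom_id_assoc]
    simp only [assoc, h, Iso.hom_inv_id_assoc, ← comp_whiskerRight_assoc, h₁, comp_id, one_act,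
      Iso.inv_hom_id]
  · have lhs : act N ≫ (λ_ N.X).inv ≫ (η ≫ σ) ▷ N.X ≫ (α_ A A N.X).hom ≫ A ◁ act N =
        σ ▷ N.X ≫ (α_ A A N.X).hom ≫ A ◁ act N := by
      rw [leftUnitor_inv_naturality_assoc, whisker_exchange_assoc]
      rw [associator_naturality_right_assoc, ← whiskerLeft_comp]
      have h : A ◁ act N ≫ act N = (α_ A A N.X).inv ≫ μ ▷ N.X ≫ act N := by
        rw [mul_act, Iso.inv_hom_id_assoc]
      rw [h]
      conv_rhs => rw [← e₂]
      simp only [comp_whiskerRight, assoc, whiskerLeft_comp]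
      monoidal
    have rhs : A ◁ ((λ_ N.X).inv ≫ (η ≫ σ) ▷ N.X ≫ (α_ A A N.X).hom ≫ A ◁ act N) ≫
        (α_ A A N.X).inv ≫ μ ▷ N.X = σ ▷ N.X ≫ (α_ A A N.X).hom ≫ A ◁ act N := by
      conv_rhs => rw [← e₃]
      simp only [whiskerLeft_comp, assoc, associator_inv_naturality_right_assoc,
        whisker_exchange, comp_whiskerRight]
      monoidal
    rw [lhs, rhs]

variable [SymmetricCategory K]

lemma act_comm {B : K} [MonObj B] [IsCommMonObj B] (M : Mod K B) :
    (α_ B B M.X).inv ≫ (β_ B B).hom ▷ M.X ≫ (α_ B B M.X).hom ≫ B ◁ act M ≫ act M =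
      B ◁ act M ≫ act M := by
  rw [← mul_act, ← comp_whiskerRight_assoc, IsCommMonObj.mul_comm, mul_act, Iso.inv_hom_id_assoc]

/-- The right action `M ⊗ A ⟶ M` on a `B`-module `M`, through a morphism `f : A ⟶ B` (a homomorphism
to a commutative ring object). -/
def rightAct {A B : K} [MonObj B] (f : A ⟶ B) (M : Mod K B) : M.X ⊗ A ⟶ M.X :=
  M.X ◁ f ≫ (β_ M.X B).hom ≫ act M

lemma act_rightAct {A B : K} [MonObj B] [IsCommMonObj B] (f : A ⟶ B) (M : Mod K B) :
    act M ▷ A ≫ rightAct f M = (α_ B M.X A).hom ≫ B ◁ rightAct f M ≫ act M := by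
  unfold rightAct
  rw [← whisker_exchange_assoc, BraidedCategory.braiding_naturality_left_assoc,
    BraidedCategory.braiding_tensor_left_hom]
  simp only [assoc, act_comm, whiskerLeft_comp]
  simp

lemma rightAct_rightAct {A B : K} [MonObj A] [MonObj B] [IsCommMonObj B] (f : A ⟶ B) [IsMonHom f]
    (M : Mod K B) :
    rightAct f M ▷ A ≫ rightAct f M = (α_ M.X A A).hom ≫ M.X ◁ μ ≫ rightAct f M := by
  unfold rightAct
  rw [← whiskerLeft_comp_assoc, IsMonHom.mul_hom, ← whisker_exchange_assoc, tensorHom_def']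
  simp only [comp_whiskerRight, whiskerLeft_comp, assoc,
    BraidedCategory.braiding_naturality_left_assoc, BraidedCategory.braiding_naturality_right_assoc,
    BraidedCategory.braiding_tensor_left_hom, BraidedCategory.braiding_tensor_right_hom, mul_act,
    act_comm]
  rw [Iso.inv_hom_id_assoc, ← associator_naturality_right_assoc,
    ← associator_naturality_middle_assoc, Iso.hom_inv_id_assoc, ← comp_whiskerRight_assoc,
    ← comp_whiskerRight_assoc, BraidedCategory.braiding_naturality_right]

section Relative

variable {A B : K} [MonObj A] [MonObj B] [IsCommMonObj B] (f : A ⟶ B)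

/-- The first of the two maps `M ⊗ A ⊗ N ⟶ M ⊗ N`, given by the right action on `M`. -/
def relLeft (M : Mod K B) (N : Mod K A) :
    tensorObject (tensorObject M A) N.X ⟶ tensorObject M N.X :=
  mkHom (rightAct f M ▷ N.X) (by
    change ((α_ B (M.X ⊗ A) N.X).inv ≫ ((α_ B M.X A).inv ≫ act M ▷ A) ▷ N.X) ≫ rightAct f M ▷ N.X =
      B ◁ (rightAct f M ▷ N.X) ≫ (α_ B M.X N.X).inv ≫ act M ▷ N.X
    rw [assoc, ← comp_whiskerRight, assoc, act_rightAct, Iso.inv_hom_id_assoc]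
    simp)

/-- The second of the two maps `M ⊗ A ⊗ N ⟶ M ⊗ N`, given by the action on `N`. -/
def relRight (M : Mod K B) (N : Mod K A) :
    tensorObject (tensorObject M A) N.X ⟶ tensorObject M N.X :=
  mkHom ((α_ M.X A N.X).hom ≫ M.X ◁ act N) (by
    change ((α_ B (M.X ⊗ A) N.X).inv ≫ ((α_ B M.X A).inv ≫ act M ▷ A) ▷ N.X) ≫
        (α_ M.X A N.X).hom ≫ M.X ◁ act N =
      B ◁ ((α_ M.X A N.X).hom ≫ M.X ◁ act N) ≫ (α_ B M.X N.X).inv ≫ act M ▷ N.X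
    have := whisker_exchange (act M) (act N)
    simp only [comp_whiskerRight, assoc, associator_naturality_left_assoc, ← this]
    monoidal)

/-- Over a separable ring object, the coequalizers which define relative tensor products exist. -/
instance [IsIdempotentComplete K] [IsSeparableRing A] [IsMonHom f] (M : Mod K B) (N : Mod K A) :
    HasCoequalizer (relLeft f M N) (relRight M N) := by
  obtain ⟨s, h₁, h₂⟩ := exists_linear_section N
  refine hasCoequalizer_of_contractible _ _
    (mkHom (M.X ◁ s ≫ (α_ M.X A N.X).inv) ?_) ?_ ?_
  · change ((α_ B M.X N.X).inv ≫ act M ▷ N.X) ≫ M.X ◁ s ≫ (α_ M.X A N.X).inv =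
      B ◁ (M.X ◁ s ≫ (α_ M.X A N.X).inv) ≫ (α_ B (M.X ⊗ A) N.X).inv ≫
        ((α_ B M.X A).inv ≫ act M ▷ A) ▷ N.X
    rw [assoc, ← whisker_exchange_assoc]
    monoidal
  · ext
    change (M.X ◁ s ≫ (α_ M.X A N.X).inv) ≫ (α_ M.X A N.X).hom ≫ M.X ◁ act N = 𝟙 (M.X ⊗ N.X)
    rw [assoc, Iso.inv_hom_id_assoc, ← whiskerLeft_comp, h₁, whiskerLeft_id]
  · ext
    change rightAct f M ▷ N.X ≫ (M.X ◁ s ≫ (α_ M.X A N.X).inv) ≫ rightAct f M ▷ N.X =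
      ((α_ M.X A N.X).hom ≫ M.X ◁ act N) ≫ (M.X ◁ s ≫ (α_ M.X A N.X).inv) ≫ rightAct f M ▷ N.X
    have e₁ := congrArg (M.X ◁ ·) h₂
    simp only [whiskerLeft_comp] at e₁
    have e₂ := rightAct_rightAct f M
    simp only [assoc, reassoc_of% e₁]
    rw [← whisker_exchange_assoc, associator_inv_naturality_left_assoc, ← comp_whiskerRight, e₂]
    simp

/-- The relative tensor product `M ⊗_A N` of a `B`-module `M` and an `A`-module `N` along a
homomorphism `f : A ⟶ B` of commutative ring objects, with its `B`-action: the coequalizer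
of `M ⊗ A ⊗ N ⇉ M ⊗ N` in `B`-modules. -/
def relTensor [IsIdempotentComplete K] [IsSeparableRing A] [IsMonHom f] (M : Mod K B) (N : Mod K A) :
    Mod K B :=
  coequalizer (relLeft f M N) (relRight M N)

/-- Extension of scalars `B ⊗_A N` of an `A`-module `N` along a homomorphism `f : A ⟶ B` of
commutative ring objects. -/
def extendScalars [IsIdempotentComplete K] [IsSeparableRing A] [IsMonHom f] (N : Mod K A) : Mod K B :=
  relTensor f (Mod.regular B) N

end Relative

lemma tensorμ_involutive (X₁ X₂ Y₁ Y₂ : K) :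
    tensorμ X₁ X₂ Y₁ Y₂ ≫ tensorμ X₁ Y₁ X₂ Y₂ = 𝟙 _ := by
  have h : (β_ X₂ Y₁).hom ▷ Y₂ ≫ (β_ Y₁ X₂).hom ▷ Y₂ = 𝟙 _ := by
    rw [← comp_whiskerRight, SymmetricCategory.symmetry, id_whiskerRight]
  simp only [tensorμ, assoc, Iso.inv_hom_id_assoc]
  rw [← whiskerLeft_comp_assoc, ← whiskerLeft_comp_assoc, ← whiskerLeft_comp_assoc, assoc, assoc,
    ← whiskerLeft_comp_assoc]
  simp [h]

/-- `A ⊗ B` is separable if `A` and `B` are. -/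
instance {A B : K} [MonObj A] [MonObj B] [IsSeparableRing A] [IsSeparableRing B] : IsSeparableRing (A ⊗ B) := by
  obtain ⟨σ, h₁, h₂, h₃⟩ := IsSeparableRing.exists_section (A := A)
  obtain ⟨τ, k₁, k₂, k₃⟩ := IsSeparableRing.exists_section (A := B)
  refine ⟨(σ ⊗ₘ τ) ≫ tensorμ A A B B, ?_, ?_, ?_⟩
  · change ((σ ⊗ₘ τ) ≫ tensorμ A A B B) ≫ tensorμ A B A B ≫ (μ ⊗ₘ μ) = 𝟙 (A ⊗ B)
    rw [assoc, reassoc_of% (tensorμ_involutive A A B B), tensorHom_comp_tensorHom, h₁, k₁,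
      id_tensorHom_id]
  · change ((σ ⊗ₘ τ) ≫ tensorμ A A B B) ▷ (A ⊗ B) ≫ (α_ (A ⊗ B) (A ⊗ B) (A ⊗ B)).hom ≫
        (A ⊗ B) ◁ (tensorμ A B A B ≫ (μ ⊗ₘ μ)) =
      (tensorμ A B A B ≫ (μ ⊗ₘ μ)) ≫ (σ ⊗ₘ τ) ≫ tensorμ A A B B
    have key : tensorμ A A B B ▷ (A ⊗ B) ≫ (α_ (A ⊗ B) (A ⊗ B) (A ⊗ B)).hom ≫
        (A ⊗ B) ◁ tensorμ A B A B =
        tensorμ (A ⊗ A) (B ⊗ B) A B ≫ ((α_ A A A).hom ⊗ₘ (α_ B B B).hom) ≫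
          tensorμ A (A ⊗ A) B (B ⊗ B) := by
      have e := associator_monoidal_assoc A A A B B B ((A ⊗ B) ◁ tensorμ A B A B)
      rw [← whiskerLeft_comp, tensorμ_involutive, whiskerLeft_id, comp_id] at e
      rw [← e, reassoc_of% (tensorμ_involutive (A ⊗ A) (B ⊗ B) A B)]
    have nat₁ := tensorμ_natural_left σ τ A B
    have nat₃ := tensorμ_natural (𝟙 A) (μ : A ⊗ A ⟶ A) (𝟙 B) (μ : B ⊗ B ⟶ B)
    simp only [id_tensorHom, tensorHom_id, id_whiskerRight] at nat₃
    rw [comp_whiskerRight, whiskerLeft_comp, assoc, reassoc_of% key, ← nat₃, reassoc_of% nat₁,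
      assoc, tensorHom_comp_tensorHom_assoc, tensorHom_comp_tensorHom_assoc, assoc, assoc,
      h₂, k₂, tensorHom_comp_tensorHom_assoc]
  · change (A ⊗ B) ◁ ((σ ⊗ₘ τ) ≫ tensorμ A A B B) ≫ (α_ (A ⊗ B) (A ⊗ B) (A ⊗ B)).inv ≫
        (tensorμ A B A B ≫ (μ ⊗ₘ μ)) ▷ (A ⊗ B) =
      (tensorμ A B A B ≫ (μ ⊗ₘ μ)) ≫ (σ ⊗ₘ τ) ≫ tensorμ A A B B
    have key : (A ⊗ B) ◁ tensorμ A A B B ≫ (α_ (A ⊗ B) (A ⊗ B) (A ⊗ B)).inv ≫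
        tensorμ A B A B ▷ (A ⊗ B) =
        tensorμ A B (A ⊗ A) (B ⊗ B) ≫ ((α_ A A A).inv ⊗ₘ (α_ B B B).inv) ≫
          tensorμ (A ⊗ A) A (B ⊗ B) B := by
      have e := associator_monoidal A A A B B B
      have e' : (A ⊗ B) ◁ tensorμ A A B B = tensorμ A B (A ⊗ A) (B ⊗ B) ≫
          ((α_ A A A).inv ⊗ₘ (α_ B B B).inv) ≫ tensorμ (A ⊗ A) A (B ⊗ B) B ≫
            tensorμ A A B B ▷ (A ⊗ B) ≫ (α_ (A ⊗ B) (A ⊗ B) (A ⊗ B)).hom := by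
        rw [e, tensorHom_comp_tensorHom_assoc, Iso.inv_hom_id, Iso.inv_hom_id, id_tensorHom_id,
          id_comp, reassoc_of% (tensorμ_involutive A B (A ⊗ A) (B ⊗ B))]
      rw [e']
      simp only [assoc, Iso.hom_inv_id_assoc]
      rw [← comp_whiskerRight, tensorμ_involutive, id_whiskerRight, comp_id]
    have nat₁ := tensorμ_natural_right A B σ τ
    have nat₃ := tensorμ_natural (μ : A ⊗ A ⟶ A) (𝟙 A) (μ : B ⊗ B ⟶ B) (𝟙 B)
    simp only [tensorHom_id, id_whiskerRight] at nat₃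
    rw [comp_whiskerRight, whiskerLeft_comp, assoc, reassoc_of% key, ← nat₃, reassoc_of% nat₁,
      assoc, tensorHom_comp_tensorHom_assoc, tensorHom_comp_tensorHom_assoc, assoc, assoc,
      h₃, k₃, tensorHom_comp_tensorHom_assoc]

/-- The homomorphism `1 ⊗ η : A ⟶ A ⊗ A`. -/
def inclLeft (A : K) [MonObj A] : A ⟶ A ⊗ A := (ρ_ A).inv ≫ A ◁ (η : 𝟙_ K ⟶ A)

/-- The homomorphism `η ⊗ 1 : A ⟶ A ⊗ A`. -/
def inclRight (A : K) [MonObj A] : A ⟶ A ⊗ A := (λ_ A).inv ≫ (η : 𝟙_ K ⟶ A) ▷ A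

lemma isMonHom_one (A : K) [MonObj A] : IsMonHom (η : 𝟙_ K ⟶ A) where
  one_hom := by simp
  mul_hom := by
    simp [MonoidalCategory.tensorHom_def, unitors_equal]

instance (A : K) [MonObj A] : IsMonHom (inclLeft A) := by
  have : IsMonHom (ρ_ A).inv := inferInstance
  have := isMonHom_one A
  have : IsMonHom (A ◁ (η : 𝟙_ K ⟶ A)) := inferInstance
  unfold inclLeft; infer_instance

instance (A : K) [MonObj A] : IsMonHom (inclRight A) := by
  have := isMonHom_one A
  have : IsMonHom (λ_ A).inv := inferInstance
  unfold inclRight; infer_instance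

end Modules

/-! ### The tensor-triangular structure on modules -/

section ModTT

variable {K : Type u} [Category.{v} K] [Preadditive K] [HasZeroObject K] [HasShift K ℤ]
  [∀ n : ℤ, (shiftFunctor K n).Additive] [Pretriangulated K] [MonoidalCategory K]
  [TensorTriangulated K]

/-- The shift of an `A`-module: `M⟦n⟧` with the action `A ⊗ M⟦n⟧ ≅ (A ⊗ M)⟦n⟧ ⟶ M⟦n⟧`. -/
def shiftMod {A : K} [MonObj A] (n : ℤ) (M : Mod K A) : Mod K A :=
  mkMod (M.X⟦n⟧) (((tensorLeft A).commShiftIso n).hom.app M.X ≫ (act M)⟦n⟧')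
    (by
      rw [reassoc_of% (TensorTriangulated.natural (η : 𝟙_ K ⟶ A) n M.X), ← Functor.map_comp,
        one_act, TensorTriangulated.unit])
    (by
      have nat := (tensorLeft A).commShiftIso_hom_naturality (act M) n
      simp only [curriedTensor_obj_map] at nat
      rw [reassoc_of% (TensorTriangulated.natural (μ : A ⊗ A ⟶ A) n M.X), ← Functor.map_comp,
        mul_act, Functor.map_comp, Functor.map_comp,
        reassoc_of% (TensorTriangulated.assoc A A n M.X), whiskerLeft_comp, assoc,
        ← reassoc_of% nat])

/-- The shifts, distinguished triangles and tensor product `⊗_A` of the category of modules over a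
separable commutative ring object `A`. A triangle of `A`-modules is distinguished if the underlying
triangle in `K` is. -/
def modTTData [SymmetricCategory K] [IsIdempotentComplete K] (A : K) [MonObj A] [IsCommMonObj A]
    [IsSeparableRing A] : TTData (Mod K A) where
  shift n M := shiftMod n M
  dist {L _ N} f g h :=
    Triangle.mk f.hom g.hom (show N.X ⟶ L.X⟦(1 : ℤ)⟧ from h.hom) ∈ distTriang K
  tensor M N := relTensor (𝟙 A) M N

end ModTT

/-! ### The degree of a ring object -/

section Degree

variable {K : Type u} [Category.{v} K] [Preadditive K] [HasBinaryBiproducts K]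
  [MonoidalCategory K] [SymmetricCategory K]

/-- For a homomorphism `f : B ⟶ C` of commutative ring objects, this says that a commutative ring
object `C'` with `g : C ⟶ C'` is the complement of `μ` in `C ⊗_B C`: there is an isomorphism
`C ⊗_B C ≅ C × C'` of ring objects whose first component is induced by `μ`, and for which
the second component restricts to `g` along `1 ⊗ η : C ⟶ C ⊗_B C`.
Here `C ⊗_B C` is the coequalizer of `C ⊗ B ⊗ C ⇉ C ⊗ C`, and the second component of
the isomorphism is given by a homomorphism `h : C ⊗ C ⟶ C'`. -/
def IsSplitting {B C C' : CommMon K} (f : B ⟶ C) (g : C ⟶ C') : Prop :=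
  ∃ (h : C.X ⊗ C.X ⟶ C'.X) (_ : IsMonHom h) (w : ((C.X ◁ f.hom.hom ≫ μ) ▷ C.X) ≫ biprod.lift μ h =
      ((α_ C.X B.X C.X).hom ≫ C.X ◁ (f.hom.hom ▷ C.X ≫ μ)) ≫ biprod.lift μ h),
    inclLeft C.X ≫ h = g.hom.hom ∧ Nonempty (IsColimit (Cofork.ofπ (biprod.lift μ h) w))

/-- A splitting tower `A^[0] ⟶ A^[1] ⟶ A^[2] ⟶ ⋯` of a commutative ring object `A`:
`A^[0] = 𝟙`, `A^[1] = A` and `A^[n+1] ⊗_{A^[n]} A^[n+1] ≅ A^[n+1] × A^[n+2]` as above. -/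
structure SplittingTower (A : CommMon K) where
  /-- the ring object `A^[n]` -/
  ring : ℕ → CommMon K
  /-- the homomorphism `A^[n] ⟶ A^[n+1]` -/
  map : ∀ n, ring n ⟶ ring (n + 1)
  /-- `A^[0] = 𝟙` -/
  isoZero : ring 0 ≅ CommMon.trivial K
  /-- `A^[1] = A` -/
  isoOne : ring 1 ≅ A
  isSplitting : ∀ n, IsSplitting (map n) (map (n + 1))

/-- `A` has finite degree if its splitting tower reaches `0` (the degree is then the
last `n` such that `A^[n] ≠ 0`). -/
def HasFiniteDegree (A : K) [MonObj A] [IsCommMonObj A] : Prop :=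
  ∃ (T : SplittingTower (CommMon.mk A)) (n : ℕ), IsZero (T.ring n).X

end Degree

/-! ### Coequalizers of topological spaces -/

/-- `p : Y → Z` is the coequalizer of `f, g : X ⇉ Y` in topological spaces. -/
def IsTopCoequalizer {X Y Z : Type*} [TopologicalSpace X] [TopologicalSpace Y] [TopologicalSpace Z]
    (f g : C(X, Y)) (p : C(Y, Z)) : Prop :=
  p.comp f = p.comp g ∧ ∀ (T : Type w) [TopologicalSpace T] (k : C(Y, T)),
    k.comp f = k.comp g → ∃! l : C(Z, T), l.comp p = k

end

end TTGeometry

open TTGeometry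

namespace TTGeometry
open Set

/-! ### Commutative monoids with a system of ideals -/

/-! The argument is commutative algebra with thick tensor ideals in place of ideals. An extension of
scalars `F` has a restriction `U` with a projection formula `U (F x ⊗ m) ≅ x ⊗ U m`, and by
separability every module `m` is a retract of `F (U m)`. From these two facts,
`Extension.exists_isPrime_over` lifts a prime `Q` to a prime avoiding any multiplicative set `S`
with `U s ∉ Q` for all `s ∈ S`. Taking `S` trivial shows that `φ_A` maps onto `supp(A)`; taking for
`S` the objects lying in no prime of a closed set shows that `φ_A` is closed. A continuous closed
surjection is a topological quotient map, so only its fibres remain to be determined.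

Let `Q₁, Q₂` have the same image. Lift `Q₂` along `φ₂` to a prime `T` avoiding the image under `F₁`
of the complement of `Q₁`; the base change isomorphism `F_A (U M) ≅ U₂ (F₁ M)` makes this possible.
Then `φ₂ T = Q₂`, while `φ₁ T ⊆ Q₁` lies in the same fibre. Equality `φ₁ T = Q₁` is exactly
incomparability: there are no strict inclusions within fibres of `φ_A`
(`Extension.exists_isPrime_pair`).

Incomparability is where finite degree enters, by descending induction along the splitting tower `B
→ C → D`. The decomposition `C ⊗_B C ≅ C × D` makes `C ⊗_B M` a summand of `M ⊕ (D ⊗_C M)`, and this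
suffices to pass incomparability from `C → D` to `B → C` (`Extension.incomparable_of_splitting`).
Once the tower reaches `0`, there are no primes at all.

The categorical half supplies the hypotheses. Separability makes every relative tensor product the
image of an idempotent on `M ⊗ N`, hence a split coequalizer preserved by every functor. The
required isomorphisms are then comparisons of two quotients of one object
(`nonempty_iso_of_factors`), and exactness follows because the relevant triangles are retracts of
distinguished ones (`distinguished_of_retract`). -/

/-- A commutative monoid with a system of ideals, stable under intersections, unions of chains and
colons. -/
class IdealMonoid (M : Type*) extends CommMonoid M where
  /-- the ideals -/
  IsIdeal : Set M → Prop
  mul_mem {I : Set M} : IsIdeal I → ∀ x {y : M}, y ∈ I → x * y ∈ I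
  isIdeal_sInter {𝒮 : Set (Set M)} : (∀ I ∈ 𝒮, IsIdeal I) → IsIdeal (⋂₀ 𝒮)
  isIdeal_sUnion {𝒮 : Set (Set M)} : 𝒮.Nonempty → IsChain (· ⊆ ·) 𝒮 → (∀ I ∈ 𝒮, IsIdeal I) →
    IsIdeal (⋃₀ 𝒮)
  isIdeal_colon {I : Set M} (x : M) : IsIdeal I → IsIdeal {y | x * y ∈ I}

namespace IdealMonoid

variable {M N : Type*} [IdealMonoid M] [IdealMonoid N]

/-- Prime ideals. -/
structure IsPrime (I : Set M) : Prop where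
  isIdeal : IsIdeal I
  one_notMem : (1 : M) ∉ I
  mem_or_mem : ∀ {x y : M}, x * y ∈ I → x ∈ I ∨ y ∈ I

/-- The complement of a prime ideal. -/
def IsPrime.compl {I : Set M} (h : IsPrime I) : Submonoid M where
  carrier := Iᶜ
  one_mem' := h.one_notMem
  mul_mem' ha hb hab := (h.mem_or_mem hab).elim ha hb

/-- An ideal which is disjoint from a submonoid is contained in a prime with this property. -/
lemma exists_isPrime {J : Set M} (hJ : IsIdeal J) (S : Submonoid M) (hS : ∀ s ∈ S, s ∉ J) :
    ∃ Q, IsPrime Q ∧ J ⊆ Q ∧ ∀ s ∈ S, s ∉ Q := by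
  obtain ⟨Q, hJQ, hQ⟩ := zorn_subset_nonempty {I : Set M | IsIdeal I ∧ ∀ s ∈ S, s ∉ I}
    (fun c hc hchain hne ↦ ⟨⋃₀ c, ⟨isIdeal_sUnion hne hchain fun I hI ↦ (hc hI).1, by
      rintro s hs ⟨I, hI, hsI⟩
      exact (hc hI).2 s hs hsI⟩, fun I hI ↦ subset_sUnion_of_mem hI⟩) J ⟨hJ, hS⟩
  -- By maximality, the ideal generated by `Q` and `a` meets `S`. Writing that ideal as an
  -- intersection avoids describing its elements.
  have key : ∀ a ∉ Q, ∃ s ∈ S, ∀ I, IsIdeal I → Q ⊆ I → a ∈ I → s ∈ I := by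
    intro a ha
    by_contra! h
    refine ha (hQ.2 (y := ⋂₀ {I | IsIdeal I ∧ Q ⊆ I ∧ a ∈ I}) ⟨isIdeal_sInter fun I hI ↦ hI.1, ?_⟩
      (fun x hx I hI ↦ hI.2.1 hx) fun I hI ↦ hI.2.2)
    intro s hs hsI
    obtain ⟨I, h₁, h₂, h₃, h₄⟩ := h s hs
    exact h₄ (hsI I ⟨h₁, h₂, h₃⟩)
  refine ⟨Q, ⟨hQ.1.1, hQ.1.2 1 S.one_mem, fun {x y} hxy ↦ ?_⟩, hJQ, hQ.1.2⟩
  by_contra! h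
  obtain ⟨s, hs, hs'⟩ := key x h.1
  obtain ⟨t, ht, ht'⟩ := key y h.2
  -- Colon ideals let `x` be replaced by `s`, and then `y` by `t`, in `x * y ∈ Q`. The result `s * t
  -- ∈ Q` contradicts that `Q` avoids `S`.
  have h₁ : s * y ∈ Q := by
    have := hs' _ (isIdeal_colon y hQ.1.1) (fun z hz ↦ mul_mem hQ.1.1 y hz)
      (by rwa [mem_ofPred_eq, mul_comm])
    rwa [mem_ofPred_eq, mul_comm] at this
  exact hQ.1.2 _ (S.mul_mem hs ht)
    (ht' _ (isIdeal_colon s hQ.1.1) (fun z hz ↦ mul_mem hQ.1.1 s hz) h₁)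

/-- If `x` and `y` are each missing from some member of the chain, the smaller of these two members
misses both. This provides minimal primes in fibres. -/
lemma isPrime_sInter {c : Set (Set M)} (hne : c.Nonempty) (hchain : IsChain (· ⊆ ·) c)
    (hc : ∀ I ∈ c, IsPrime I) : IsPrime (⋂₀ c) := by
  obtain ⟨I₀, hI₀⟩ := hne
  refine ⟨isIdeal_sInter fun I hI ↦ (hc I hI).isIdeal,
    fun h ↦ (hc I₀ hI₀).one_notMem (h I₀ hI₀), fun {x y} hxy ↦ ?_⟩
  by_contra! h
  obtain ⟨⟨I, hI, hxI⟩, J, hJ, hyJ⟩ : (∃ I ∈ c, x ∉ I) ∧ ∃ J ∈ c, y ∉ J := by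
    simpa [mem_sInter] using h
  rcases hchain.total hI hJ with hIJ | hIJ
  · exact ((hc I hI).mem_or_mem (hxy I hI)).elim hxI fun h ↦ hyJ (hIJ h)
  · exact ((hc J hJ).mem_or_mem (hxy J hJ)).elim (fun h ↦ hxI (hIJ h)) hyJ

/-! ### Lying over, incomparability and fibres for extensions of monoids with ideals -/

variable (M N) in
/-- An extension of scalars `F` together with its restriction `U`. -/
structure Extension where
  /-- extension of scalars -/
  F : M →* N
  /-- restriction of scalars -/
  U : N → M
  isIdeal_F {I : Set N} : IsIdeal I → IsIdeal (F ⁻¹' I)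
  isIdeal_U {I : Set M} : IsIdeal I → IsIdeal (U ⁻¹' I)
  U_mul (x : M) (n : N) : U (F x * n) = x * U n
  mem_of_F_U {I : Set N} : IsIdeal I → ∀ {n}, F (U n) ∈ I → n ∈ I

namespace Extension

variable (e : Extension M N)

lemma isPrime_F {Q : Set N} (hQ : IsPrime Q) : IsPrime (e.F ⁻¹' Q) where
  isIdeal := e.isIdeal_F hQ.isIdeal
  one_notMem := by simpa using hQ.one_notMem
  mem_or_mem h := hQ.mem_or_mem (by simpa using h)

/-- By the projection formula, `F x * n` lies in the ideal `U⁻¹ Q` exactly when `x * U n ∈ Q`. So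
this ideal avoids the products of elements of `S` with images of elements outside `Q`, and any prime
containing it and avoiding these products restricts to `Q`. -/
lemma exists_isPrime_over {Q : Set M} (hQ : IsPrime Q) (S : Submonoid N)
    (hS : ∀ s ∈ S, e.U s ∉ Q) : ∃ T, IsPrime T ∧ e.F ⁻¹' T = Q ∧ ∀ s ∈ S, s ∉ T := by
  obtain ⟨T, hT, hJT, hST⟩ := exists_isPrime (e.isIdeal_U hQ.isIdeal) (hQ.compl.map e.F ⊔ S) (by
    intro s hs hs'
    obtain ⟨_, ⟨x, hx, rfl⟩, n, hn, rfl⟩ := Submonoid.mem_sup.1 hs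
    rw [mem_preimage, e.U_mul] at hs'
    exact (hQ.mem_or_mem hs').elim hx (hS n hn))
  refine ⟨T, hT, Subset.antisymm (fun x hx ↦ ?_) fun x hx ↦ hJT ?_, fun s hs ↦
    hST s (Submonoid.mem_sup_right hs)⟩
  · by_contra hxQ
    exact hST _ (Submonoid.mem_sup_left ⟨x, hxQ, rfl⟩) hx
  · have := e.U_mul x 1
    rw [_root_.mul_one] at this
    rw [mem_preimage, this, mul_comm]
    exact mul_mem hQ.isIdeal _ hx

/-- Two primes with the same restriction, one contained in the other, are equal. -/
def Incomparable : Prop :=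
  ∀ ⦃Q' Q : Set N⦄, IsPrime Q' → IsPrime Q → Q' ⊆ Q → e.F ⁻¹' Q' = e.F ⁻¹' Q → Q' = Q

/-- For two extensions `g₁, g₂` of `e`, equal on the base, such that `F_e (U_e m)` lies in every
ideal containing `m` and `U_{g₂} (F_{g₁} m)`, incomparability descends from `g₁` to `e`. -/
lemma incomparable_of_splitting {L : Type*} [IdealMonoid L] (g₁ g₂ : Extension N L)
    (hg : ∀ x, g₁.F (e.F x) = g₂.F (e.F x))
    (hs : ∀ I, IsIdeal I → ∀ m, m ∈ I → g₂.U (g₁.F m) ∈ I → e.F (e.U m) ∈ I)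
    (h : g₁.Incomparable) : e.Incomparable := by
  intro Q'' Q hQ'' hQ hle heq
  -- Replace `Q''` by a minimal prime of its fibre: then a restriction along `g₁` that is contained
  -- in `Q'` and lies in the fibre must equal `Q'`.
  obtain ⟨Q', hQ'le, hQ'⟩ := zorn_superset_nonempty
    {I : Set N | IsPrime I ∧ e.F ⁻¹' I = e.F ⁻¹' Q}
    (fun c hc hchain hne ↦ ⟨⋂₀ c, ⟨isPrime_sInter hne hchain fun I hI ↦ (hc hI).1, by
      obtain ⟨I₀, hI₀⟩ := hne
      ext x
      refine ⟨fun hx ↦ ?_, fun hx I hI ↦ ?_⟩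
      · rw [← (hc hI₀).2]
        exact hx I₀ hI₀
      · have : x ∈ e.F ⁻¹' I := by rwa [(hc hI).2]
        exact this⟩, fun I hI ↦ sInter_subset_of_mem hI⟩) Q'' ⟨hQ'', heq⟩
  have hmin : ∀ I, IsPrime I → e.F ⁻¹' I = e.F ⁻¹' Q → I ⊆ Q' → I = Q' :=
    fun I h₁ h₂ h₃ ↦ Subset.antisymm h₃ (hQ'.2 ⟨h₁, h₂⟩ h₃)
  obtain ⟨hQ'p, hQ'eq⟩ := hQ'.1
  have hQ'Q : Q' ⊆ Q := hQ'le.trans hle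
  suffices Q ⊆ Q' from Subset.antisymm hle (this.trans hQ'le)
  intro m₀ hm₀
  by_contra hm₀'
  have hmem : ∀ I, IsPrime I → g₁.F ⁻¹' I ⊆ Q' → e.F ⁻¹' (g₂.F ⁻¹' I) = e.F ⁻¹' Q →
      g₁.F ⁻¹' I = Q' := by
    intro I hI hle' heq'
    refine hmin _ (g₁.isPrime_F hI) ?_ hle'
    rw [← heq']
    ext x
    simp only [mem_preimage, hg]
  -- `T` is to lie over `Q` along `g₂` and inside `Q'` along `g₁`. The obstruction is some `m ∉ Q'`
  -- with `U_{g₂} (F_{g₁} m) ∈ Q`. Multiplying by `m₀ ∈ Q` puts both arguments of `hs` in `Q`, so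
  -- `e.F (e.U (m * m₀))` lies in `Q`, hence in `Q'` as both have the same restriction. This forces
  -- `m * m₀ ∈ Q'`, although neither factor is in `Q'`.
  obtain ⟨T, hT, hTQ, hTS⟩ := g₂.exists_isPrime_over hQ (hQ'p.compl.map g₁.F) (by
    rintro _ ⟨m, hm, rfl⟩ hmU
    have h₁ : g₂.U (g₁.F (m * m₀)) ∈ Q := by
      rw [map_mul, mul_comm]
      exact mul_mem (g₂.isIdeal_U hQ.isIdeal) _ hmU
    have h₂ : e.U (m * m₀) ∈ e.F ⁻¹' Q := hs Q hQ.isIdeal _ (mul_mem hQ.isIdeal _ hm₀) h₁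
    rw [← hQ'eq] at h₂
    exact (hQ'p.mem_or_mem (e.mem_of_F_U hQ'p.isIdeal h₂)).elim hm hm₀')
  have hTQ' : g₁.F ⁻¹' T = Q' := by
    refine hmem T hT (fun m hm ↦ ?_) (by rw [hTQ])
    by_contra hm'
    exact hTS _ ⟨m, hm', rfl⟩ hm
  -- Going down: avoiding the complement of `T` gives `T' ⊆ T` over `Q'` along `g₂`. By minimality,
  -- `T'` and `T` both restrict to `Q'` along `g₁`, so incomparability for `g₁` identifies them, and
  -- with them `Q'` and `Q`.
  obtain ⟨T', hT', hTQ₂, hTS'⟩ := g₂.exists_isPrime_over hQ'p hT.compl (by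
    intro y hy hyU
    refine hy (g₂.mem_of_F_U hT.isIdeal ?_)
    have : g₂.U y ∈ g₂.F ⁻¹' T := hTQ ▸ hQ'Q hyU
    exact this)
  have hle' : T' ⊆ T := fun y hy ↦ by
    by_contra hy'
    exact hTS' y hy' hy
  have hTQ₁ : g₁.F ⁻¹' T' = Q' :=
    hmem T' hT' (fun m hm ↦ hTQ' ▸ hle' hm) (by rw [hTQ₂, hQ'eq])
  have := h hT' hT hle' (by rw [hTQ', hTQ₁])
  rw [← hTQ, ← this, hTQ₂] at hm₀
  exact hm₀' hm₀

/-- The start of the induction: a zero ring has no primes. -/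
lemma incomparable_of_one_mem (h : ∀ I : Set N, IsIdeal I → (1 : N) ∈ I) : e.Incomparable :=
  fun _ _ hQ' _ _ _ ↦ (hQ'.one_notMem (h _ hQ'.isIdeal)).elim

/-- If `e₁, e₂` are two extensions of `N` (such as the two base changes of `e` along itself), then
primes of `N` with the same restriction come from a common prime. -/
lemma exists_isPrime_pair {L : Type*} [IdealMonoid L] (g₁ g₂ : Extension N L)
    (hg : ∀ x, g₁.F (e.F x) = g₂.F (e.F x))
    (hs : ∀ I, IsIdeal I → ∀ m, g₂.U (g₁.F m) ∈ I → e.F (e.U m) ∈ I)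
    (h : e.Incomparable) {Q₁ Q₂ : Set N} (h₁ : IsPrime Q₁) (h₂ : IsPrime Q₂)
    (heq : e.F ⁻¹' Q₁ = e.F ⁻¹' Q₂) :
    ∃ T, IsPrime T ∧ g₁.F ⁻¹' T = Q₁ ∧ g₂.F ⁻¹' T = Q₂ := by
  -- Avoiding the `g₁`-image of the complement of `Q₁` means `g₁.F ⁻¹' T ⊆ Q₁`; incomparability then
  -- upgrades this inclusion to an equality.
  obtain ⟨T, hT, hTQ, hTS⟩ := g₂.exists_isPrime_over h₂ (h₁.compl.map g₁.F) (by
    rintro _ ⟨m, hm, rfl⟩ hmU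
    have : e.U m ∈ e.F ⁻¹' Q₂ := hs Q₂ h₂.isIdeal m hmU
    rw [← heq] at this
    exact hm (e.mem_of_F_U h₁.isIdeal this))
  refine ⟨T, hT, h (g₁.isPrime_F hT) h₁ (fun m hm ↦ ?_) ?_, hTQ⟩
  · by_contra hm'
    exact hTS _ ⟨m, hm', rfl⟩ hm
  · rw [heq, ← hTQ]
    ext x
    simp only [mem_preimage, hg]

end Extension
end IdealMonoid
end TTGeometry

namespace TTGeometry
open Set

/-! ### The monoid of objects of a tensor-triangulated category -/

section Objects

universe v₁ u₁ v₂ u₂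

variable {C : Type u} [Category.{v} C] {C' : Type u₁} [Category.{v₁} C']
  {C'' : Type u₂} [Category.{v₂} C'']

/-- Thick tensor ideals. -/
structure IsThickIdeal (D : TTData C) (I : Set C) : Prop where
  zero_mem : ∀ X : C, IsZero X → X ∈ I
  shift_mem : ∀ (n : ℤ) (X : C), X ∈ I → D.shift n X ∈ I
  dist_mem₁ : ∀ {X Y Z : C} (f : X ⟶ Y) (g : Y ⟶ Z) (h : Z ⟶ D.shift 1 X), D.dist f g h →
    Y ∈ I → Z ∈ I → X ∈ I
  dist_mem₂ : ∀ {X Y Z : C} (f : X ⟶ Y) (g : Y ⟶ Z) (h : Z ⟶ D.shift 1 X), D.dist f g h →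
    X ∈ I → Z ∈ I → Y ∈ I
  dist_mem₃ : ∀ {X Y Z : C} (f : X ⟶ Y) (g : Y ⟶ Z) (h : Z ⟶ D.shift 1 X), D.dist f g h →
    X ∈ I → Y ∈ I → Z ∈ I
  retract_mem : ∀ {X Y : C}, Retract X Y → Y ∈ I → X ∈ I
  tensor_mem : ∀ X Y : C, Y ∈ I → D.tensor X Y ∈ I

lemma IsThickIdeal.iso_mem {D : TTData C} {I : Set C} (h : IsThickIdeal D I) {X Y : C}
    (e : Nonempty (X ≅ Y)) : X ∈ I ↔ Y ∈ I :=
  ⟨h.retract_mem (Retract.ofIso e.some.symm), h.retract_mem (Retract.ofIso e.some)⟩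

lemma Spc.isThickIdeal {D : TTData C} (Q : Spc D) : IsThickIdeal D Q.carrier where
  zero_mem := Q.zero_mem
  shift_mem := Q.shift_mem
  dist_mem₁ := Q.dist_mem₁
  dist_mem₂ := Q.dist_mem₂
  dist_mem₃ := Q.dist_mem₃
  retract_mem := Q.retract_mem
  tensor_mem := Q.tensor_mem

/-- The properties of a map on objects which make preimages of thick subcategories thick. -/
structure IsExactOn (D : TTData C) (D' : TTData C') (F : C → C') : Prop where
  zero : ∀ X, IsZero X → IsZero (F X)
  shift : ∀ n X, Nonempty (F (D.shift n X) ≅ D'.shift n (F X))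
  dist : ∀ {X Y Z : C} (f : X ⟶ Y) (g : Y ⟶ Z) (h : Z ⟶ D.shift 1 X), D.dist f g h →
    ∃ (f' : F X ⟶ F Y) (g' : F Y ⟶ F Z) (h' : F Z ⟶ D'.shift 1 (F X)), D'.dist f' g' h'
  retract : ∀ {X Y}, Retract X Y → Nonempty (Retract (F X) (F Y))

lemma IsExactOn.isThickIdeal {D : TTData C} {D' : TTData C'} {F : C → C'} (hF : IsExactOn D D' F)
    {I : Set C'} (hI : IsThickIdeal D' I) (h : ∀ X Y, F Y ∈ I → F (D.tensor X Y) ∈ I) :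
    IsThickIdeal D (F ⁻¹' I) where
  zero_mem X hX := hI.zero_mem _ (hF.zero X hX)
  shift_mem n X hX := (hI.iso_mem (hF.shift n X)).2 (hI.shift_mem n _ hX)
  dist_mem₁ f g h hd hY hZ := by
    obtain ⟨f', g', h', hd'⟩ := hF.dist f g h hd
    exact hI.dist_mem₁ f' g' h' hd' hY hZ
  dist_mem₂ f g h hd hY hZ := by
    obtain ⟨f', g', h', hd'⟩ := hF.dist f g h hd
    exact hI.dist_mem₂ f' g' h' hd' hY hZ
  dist_mem₃ f g h hd hY hZ := by
    obtain ⟨f', g', h', hd'⟩ := hF.dist f g h hd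
    exact hI.dist_mem₃ f' g' h' hd' hY hZ
  retract_mem r hY := hI.retract_mem (hF.retract r).some hY
  tensor_mem X Y hY := h X Y hY

/-- The part of the axioms of a tensor-triangulated category which the theory of prime ideals
depends on. -/
class IsTensorTriangulated (D : TTData C) where
  /-- the unit object -/
  unit : C
  unit_tensor (X : C) : Nonempty (D.tensor unit X ≅ X)
  comm (X Y : C) : Nonempty (D.tensor X Y ≅ D.tensor Y X)
  assoc (X Y Z : C) : Nonempty (D.tensor (D.tensor X Y) Z ≅ D.tensor X (D.tensor Y Z))
  exact (X : C) : IsExactOn D D (D.tensor X)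
  exists_zero (D) : ∃ X : C, IsZero X
  exists_sum (X Y : C) : ∃ Z, ∀ I, IsThickIdeal D I → (Z ∈ I ↔ X ∈ I ∧ Y ∈ I)

open IsTensorTriangulated

/-- Objects are equivalent if they lie in the same thick tensor ideals. -/
def objSetoid (D : TTData C) : Setoid C where
  r X Y := ∀ I, IsThickIdeal D I → (X ∈ I ↔ Y ∈ I)
  iseqv := ⟨fun _ _ _ ↦ Iff.rfl, fun h I hI ↦ (h I hI).symm,
    fun h h' I hI ↦ (h I hI).trans (h' I hI)⟩

/-- Classes of objects which lie in the same thick tensor ideals. -/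
def Obj (D : TTData C) : Type _ := Quotient (objSetoid D)

/-- The class of an object. -/
def Obj.mk (D : TTData C) (X : C) : Obj D := Quotient.mk (objSetoid D) X

variable {D : TTData C} {D' : TTData C'} {D'' : TTData C''}

lemma Obj.sound {X Y : C} (h : ∀ I, IsThickIdeal D I → (X ∈ I ↔ Y ∈ I)) :
    Obj.mk D X = Obj.mk D Y :=
  Quotient.sound (s := objSetoid D) h

lemma Obj.sound_iso {X Y : C} (e : Nonempty (X ≅ Y)) : Obj.mk D X = Obj.mk D Y :=
  Obj.sound fun _ hI ↦ hI.iso_mem e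

lemma Obj.mem_image {I : Set C} (hI : IsThickIdeal D I) {X : C} :
    Obj.mk D X ∈ Obj.mk D '' I ↔ X ∈ I :=
  ⟨fun ⟨_, hY, h⟩ ↦ (Quotient.exact (s := objSetoid D) h I hI).1 hY, fun h ↦ ⟨X, h, rfl⟩⟩

lemma Obj.preimage_image {I : Set C} (hI : IsThickIdeal D I) :
    Obj.mk D ⁻¹' (Obj.mk D '' I) = I :=
  Set.ext fun _ ↦ Obj.mem_image hI

lemma Obj.mk_surjective : Function.Surjective (Obj.mk D) := Quotient.mk_surjective

lemma IsThickIdeal.colon [IsTensorTriangulated D] {I : Set C} (hI : IsThickIdeal D I) (X : C) :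
    IsThickIdeal D {Y | D.tensor X Y ∈ I} :=
  (exact X).isThickIdeal hI fun Z Y hY ↦ by
    refine (hI.iso_mem (comm (D.tensor Z Y) X)).1 ((hI.iso_mem (assoc Z Y X)).2 ?_)
    exact hI.tensor_mem _ _ ((hI.iso_mem (comm X Y)).1 hY)

/-- Change one factor at a time: membership of a tensor product in `I` is membership of one factor
in a colon ideal, which is again thick. -/
lemma Obj.tensor_congr [IsTensorTriangulated D] {X X' Y Y' : C}
    (hX : ∀ I, IsThickIdeal D I → (X ∈ I ↔ X' ∈ I))
    (hY : ∀ I, IsThickIdeal D I → (Y ∈ I ↔ Y' ∈ I)) (I : Set C) (hI : IsThickIdeal D I) :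
    D.tensor X Y ∈ I ↔ D.tensor X' Y' ∈ I := by
  have h₁ := hY _ (hI.colon X)
  have h₂ := hX _ (hI.colon Y')
  simp only [mem_ofPred_eq] at h₁ h₂
  rw [h₁, hI.iso_mem (comm X Y'), h₂, hI.iso_mem (comm Y' X')]

/-- On classes, the constraint isomorphisms become equalities, so no coherence is needed. Ideals of
the monoid are the images of thick tensor ideals, and its primes are the points of the spectrum. -/
instance [IsTensorTriangulated D] : IdealMonoid (Obj D) where
  mul := Quotient.map₂ D.tensor fun _ _ hX _ _ hY ↦ Obj.tensor_congr hX hY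
  mul_assoc := by
    rintro ⟨X⟩ ⟨Y⟩ ⟨Z⟩
    exact Obj.sound_iso (assoc X Y Z)
  one := Obj.mk D (unit D)
  one_mul := by
    rintro ⟨X⟩
    exact Obj.sound_iso (unit_tensor X)
  mul_one := by
    rintro ⟨X⟩
    exact (Obj.sound_iso (comm X (unit D))).trans (Obj.sound_iso (unit_tensor X))
  mul_comm := by
    rintro ⟨X⟩ ⟨Y⟩
    exact Obj.sound_iso (comm X Y)
  IsIdeal I := IsThickIdeal D (Obj.mk D ⁻¹' I)
  mul_mem := by
    rintro I hI ⟨X⟩ ⟨Y⟩ hY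
    exact hI.tensor_mem X Y hY
  isIdeal_sInter {S} h := by
    refine ⟨fun X hX I hI ↦ (h I hI).zero_mem X hX,
      fun n X hX I hI ↦ (h I hI).shift_mem n X (hX I hI),
      fun f g k hd h₁ h₂ I hI ↦ (h I hI).dist_mem₁ f g k hd (h₁ I hI) (h₂ I hI),
      fun f g k hd h₁ h₂ I hI ↦ (h I hI).dist_mem₂ f g k hd (h₁ I hI) (h₂ I hI),
      fun f g k hd h₁ h₂ I hI ↦ (h I hI).dist_mem₃ f g k hd (h₁ I hI) (h₂ I hI),
      fun r h₁ I hI ↦ (h I hI).retract_mem r (h₁ I hI),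
      fun X Y h₁ I hI ↦ (h I hI).tensor_mem X Y (h₁ I hI)⟩
  isIdeal_sUnion {S} hne hchain h := by
    have key : ∀ {X Y : C}, X ∈ Obj.mk D ⁻¹' ⋃₀ S → Y ∈ Obj.mk D ⁻¹' ⋃₀ S →
        ∃ I ∈ S, Obj.mk D X ∈ I ∧ Obj.mk D Y ∈ I := by
      rintro X Y ⟨I, hI, hX⟩ ⟨J, hJ, hY⟩
      rcases hchain.total hI hJ with h' | h'
      exacts [⟨J, hJ, h' hX, hY⟩, ⟨I, hI, hX, h' hY⟩]
    refine ⟨fun X hX ↦ ?_, ?_, fun f g k hd h₁ h₂ ↦ ?_, fun f g k hd h₁ h₂ ↦ ?_,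
      fun f g k hd h₁ h₂ ↦ ?_, ?_, ?_⟩
    · obtain ⟨I, hI⟩ := hne
      exact ⟨I, hI, (h I hI).zero_mem X hX⟩
    · rintro n X ⟨I, hI, hX⟩
      exact ⟨I, hI, (h I hI).shift_mem n X hX⟩
    · obtain ⟨I, hI, h₁, h₂⟩ := key h₁ h₂
      exact ⟨I, hI, (h I hI).dist_mem₁ f g k hd h₁ h₂⟩
    · obtain ⟨I, hI, h₁, h₂⟩ := key h₁ h₂
      exact ⟨I, hI, (h I hI).dist_mem₂ f g k hd h₁ h₂⟩
    · obtain ⟨I, hI, h₁, h₂⟩ := key h₁ h₂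
      exact ⟨I, hI, (h I hI).dist_mem₃ f g k hd h₁ h₂⟩
    · rintro X Y r ⟨I, hI, hY⟩
      exact ⟨I, hI, (h I hI).retract_mem r hY⟩
    · rintro X Y ⟨I, hI, hY⟩
      exact ⟨I, hI, (h I hI).tensor_mem X Y hY⟩
  isIdeal_colon := by
    rintro I ⟨X⟩ hI
    exact hI.colon X

open IdealMonoid

lemma Obj.isIdeal_image [IsTensorTriangulated D] {I : Set C} (hI : IsThickIdeal D I) :
    IsIdeal (Obj.mk D '' I) := by
  change IsThickIdeal D (Obj.mk D ⁻¹' (Obj.mk D '' I))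
  rwa [Obj.preimage_image hI]

lemma Spc.unit_notMem [IsTensorTriangulated D] (Q : Spc D) : unit D ∉ Q.carrier := fun h ↦
  Q.ne_univ (Set.eq_univ_of_forall fun X ↦ (Q.isThickIdeal.iso_mem (unit_tensor X)).1
    ((Q.isThickIdeal.iso_mem (comm X (unit D))).1 (Q.tensor_mem X _ h)))

/-- The prime ideal of the monoid of objects of a point of the spectrum. -/
def Spc.image (Q : Spc D) : Set (Obj D) := Obj.mk D '' Q.carrier

lemma Spc.mk_mem_image (Q : Spc D) {X : C} : Obj.mk D X ∈ Q.image ↔ X ∈ Q.carrier :=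
  Obj.mem_image Q.isThickIdeal

lemma Spc.isPrime_image [IsTensorTriangulated D] (Q : Spc D) : IsPrime Q.image where
  isIdeal := Obj.isIdeal_image Q.isThickIdeal
  one_notMem h := Q.unit_notMem (Q.mk_mem_image.1 h)
  mem_or_mem := by
    rintro ⟨X⟩ ⟨Y⟩ h
    exact (Q.prime X Y (Q.mk_mem_image.1 h)).imp Q.mk_mem_image.2 Q.mk_mem_image.2

/-- The point of the spectrum of a prime ideal of the monoid of objects. -/
def Spc.ofPrime [IsTensorTriangulated D] {I : Set (Obj D)} (hI : IsPrime I) : Spc D :=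
  have h : IsThickIdeal D (Obj.mk D ⁻¹' I) := hI.isIdeal
  { h with
    carrier := Obj.mk D ⁻¹' I
    ne_univ := fun h ↦ hI.one_notMem (by
      have : unit D ∈ Obj.mk D ⁻¹' I := h ▸ Set.mem_univ _
      exact this)
    prime := fun _ _ hXY ↦ hI.mem_or_mem hXY }

lemma Spc.image_ofPrime [IsTensorTriangulated D] {I : Set (Obj D)} (hI : IsPrime I) :
    (Spc.ofPrime hI).image = I :=
  Set.image_preimage_eq _ Obj.mk_surjective

lemma Spc.image_injective : Function.Injective (Spc.image (D := D)) := fun Q Q' h ↦ by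
  ext X
  rw [← Q.mk_mem_image, h, Q'.mk_mem_image]

/-! ### Scalar extensions and the maps they induce on spectra -/

/-- Extension and restriction of scalars, as maps on objects. -/
structure TTExtension (D : TTData C) (D' : TTData C') [IsTensorTriangulated D]
    [IsTensorTriangulated D'] where
  /-- extension of scalars -/
  F : C → C'
  /-- restriction of scalars -/
  U : C' → C
  exact_F : IsExactOn D D' F
  exact_U : IsExactOn D' D U
  F_unit : Nonempty (F (unit D) ≅ unit D')
  F_tensor (X Y : C) : Nonempty (F (D.tensor X Y) ≅ D'.tensor (F X) (F Y))
  U_tensor (X : C) (M : C') : Nonempty (U (D'.tensor (F X) M) ≅ D.tensor X (U M))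
  retract_F_U (M : C') : Nonempty (Retract M (F (U M)))

namespace TTExtension

variable [IsTensorTriangulated D] [IsTensorTriangulated D'] [IsTensorTriangulated D'']
  (e : TTExtension D D')

lemma isThickIdeal_F {I : Set C'} (hI : IsThickIdeal D' I) : IsThickIdeal D (e.F ⁻¹' I) :=
  e.exact_F.isThickIdeal hI fun X Y hY ↦
    (hI.iso_mem (e.F_tensor X Y)).2 (hI.tensor_mem _ _ hY)

/-- The tensor condition is the only issue, since `U` is not monoidal. As `N` is a retract of `F (U
N)`, the module `M ⊗ N` is a retract of `F (U N) ⊗ M`, whose restriction is `U N ⊗ U M` by the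
projection formula. -/
lemma isThickIdeal_U {I : Set C} (hI : IsThickIdeal D I) : IsThickIdeal D' (e.U ⁻¹' I) :=
  e.exact_U.isThickIdeal hI fun M N hN ↦ by
    obtain ⟨r⟩ := (IsTensorTriangulated.exact (D := D') M).retract (e.retract_F_U N).some
    refine hI.retract_mem (e.exact_U.retract r).some ?_
    obtain ⟨i⟩ := IsTensorTriangulated.comm (D := D') M (e.F (e.U N))
    refine hI.retract_mem (e.exact_U.retract (Retract.ofIso i)).some ?_
    refine (hI.iso_mem (e.U_tensor _ _)).2 ((hI.iso_mem (comm _ _)).1 (hI.tensor_mem _ _ hN))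

/-- The extension on classes of objects. -/
def toExtension : Extension (Obj D) (Obj D') where
  F :=
    { toFun := Quotient.map e.F fun _ _ h _ hI ↦ h _ (e.isThickIdeal_F hI)
      map_one' := Obj.sound_iso e.F_unit
      map_mul' := by
        rintro ⟨X⟩ ⟨Y⟩
        exact Obj.sound_iso (e.F_tensor X Y) }
  U := Quotient.map e.U fun _ _ h _ hI ↦ h _ (e.isThickIdeal_U hI)
  isIdeal_F hI := e.isThickIdeal_F hI
  isIdeal_U hI := e.isThickIdeal_U hI
  U_mul := by
    rintro ⟨X⟩ ⟨M⟩
    exact Obj.sound_iso (e.U_tensor X M)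
  mem_of_F_U := by
    rintro I hI ⟨M⟩ h
    exact hI.retract_mem (e.retract_F_U M).some h

/-- The map on spectra. -/
def spcMap : C(Spc D', Spc D) where
  toFun Q :=
    have h := e.isThickIdeal_F Q.isThickIdeal
    { h with
      carrier := e.F ⁻¹' Q.carrier
      ne_univ := fun h ↦ Q.unit_notMem ((Q.isThickIdeal.iso_mem e.F_unit).1
        (h ▸ Set.mem_univ (unit D) : unit D ∈ e.F ⁻¹' Q.carrier))
      prime := fun X Y hXY ↦ Q.prime _ _ ((Q.isThickIdeal.iso_mem (e.F_tensor X Y)).1 hXY) }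
  continuous_toFun := by
    refine continuous_generateFrom_iff.2 ?_
    rintro _ ⟨X, rfl⟩
    exact TopologicalSpace.isOpen_generateFrom_of_mem ⟨e.F X, rfl⟩

lemma image_spcMap (Q : Spc D') : (e.spcMap Q).image = e.toExtension.F ⁻¹' Q.image := by
  ext ⟨X⟩
  exact (e.spcMap Q).mk_mem_image.trans Q.mk_mem_image.symm

end TTExtension

lemma isOpen_setOf_mem (X : C) : IsOpen {P : Spc D | X ∈ P.carrier} :=
  TopologicalSpace.isOpen_generateFrom_of_mem ⟨X, rfl⟩

/-- Direct sums turn finite intersections of the generating open sets into generating open sets. The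
closedness argument needs a neighbourhood given by a single object. -/
lemma isTopologicalBasis [IsTensorTriangulated D] :
    TopologicalSpace.IsTopologicalBasis (Set.range fun X : C ↦ {P : Spc D | X ∈ P.carrier}) where
  exists_subset_inter := by
    rintro _ ⟨X, rfl⟩ _ ⟨Y, rfl⟩ P ⟨hX, hY⟩
    obtain ⟨Z, hZ⟩ := exists_sum (D := D) X Y
    exact ⟨_, ⟨Z, rfl⟩, (hZ _ P.isThickIdeal).2 ⟨hX, hY⟩, fun Q hQ ↦ (hZ _ Q.isThickIdeal).1 hQ⟩
  sUnion_eq := by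
    refine Set.eq_univ_of_forall fun P ↦ ?_
    obtain ⟨X, hX⟩ := exists_zero D
    exact ⟨_, ⟨X, rfl⟩, P.zero_mem X hX⟩
  eq_generateFrom := rfl

namespace TTExtension

variable [IsTensorTriangulated D] [IsTensorTriangulated D'] [IsTensorTriangulated D'']

lemma spcMap_mem_supp (e : TTExtension D D') {A : C} (hA : Nonempty (e.U (unit D') ≅ A))
    (Q : Spc D') : e.spcMap Q ∈ supp D A := fun h ↦ by
  have h' := ((e.spcMap Q).isThickIdeal.iso_mem hA).2 h
  exact Q.unit_notMem (Q.retract_mem (e.retract_F_U _).some h')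

lemma exists_spcMap_eq (e : TTExtension D D') (P : Spc D) (S : Submonoid (Obj D'))
    (hS : ∀ M, Obj.mk D' M ∈ S → e.U M ∉ P.carrier) :
    ∃ Q, e.spcMap Q = P ∧ ∀ M, Obj.mk D' M ∈ S → M ∉ Q.carrier := by
  obtain ⟨T, hT, hTP, hTS⟩ := e.toExtension.exists_isPrime_over P.isPrime_image S (by
    rintro ⟨M⟩ hM hM'
    exact hS M hM (P.mk_mem_image.1 hM'))
  refine ⟨Spc.ofPrime hT, Spc.image_injective ?_, fun M hM ↦ hTS _ hM⟩
  rw [image_spcMap, Spc.image_ofPrime, hTP]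

/-- The map on spectra, with values in the support of the ring object. -/
def spcMapSupp (e : TTExtension D D') {A : C} (hA : Nonempty (e.U (unit D') ≅ A)) :
    C(Spc D', supp D A) where
  toFun Q := ⟨e.spcMap Q, e.spcMap_mem_supp hA Q⟩
  continuous_toFun := e.spcMap.continuous.subtype_mk _

/-- Lying over with the trivial multiplicative set, whose only condition is that `U 1 ≅ A` is not in
`P`. -/
lemma spcMapSupp_surjective (e : TTExtension D D') {A : C} (hA : Nonempty (e.U (unit D') ≅ A)) :
    Function.Surjective (e.spcMapSupp hA) := by
  rintro ⟨P, hP⟩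
  obtain ⟨Q, hQ, -⟩ := e.exists_spcMap_eq P ⊥ (by
    intro M hM hM'
    have hM₁ : Obj.mk D' M = 1 := Submonoid.mem_bot.1 hM
    have : e.toExtension.U (Obj.mk D' M) ∈ P.image := P.mk_mem_image.2 hM'
    rw [hM₁] at this
    exact hP ((P.isThickIdeal.iso_mem hA).1 (P.mk_mem_image.1 this)))
  exact ⟨Q, Subtype.ext hQ⟩

/-- The objects lying in no prime of `Z` form a multiplicative set `S`. The image of `Z` consists of
the `P` with `U M ∉ P` for all `M` in `S`, an intersection of closed sets. One inclusion uses that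
`M` is a retract of `F (U M)`, the other is lying over with respect to `S`. -/
lemma isClosedMap_spcMapSupp (e : TTExtension D D') {A : C}
    (hA : Nonempty (e.U (unit D') ≅ A)) : IsClosedMap (e.spcMapSupp hA) := by
  intro Z hZ
  let S : Submonoid (Obj D') :=
    { carrier := {m | ∀ Q ∈ Z, m ∉ Q.image}
      one_mem' := fun Q _ ↦ Q.isPrime_image.one_notMem
      mul_mem' := fun hm hn Q hQ h ↦
        (Q.isPrime_image.mem_or_mem h).elim (hm Q hQ) (hn Q hQ) }
  have hS : ∀ M, Obj.mk D' M ∈ S ↔ ∀ Q ∈ Z, M ∉ Q.carrier := fun M ↦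
    forall₂_congr fun Q _ ↦ not_congr Q.mk_mem_image
  have key : e.spcMapSupp hA '' Z =
      ⋂ M ∈ {M | Obj.mk D' M ∈ S}, {P | P.1 ∈ {P : Spc D | e.U M ∈ P.carrier}ᶜ} := by
    ext P
    simp only [Set.mem_iInter]
    refine ⟨?_, fun h ↦ ?_⟩
    · rintro ⟨Q, hQ, rfl⟩ M hM hM'
      exact (hS M).1 hM Q hQ (Q.retract_mem (e.retract_F_U M).some hM')
    · obtain ⟨Q, hQ, hQS⟩ := e.exists_spcMap_eq P.1 S h
      refine ⟨Q, ?_, Subtype.ext hQ⟩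
      by_contra hQZ
      -- If `Q ∉ Z`, some `M ∈ Q` lies in no prime of `Z`. Then `M` is in `S`, which `Q` was chosen
      -- to avoid.
      obtain ⟨_, ⟨M, rfl⟩, hM, hMZ⟩ :=
        isTopologicalBasis.exists_subset_of_mem_open (show Q ∈ Zᶜ from hQZ) hZ.isOpen_compl
      exact hQS M ((hS M).2 fun Q' hQ' h ↦ hMZ h hQ') hM
  rw [key]
  exact isClosed_biInter fun M _ ↦
    (isOpen_setOf_mem (e.U M)).isClosed_compl.preimage continuous_subtype_val

/-- If incomparability holds for `e`, and `g₁, g₂` behave as the two base changes of `e` along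
itself, then the map on spectra is the coequalizer of the maps given by `g₁` and `g₂`. -/
theorem isTopCoequalizer (e : TTExtension D D') (g₁ g₂ : TTExtension D' D'') {A : C}
    (hA : Nonempty (e.U (unit D') ≅ A))
    (hg : ∀ X, Nonempty (g₁.F (e.F X) ≅ g₂.F (e.F X)))
    (hs : ∀ M, Nonempty (Retract (e.F (e.U M)) (g₂.U (g₁.F M))))
    (h : e.toExtension.Incomparable) :
    IsTopCoequalizer.{w} g₁.spcMap g₂.spcMap (e.spcMapSupp hA) := by
  refine ⟨?_, fun T _ k hk ↦ ?_⟩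
  · ext Q X
    exact Q.isThickIdeal.iso_mem (hg X)
  · have hq : Topology.IsQuotientMap (e.spcMapSupp hA) :=
      (e.isClosedMap_spcMapSupp hA).isQuotientMap (e.spcMapSupp hA).continuous
        (e.spcMapSupp_surjective hA)
    have hfib : Function.FactorsThrough k (e.spcMapSupp hA) := by
      intro Q₁ Q₂ h₁₂
      have h₁₂' : e.spcMap Q₁ = e.spcMap Q₂ := congrArg Subtype.val h₁₂
      obtain ⟨R, hR, hR₁, hR₂⟩ := e.toExtension.exists_isPrime_pair g₁.toExtension g₂.toExtension
        (by rintro ⟨X⟩; exact Obj.sound_iso (hg X))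
        (by rintro I hI ⟨M⟩ hM; exact hI.retract_mem (hs M).some hM)
        h Q₁.isPrime_image Q₂.isPrime_image
        (by rw [← e.image_spcMap, ← e.image_spcMap, h₁₂'])
      have e₁ : g₁.spcMap (Spc.ofPrime hR) = Q₁ := Spc.image_injective (by
        rw [image_spcMap, Spc.image_ofPrime, hR₁])
      have e₂ : g₂.spcMap (Spc.ofPrime hR) = Q₂ := Spc.image_injective (by
        rw [image_spcMap, Spc.image_ofPrime, hR₂])
      rw [← e₁, ← e₂]
      exact congrArg (fun f : C(Spc D'', T) ↦ f (Spc.ofPrime hR)) hk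
    refine ⟨hq.lift k hfib, hq.lift_comp k hfib, fun l hl ↦ ?_⟩
    ext P
    obtain ⟨Q, rfl⟩ := e.spcMapSupp_surjective hA P
    exact (congrArg (fun f : C(Spc D', T) ↦ f Q) hl).trans
      (congrArg (fun f : C(Spc D', T) ↦ f Q) (hq.lift_comp k hfib)).symm

end TTExtension

end Objects
end TTGeometry

namespace TTGeometry
noncomputable section
set_option linter.unusedSectionVars false
set_option linter.unusedVariables false

/-! ### Relative tensor products over separable ring objects -/

/-! ### Linear split quotients and the natural section of the action -/

section Split

variable {K : Type u} [Category.{v} K] [MonoidalCategory K]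

instance isSplitEpi_whiskerLeft (X : K) {Y Z : K} (p : Y ⟶ Z) [IsSplitEpi p] :
    IsSplitEpi (X ◁ p) :=
  inferInstanceAs (IsSplitEpi ((tensorLeft X).map p))

instance isSplitEpi_whiskerRight (X : K) {Y Z : K} (p : Y ⟶ Z) [IsSplitEpi p] :
    IsSplitEpi (p ▷ X) :=
  inferInstanceAs (IsSplitEpi ((tensorRight X).map p))

instance isSplitEpi_act {A : K} [MonObj A] (M : Mod K A) : IsSplitEpi (act M) :=
  ⟨⟨{ section_ := (λ_ M.X).inv ≫ η ▷ M.X, id := by rw [assoc, one_act, Iso.inv_hom_id] }⟩⟩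

/-- Restriction of scalars. -/
def resMod {A B : K} [MonObj A] [MonObj B] (f : A ⟶ B) [IsMonHom f] (M : Mod K B) : Mod K A :=
  mkMod M.X (f ▷ M.X ≫ act M)
    (by rw [← comp_whiskerRight_assoc, IsMonHom.one_hom, one_act])
    (by
      rw [← comp_whiskerRight_assoc, IsMonHom.mul_hom, comp_whiskerRight, assoc, mul_act,
        MonoidalCategory.tensorHom_def, comp_whiskerRight, assoc, associator_naturality_middle_assoc,
        associator_naturality_left_assoc, ← whiskerLeft_comp_assoc, whisker_exchange_assoc])

lemma act_resMod {A B : K} [MonObj A] [MonObj B] (f : A ⟶ B) [IsMonHom f] (M : Mod K B) :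
    act (resMod f M) = f ▷ M.X ≫ act M := rfl

/-- Two linear quotients of the same object which factor through each other are isomorphic. -/
lemma nonempty_iso_of_factors {A : K} [MonObj A] {M N : Mod K A} {W : K} (a : A ⊗ W ⟶ W)
    (p : W ⟶ M.X) (q : W ⟶ N.X) [IsSplitEpi p] [IsSplitEpi q]
    (hp : A ◁ p ≫ act M = a ≫ p) (hq : A ◁ q ≫ act N = a ≫ q)
    (hpq : ∃ k, p ≫ k = q) (hqp : ∃ k, q ≫ k = p) : Nonempty (M ≅ N) := by
  obtain ⟨k, hk⟩ := hpq
  obtain ⟨l, hl⟩ := hqp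
  refine ⟨⟨mkHom k ?_, mkHom l ?_, ?_, ?_⟩⟩
  · rw [← cancel_epi (A ◁ p), reassoc_of% hp, hk, ← whiskerLeft_comp_assoc, hk, hq]
  · rw [← cancel_epi (A ◁ q), reassoc_of% hq, hl, ← whiskerLeft_comp_assoc, hl, hp]
  · ext
    change k ≫ l = 𝟙 _
    rw [← cancel_epi p, reassoc_of% hk, hl, comp_id]
  · ext
    change l ≫ k = 𝟙 _
    rw [← cancel_epi q, reassoc_of% hl, hk, comp_id]

/-- A linear isomorphism on underlying objects. -/
def isoMod {A : K} [MonObj A] {M N : Mod K A} (i : M.X ≅ N.X)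
    (h : act M ≫ i.hom = A ◁ i.hom ≫ act N) : M ≅ N where
  hom := mkHom i.hom h
  inv := mkHom i.inv (by
    rw [← cancel_mono i.hom, assoc, assoc, h, ← whiskerLeft_comp_assoc, Iso.inv_hom_id, comp_id,
      whiskerLeft_id, id_comp])
  hom_inv_id := by ext; exact i.hom_inv_id
  inv_hom_id := by ext; exact i.inv_hom_id

variable {A : K} [MonObj A] [IsSeparableRing A]

/-- The `A`-linear section `N ⟶ A ⊗ N` of the action, for a separable ring object `A`. -/
def linSection (N : Mod K A) : N.X ⟶ A ⊗ N.X :=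
  (λ_ N.X).inv ≫ (η ≫ (IsSeparableRing.exists_section (A := A)).choose) ▷ N.X ≫
    (α_ A A N.X).hom ≫ A ◁ act N

lemma linSection_act (N : Mod K A) : linSection N ≫ act N = 𝟙 N.X := by
  have h : A ◁ act N ≫ act N = (α_ A A N.X).inv ≫ μ ▷ N.X ≫ act N := by
    rw [mul_act, Iso.inv_hom_id_assoc]
  have h₁ := (IsSeparableRing.exists_section (A := A)).choose_spec.1
  simp only [linSection, assoc, h, Iso.hom_inv_id_assoc, ← comp_whiskerRight_assoc, h₁, comp_id,
    one_act, Iso.inv_hom_id]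

/-- Both sides send `a ⊗ n` to `σ(a)` applied to `n`: bilinearity of `σ` gives `a σ(1) = σ(a) = σ(1)
a`. -/
lemma act_linSection (N : Mod K A) :
    act N ≫ linSection N = A ◁ linSection N ≫ (α_ A A N.X).inv ≫ μ ▷ N.X := by
  unfold linSection
  generalize hσ : (IsSeparableRing.exists_section (A := A)).choose = σ
  obtain ⟨-, h₂, h₃⟩ := (IsSeparableRing.exists_section (A := A)).choose_spec
  rw [hσ] at h₂ h₃
  have e₂ : (λ_ A).inv ≫ (η ≫ σ) ▷ A ≫ (α_ A A A).hom ≫ A ◁ μ = σ := by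
    rw [comp_whiskerRight, assoc, h₂, MonObj.one_mul_assoc, Iso.inv_hom_id_assoc]
  have e₃ : (ρ_ A).inv ≫ A ◁ (η ≫ σ) ≫ (α_ A A A).inv ≫ μ ▷ A = σ := by
    rw [whiskerLeft_comp, assoc, h₃, MonObj.mul_one_assoc, Iso.inv_hom_id_assoc]
  have h : A ◁ act N ≫ act N = (α_ A A N.X).inv ≫ μ ▷ N.X ≫ act N := by
    rw [mul_act, Iso.inv_hom_id_assoc]
  have lhs : act N ≫ (λ_ N.X).inv ≫ (η ≫ σ) ▷ N.X ≫ (α_ A A N.X).hom ≫ A ◁ act N =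
      σ ▷ N.X ≫ (α_ A A N.X).hom ≫ A ◁ act N := by
    rw [leftUnitor_inv_naturality_assoc, whisker_exchange_assoc,
      associator_naturality_right_assoc, ← whiskerLeft_comp, h]
    conv_rhs => rw [← e₂]
    simp only [comp_whiskerRight, assoc, whiskerLeft_comp]
    monoidal
  have rhs : A ◁ ((λ_ N.X).inv ≫ (η ≫ σ) ▷ N.X ≫ (α_ A A N.X).hom ≫ A ◁ act N) ≫
      (α_ A A N.X).inv ≫ μ ▷ N.X = σ ▷ N.X ≫ (α_ A A N.X).hom ≫ A ◁ act N := by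
    conv_rhs => rw [← e₃]
    simp only [whiskerLeft_comp, assoc, associator_inv_naturality_right_assoc,
      whisker_exchange, comp_whiskerRight]
    monoidal
  rw [lhs, rhs]

/-- The section is made from the fixed element `σ(1)` and the action, so it commutes with linear
maps. This naturality makes the idempotents below natural, which exactness relies on. -/
lemma linSection_naturality {N N' : Mod K A} (g : N ⟶ N') :
    g.hom ≫ linSection N' = linSection N ≫ A ◁ g.hom := by
  simp only [linSection, assoc, ← whiskerLeft_comp, act_hom]
  rw [leftUnitor_inv_naturality_assoc, whisker_exchange_assoc, associator_naturality_right_assoc,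
    whiskerLeft_comp]

end Split

/-! ### The relative tensor product as a split quotient of `M ⊗ N` -/

section Relative

variable {K : Type u} [Category.{v} K] [MonoidalCategory K] [SymmetricCategory K]

lemma rightAct_resMod {A B C : K} [MonObj B] [MonObj C] (e : A ⟶ B) (f : B ⟶ C) [IsMonHom f]
    (M : Mod K C) : rightAct e (resMod f M) = rightAct (e ≫ f) M := by
  simp only [rightAct, act_resMod, whiskerLeft_comp, assoc]
  rw [BraidedCategory.braiding_naturality_right_assoc]
  rfl

lemma rightAct_hom {A B : K} [MonObj B] (f : A ⟶ B) {M M' : Mod K B} (g : M ⟶ M') :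
    rightAct f M ≫ g.hom = g.hom ▷ A ≫ rightAct f M' := by
  simp only [rightAct, assoc]
  rw [act_hom, ← BraidedCategory.braiding_naturality_left_assoc, whisker_exchange_assoc]

variable [IsIdempotentComplete K] {A B : K} [MonObj A] [MonObj B] [IsCommMonObj B]
  [IsSeparableRing A] (f : A ⟶ B) [IsMonHom f] (M : Mod K B) (N : Mod K A)

/-- The idempotent on `M ⊗ N` with image `M ⊗_A N`. -/
def relIdem : M.X ⊗ N.X ⟶ M.X ⊗ N.X :=
  M.X ◁ linSection N ≫ (α_ M.X A N.X).inv ≫ rightAct f M ▷ N.X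

/-- The idempotent on `M ⊗ N` with image `M ⊗_A N`, as a linear map. -/
def relIdemHom : tensorObject M N.X ⟶ tensorObject M N.X :=
  (mkHom (M.X ◁ linSection N ≫ (α_ M.X A N.X).inv) (by
    change ((α_ B M.X N.X).inv ≫ act M ▷ N.X) ≫ M.X ◁ linSection N ≫ (α_ M.X A N.X).inv =
      B ◁ (M.X ◁ linSection N ≫ (α_ M.X A N.X).inv) ≫ (α_ B (M.X ⊗ A) N.X).inv ≫
        ((α_ B M.X A).inv ≫ act M ▷ A) ▷ N.X
    rw [assoc, ← whisker_exchange_assoc]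
    monoidal) : tensorObject M N.X ⟶ tensorObject (tensorObject M A) N.X) ≫ relLeft f M N

lemma relIdemHom_hom : (relIdemHom f M N).hom = relIdem f M N :=
  assoc _ _ _

-- The idempotent splits `n` by `linSection` and moves the scalar to `M`. A map that identifies the
-- two actions may move the scalar back to `N`, where it recombines to `n`. The functor `G` is
-- allowed because only equations are used.
variable {M N} in
lemma map_relIdem_comp {L : Type*} [Category* L] (G : K ⥤ L) {Z : L} (k : G.obj (M.X ⊗ N.X) ⟶ Z)
    (hk : G.map (rightAct f M ▷ N.X) ≫ k = G.map ((α_ M.X A N.X).hom ≫ M.X ◁ act N) ≫ k) :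
    G.map (relIdem f M N) ≫ k = k := by
  rw [relIdem, ← assoc (M.X ◁ linSection N), G.map_comp, assoc, hk, ← G.map_comp_assoc]
  rw [assoc, Iso.inv_hom_id_assoc, ← whiskerLeft_comp, linSection_act, whiskerLeft_id, G.map_id,
    id_comp]

/-- The projection `M ⊗ N ⟶ M ⊗_A N`. -/
def relπ : M.X ⊗ N.X ⟶ (relTensor f M N).X :=
  (coequalizer.π (relLeft f M N) (relRight M N)).hom

lemma relπ_condition :
    rightAct f M ▷ N.X ≫ relπ f M N = ((α_ M.X A N.X).hom ≫ M.X ◁ act N) ≫ relπ f M N :=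
  congrArg Mod.Hom.hom (coequalizer.condition (relLeft f M N) (relRight M N))

lemma relIdem_relπ : relIdem f M N ≫ relπ f M N = relπ f M N :=
  map_relIdem_comp f (𝟭 K) (relπ f M N) (relπ_condition f M N)

lemma relIdem_condition : rightAct f M ▷ N.X ≫ relIdem f M N =
    ((α_ M.X A N.X).hom ≫ M.X ◁ act N) ≫ relIdem f M N := by
  have e₁ := congrArg (M.X ◁ ·) (act_linSection N)
  simp only [whiskerLeft_comp] at e₁
  have e₂ := rightAct_rightAct f M
  simp only [relIdem, assoc, reassoc_of% e₁]
  rw [← whisker_exchange_assoc, associator_inv_naturality_left_assoc, ← comp_whiskerRight, e₂]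
  simp

/-- The linear section of `M ⊗ N ⟶ M ⊗_A N`. -/
def relιHom : relTensor f M N ⟶ tensorObject M N.X :=
  coequalizer.desc (relIdemHom f M N) (by
    ext
    rw [Mod.comp_hom', Mod.comp_hom', relIdemHom_hom]
    exact relIdem_condition f M N)

/-- The section of `M ⊗ N ⟶ M ⊗_A N`. -/
def relι : (relTensor f M N).X ⟶ M.X ⊗ N.X := (relιHom f M N).hom

lemma relπ_relι : relπ f M N ≫ relι f M N = relIdem f M N := by
  rw [← relIdemHom_hom]
  exact congrArg Mod.Hom.hom
    (coequalizer.π_desc (f := relLeft f M N) (g := relRight M N) (relIdemHom f M N) _)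

lemma relι_relπ : relι f M N ≫ relπ f M N = 𝟙 _ := by
  have : relιHom f M N ≫ coequalizer.π (relLeft f M N) (relRight M N) =
      𝟙 (relTensor f M N) := by
    apply coequalizer.hom_ext
    ext
    change relπ f M N ≫ relι f M N ≫ relπ f M N = relπ f M N ≫ 𝟙 _
    rw [← assoc, relπ_relι, relIdem_relπ, comp_id]
  exact congrArg Mod.Hom.hom this

instance : IsSplitEpi (relπ f M N) := ⟨⟨{ section_ := relι f M N, id := relι_relπ f M N }⟩⟩

lemma whiskerLeft_relπ_act : B ◁ relπ f M N ≫ act (relTensor f M N) =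
    ((α_ B M.X N.X).inv ≫ act M ▷ N.X) ≫ relπ f M N :=
  (act_hom (coequalizer.π (relLeft f M N) (relRight M N))).symm

lemma act_relι : act (relTensor f M N) ≫ relι f M N =
    B ◁ relι f M N ≫ (α_ B M.X N.X).inv ≫ act M ▷ N.X :=
  act_hom (relιHom f M N)

variable {M N} in
/-- A map out of `M ⊗ N`, possibly inside another functor, which does not distinguish the two
actions of `A` factors through `M ⊗_A N`. -/
lemma map_relπ_factors {L : Type*} [Category* L] (G : K ⥤ L) {Z : L} (k : G.obj (M.X ⊗ N.X) ⟶ Z)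
    (hk : G.map (rightAct f M ▷ N.X) ≫ k = G.map ((α_ M.X A N.X).hom ≫ M.X ◁ act N) ≫ k) :
    G.map (relπ f M N) ≫ G.map (relι f M N) ≫ k = k := by
  rw [← G.map_comp_assoc, relπ_relι, map_relIdem_comp f G k hk]

variable {M N} in
lemma relπ_factors {Z : K} (k : M.X ⊗ N.X ⟶ Z)
    (hk : rightAct f M ▷ N.X ≫ k = ((α_ M.X A N.X).hom ≫ M.X ◁ act N) ≫ k) :
    relπ f M N ≫ relι f M N ≫ k = k :=
  map_relπ_factors f (𝟭 K) k hk

/-- A scalar coming from `A'` through `A` acts on the first factor of `M ⊗_A N` as it does on the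
second. Associativity uses this to transport relations on the second factor to the first. -/
lemma whiskerRight_relπ_rightAct {A' : K} (e : A' ⟶ A) :
    relπ f M N ▷ A' ≫ rightAct (e ≫ f) (relTensor f M N) =
      (α_ M.X N.X A').hom ≫ M.X ◁ rightAct e N ≫ relπ f M N := by
  have h : (M.X ⊗ N.X) ◁ (e ≫ f) ≫ (β_ (M.X ⊗ N.X) B).hom ≫ (α_ B M.X N.X).inv =
      (α_ M.X N.X A').hom ≫ M.X ◁ (N.X ◁ e ≫ (β_ N.X A).hom) ≫ (α_ M.X A N.X).inv ≫
        (M.X ◁ f ≫ (β_ M.X B).hom) ▷ N.X := by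
    rw [BraidedCategory.braiding_tensor_left_hom]
    simp only [assoc, Iso.hom_inv_id, comp_id, whiskerLeft_comp, comp_whiskerRight]
    rw [← associator_inv_naturality_middle_assoc, ← whiskerLeft_comp_assoc _ (β_ N.X A).hom,
      ← BraidedCategory.braiding_naturality_right, whiskerLeft_comp, assoc]
    simp
  rw [rightAct, ← whisker_exchange_assoc, BraidedCategory.braiding_naturality_left_assoc,
    whiskerLeft_relπ_act, assoc, reassoc_of% h, ← comp_whiskerRight_assoc]
  have h' := relπ_condition f M N
  rw [rightAct] at h'
  simp only [assoc, h', rightAct, whiskerLeft_comp, Iso.inv_hom_id_assoc] at h' ⊢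

end Relative

/-! ### Unit, associativity, commutativity and functoriality of relative tensor products -/

section Isos

variable {K : Type u} [Category.{v} K] [MonoidalCategory K] [SymmetricCategory K]
  [IsIdempotentComplete K]

/-- Associativity of the relative tensor product, in the second variable. -/
lemma nonempty_relTensor_assoc {B C D : K} [MonObj B] [IsSeparableRing B] [MonObj C]
    [IsCommMonObj C] [IsSeparableRing C] [MonObj D] [IsCommMonObj D] (e : B ⟶ C) [IsMonHom e]
    (f : C ⟶ D) [IsMonHom f] (M : Mod K D) (N : Mod K C) (L : Mod K B) :
    Nonempty (relTensor f M (relTensor e N L) ≅ relTensor (e ≫ f) (relTensor f M N) L) := by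
  -- The maps `p` and `q` impose the relations over `B` and over `C` in opposite orders. The next
  -- four equations say that each map respects both relations, so each factors through the other.
  set p : M.X ⊗ N.X ⊗ L.X ⟶ _ := M.X ◁ relπ e N L ≫ relπ f M (relTensor e N L) with hp
  set q : M.X ⊗ N.X ⊗ L.X ⟶ _ :=
    (α_ _ _ _).inv ≫ relπ f M N ▷ L.X ≫ relπ (e ≫ f) (relTensor f M N) L with hq
  have hpB : M.X ◁ (rightAct e N ▷ L.X) ≫ p = M.X ◁ ((α_ N.X B L.X).hom ≫ N.X ◁ act L) ≫ p := by
    rw [hp, ← whiskerLeft_comp_assoc, relπ_condition, whiskerLeft_comp_assoc]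
  have hpC : rightAct f M ▷ (N.X ⊗ L.X) ≫ p =
      (α_ M.X C (N.X ⊗ L.X)).hom ≫ M.X ◁ ((α_ C N.X L.X).inv ≫ act N ▷ L.X) ≫ p := by
    rw [hp, ← whisker_exchange_assoc, relπ_condition, assoc, associator_naturality_right_assoc,
      ← whiskerLeft_comp_assoc, whiskerLeft_relπ_act, whiskerLeft_comp_assoc]
  have hqC : rightAct f M ▷ (N.X ⊗ L.X) ≫ q =
      (α_ M.X C (N.X ⊗ L.X)).hom ≫ M.X ◁ ((α_ C N.X L.X).inv ≫ act N ▷ L.X) ≫ q := by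
    rw [hq, associator_inv_naturality_left_assoc, ← comp_whiskerRight_assoc, relπ_condition]
    simp
  have hqB : M.X ◁ (rightAct e N ▷ L.X) ≫ q =
      M.X ◁ ((α_ N.X B L.X).hom ≫ N.X ◁ act L) ≫ q := by
    have h := (α_ M.X N.X B).inv ≫= whiskerRight_relπ_rightAct f M N e
    rw [Iso.inv_hom_id_assoc] at h
    rw [hq, associator_inv_naturality_middle_assoc, ← comp_whiskerRight_assoc, ← h,
      comp_whiskerRight, comp_whiskerRight, assoc, assoc, relπ_condition, assoc,
      associator_naturality_left_assoc, ← whisker_exchange_assoc]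
    simp
  refine nonempty_iso_of_factors ((α_ D M.X (N.X ⊗ L.X)).inv ≫ act M ▷ (N.X ⊗ L.X)) p q
    ?_ ?_ ?_ ?_
  · rw [hp, whiskerLeft_comp, assoc, whiskerLeft_relπ_act, assoc, assoc, ← whisker_exchange_assoc]
    simp
  · have h := congrArg (· ▷ L.X) (whiskerLeft_relπ_act f M N)
    simp only [comp_whiskerRight, assoc] at h
    rw [hq, whiskerLeft_comp, whiskerLeft_comp, assoc, assoc, whiskerLeft_relπ_act, assoc,
      associator_inv_naturality_middle_assoc, reassoc_of% h]
    simp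
  · refine ⟨relι f M (relTensor e N L) ≫ M.X ◁ relι e N L ≫ q, ?_⟩
    have h₁ : M.X ◁ relπ e N L ≫ M.X ◁ relι e N L ≫ q = q :=
      map_relπ_factors e (tensorLeft M.X) q hqB
    rw [hp, assoc, relπ_factors, h₁]
    -- The relation over `C` on `M ⊗ (N ⊗_B L)` can be checked after lifting to `M ⊗ C ⊗ (N ⊗ L)`,
    -- where it is `hqC`.
    rw [← cancel_epi ((M.X ⊗ C) ◁ relπ e N L), whisker_exchange_assoc, h₁, hqC, assoc,
      associator_naturality_right_assoc, ← whiskerLeft_comp_assoc, whiskerLeft_relπ_act]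
    simp only [whiskerLeft_comp, assoc, h₁]
  · refine ⟨relι (e ≫ f) (relTensor f M N) L ≫ relι f M N ▷ L.X ≫ (α_ _ _ _).hom ≫ p, ?_⟩
    have h₁ : relπ f M N ▷ L.X ≫ relι f M N ▷ L.X ≫ (α_ _ _ _).hom ≫ p = (α_ _ _ _).hom ≫ p :=
      map_relπ_factors f (tensorRight L.X) ((α_ _ _ _).hom ≫ p) (by
        change (rightAct f M ▷ N.X) ▷ L.X ≫ _ = ((α_ M.X C N.X).hom ≫ M.X ◁ act N) ▷ L.X ≫ _
        rw [associator_naturality_left_assoc, hpC]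
        simp)
    rw [hq, assoc, assoc, relπ_factors, h₁, Iso.inv_hom_id_assoc]
    rw [← cancel_epi (relπ f M N ▷ B ▷ L.X), ← comp_whiskerRight_assoc,
      whiskerRight_relπ_rightAct, assoc, associator_naturality_left_assoc, ← whisker_exchange_assoc,
      comp_whiskerRight, comp_whiskerRight, assoc, assoc, h₁, associator_naturality_middle_assoc,
      hpB]
    simp

section Tensor

variable {A B : K} [MonObj A] [MonObj B] [IsCommMonObj B] [IsSeparableRing A] (f : A ⟶ B)
  [IsMonHom f]

lemma nonempty_relTensor_tensorObject (M : Mod K B) (N : Mod K A) (X : K) :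
    Nonempty (relTensor f M (tensorObject N X) ≅ tensorObject (relTensor f M N) X) := by
  let p : M.X ⊗ N.X ⊗ X ⟶ (relTensor f M (tensorObject N X)).X := relπ f M (tensorObject N X)
  let q : M.X ⊗ N.X ⊗ X ⟶ (relTensor f M N).X ⊗ X := (α_ _ _ _).inv ≫ relπ f M N ▷ X
  have hp : rightAct f M ▷ (N.X ⊗ X) ≫ p =
      ((α_ M.X A (N.X ⊗ X)).hom ≫ M.X ◁ ((α_ A N.X X).inv ≫ act N ▷ X)) ≫ p :=
    relπ_condition f M (tensorObject N X)
  have hq : rightAct f M ▷ (N.X ⊗ X) ≫ q =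
      ((α_ M.X A (N.X ⊗ X)).hom ≫ M.X ◁ ((α_ A N.X X).inv ≫ act N ▷ X)) ≫ q := by
    rw [associator_inv_naturality_left_assoc, ← comp_whiskerRight, relπ_condition]
    simp [q]
  have hq' : B ◁ q ≫ (α_ B (relTensor f M N).X X).inv ≫ act (relTensor f M N) ▷ X =
      ((α_ B M.X (N.X ⊗ X)).inv ≫ act M ▷ (N.X ⊗ X)) ≫ q := by
    have h := congrArg (· ▷ X) (whiskerLeft_relπ_act f M N)
    simp only [comp_whiskerRight, assoc] at h
    rw [whiskerLeft_comp, assoc, associator_inv_naturality_middle_assoc, h]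
    simp [q]
  have h₁ : relπ f M N ▷ X ≫ relι f M N ▷ X ≫ (α_ _ _ _).hom ≫ p = (α_ _ _ _).hom ≫ p :=
    map_relπ_factors f (tensorRight X) ((α_ _ _ _).hom ≫ p) (by
      change (rightAct f M ▷ N.X) ▷ X ≫ _ = ((α_ M.X A N.X).hom ≫ M.X ◁ act N) ▷ X ≫ _
      rw [associator_naturality_left_assoc, hp]
      simp)
  have h₂ : q ≫ relι f M N ▷ X ≫ (α_ _ _ _).hom ≫ p = p := by
    rw [assoc, h₁, Iso.inv_hom_id_assoc]
  have : IsSplitEpi (Y := (tensorObject (relTensor f M N) X).X) q :=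
    inferInstanceAs (IsSplitEpi ((α_ _ _ _).inv ≫ relπ f M N ▷ X))
  have : IsSplitEpi p := inferInstanceAs (IsSplitEpi (relπ f M (tensorObject N X)))
  exact nonempty_iso_of_factors (N := tensorObject (relTensor f M N) X) _ p q
    (whiskerLeft_relπ_act f M (tensorObject N X)) hq' ⟨_, relπ_factors f (N := tensorObject N X) q hq⟩
    ⟨_, h₂⟩

lemma rightUnitor_inv_rightAct (M : Mod K B) :
    ((ρ_ M.X).inv ≫ M.X ◁ η) ≫ rightAct f M = 𝟙 M.X := by
  rw [rightAct, assoc, ← whiskerLeft_comp_assoc, IsMonHom.one_hom,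
    BraidedCategory.braiding_naturality_right_assoc, one_act]
  simp

lemma nonempty_relTensor_regular (M : Mod K B) :
    Nonempty (relTensor f M (Mod.regular A) ≅ M) := by
  let p : M.X ⊗ A ⟶ (relTensor f M (Mod.regular A)).X := relπ f M (Mod.regular A)
  have : IsSplitEpi (rightAct f M) := ⟨⟨⟨_, rightUnitor_inv_rightAct f M⟩⟩⟩
  have : IsSplitEpi p := inferInstanceAs (IsSplitEpi (relπ f M (Mod.regular A)))
  have hp : rightAct f M ▷ A ≫ p = ((α_ M.X A A).hom ≫ M.X ◁ μ) ≫ p :=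
    relπ_condition f M (Mod.regular A)
  have hq : rightAct f M ▷ A ≫ rightAct f M = ((α_ M.X A A).hom ≫ M.X ◁ μ) ≫ rightAct f M := by
    rw [rightAct_rightAct f M, assoc]
  have hq' : B ◁ rightAct f M ≫ act M = ((α_ B M.X A).inv ≫ act M ▷ A) ≫ rightAct f M := by
    rw [assoc, act_rightAct, Iso.inv_hom_id_assoc]
  have h₁ : rightAct f M ≫ ((ρ_ M.X).inv ≫ M.X ◁ η) ≫ p = p := by
    rw [assoc, rightUnitor_inv_naturality_assoc, ← whisker_exchange_assoc, hp, assoc,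
      associator_naturality_right_assoc, ← whiskerLeft_comp_assoc, MonObj.mul_one]
    simp
  exact nonempty_iso_of_factors _ p (rightAct f M)
    (whiskerLeft_relπ_act f M (Mod.regular A)) hq'
    ⟨_, relπ_factors f (N := Mod.regular A) (rightAct f M) hq⟩ ⟨_, h₁⟩

/-- Functoriality of the relative tensor product in the first variable. -/
def relMapLeft {M M' : Mod K B} (g : M ⟶ M') (N : Mod K A) :
    relTensor f M N ⟶ relTensor f M' N :=
  mkHom (relι f M N ≫ g.hom ▷ N.X ≫ relπ f M' N) (by
    rw [whiskerLeft_comp, whiskerLeft_comp, assoc, assoc, whiskerLeft_relπ_act,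
      reassoc_of% (act_relι f M N), assoc, associator_inv_naturality_middle_assoc,
      ← comp_whiskerRight_assoc, ← comp_whiskerRight_assoc, act_hom])

lemma relπ_relMapLeft {M M' : Mod K B} (g : M ⟶ M') (N : Mod K A) :
    relπ f M N ≫ (relMapLeft f g N).hom = g.hom ▷ N.X ≫ relπ f M' N :=
  relπ_factors f (g.hom ▷ N.X ≫ relπ f M' N) (by
    rw [← comp_whiskerRight_assoc, rightAct_hom, comp_whiskerRight_assoc, relπ_condition, assoc,
      assoc, associator_naturality_left_assoc, whisker_exchange_assoc])

/-- Functoriality of the relative tensor product in the second variable. -/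
def relMapRight (M : Mod K B) {N N' : Mod K A} (g : N ⟶ N') :
    relTensor f M N ⟶ relTensor f M N' :=
  mkHom (relι f M N ≫ M.X ◁ g.hom ≫ relπ f M N') (by
    rw [whiskerLeft_comp, whiskerLeft_comp, assoc, assoc, whiskerLeft_relπ_act,
      reassoc_of% (act_relι f M N), assoc, ← whisker_exchange_assoc,
      associator_inv_naturality_right_assoc])

lemma relπ_relMapRight (M : Mod K B) {N N' : Mod K A} (g : N ⟶ N') :
    relπ f M N ≫ (relMapRight f M g).hom = M.X ◁ g.hom ≫ relπ f M N' :=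
  relπ_factors f (M.X ◁ g.hom ≫ relπ f M N') (by
    rw [← whisker_exchange_assoc, relπ_condition, assoc, assoc,
      associator_naturality_right_assoc, ← whiskerLeft_comp_assoc, ← whiskerLeft_comp_assoc,
      act_hom])

lemma relMapLeft_comp {M M' M'' : Mod K B} (g : M ⟶ M') (g' : M' ⟶ M'') (N : Mod K A) :
    relMapLeft f (g ≫ g') N = relMapLeft f g N ≫ relMapLeft f g' N := by
  ext
  rw [← cancel_epi (relπ f M N), relπ_relMapLeft, Mod.comp_hom', Mod.comp_hom',
    reassoc_of% (relπ_relMapLeft f g N), relπ_relMapLeft, comp_whiskerRight, assoc]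

lemma relMapLeft_id (M : Mod K B) (N : Mod K A) : relMapLeft f (𝟙 M) N = 𝟙 _ := by
  ext
  rw [← cancel_epi (relπ f M N), relπ_relMapLeft, Mod.id_hom', Mod.id_hom', id_whiskerRight,
    comp_id]
  exact id_comp _

lemma relMapRight_comp (M : Mod K B) {N N' N'' : Mod K A} (g : N ⟶ N') (g' : N' ⟶ N'') :
    relMapRight f M (g ≫ g') = relMapRight f M g ≫ relMapRight f M g' := by
  ext
  rw [← cancel_epi (relπ f M N), relπ_relMapRight, Mod.comp_hom', Mod.comp_hom',
    reassoc_of% (relπ_relMapRight f M g), relπ_relMapRight, whiskerLeft_comp, assoc]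

lemma relMapRight_id (M : Mod K B) (N : Mod K A) : relMapRight f M (𝟙 N) = 𝟙 _ := by
  ext
  rw [← cancel_epi (relπ f M N), relπ_relMapRight, Mod.id_hom', Mod.id_hom', whiskerLeft_id,
    comp_id]
  exact id_comp _

/-- The relative tensor product preserves isomorphisms in the first variable. -/
def relTensorIsoLeft {M M' : Mod K B} (i : M ≅ M') (N : Mod K A) :
    relTensor f M N ≅ relTensor f M' N where
  hom := relMapLeft f i.hom N
  inv := relMapLeft f i.inv N
  hom_inv_id := by rw [← relMapLeft_comp, i.hom_inv_id, relMapLeft_id]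
  inv_hom_id := by rw [← relMapLeft_comp, i.inv_hom_id, relMapLeft_id]

/-- The relative tensor product preserves retracts in the second variable. -/
def relTensorRetract (M : Mod K B) {N N' : Mod K A} (r : Retract N N') :
    Retract (relTensor f M N) (relTensor f M N') where
  i := relMapRight f M r.i
  r := relMapRight f M r.r
  retract := by rw [← relMapRight_comp, r.retract, relMapRight_id]

variable {f} in
lemma relTensor_congr {f' : A ⟶ B} [IsMonHom f'] (h : f = f') (M : Mod K B) (N : Mod K A) :
    relTensor f M N = relTensor f' M N := by
  subst h; rfl

end Tensor

section Comm

variable {A : K} [MonObj A] [IsCommMonObj A] [IsSeparableRing A]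

/-- Swapping the factors exchanges the two actions that are identified in `N ⊗_A M`. -/
lemma braiding_relπ_condition (M N : Mod K A) :
    rightAct (𝟙 A) M ▷ N.X ≫ (β_ M.X N.X).hom ≫ relπ (𝟙 A) N M =
      ((α_ M.X A N.X).hom ≫ M.X ◁ act N) ≫ (β_ M.X N.X).hom ≫ relπ (𝟙 A) N M := by
  have h := (α_ _ _ _).inv ≫= relπ_condition (𝟙 A) N M
  rw [assoc, Iso.inv_hom_id_assoc] at h
  rw [BraidedCategory.braiding_naturality_left_assoc, assoc,
    BraidedCategory.braiding_naturality_right_assoc]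
  simp only [rightAct, whiskerLeft_id, id_comp, whiskerLeft_comp, assoc, comp_whiskerRight] at h ⊢
  rw [← h, ← BraidedCategory.braiding_naturality_left_assoc,
    BraidedCategory.braiding_tensor_left_hom, BraidedCategory.braiding_tensor_right_hom]
  simp only [assoc, Iso.hom_inv_id_assoc]
  rw [← comp_whiskerRight_assoc (β_ A N.X).hom, SymmetricCategory.symmetry, id_whiskerRight,
    id_comp]

lemma nonempty_relTensor_comm (M N : Mod K A) :
    Nonempty (relTensor (𝟙 A) M N ≅ relTensor (𝟙 A) N M) := by
  refine nonempty_iso_of_factors _ (relπ (𝟙 A) M N) ((β_ M.X N.X).hom ≫ relπ (𝟙 A) N M)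
    (whiskerLeft_relπ_act _ _ _) ?_ ⟨_, relπ_factors (𝟙 A) _ (braiding_relπ_condition M N)⟩ ?_
  · have h := (α_ _ _ _).inv ≫= relπ_condition (𝟙 A) N M
    rw [assoc, Iso.inv_hom_id_assoc] at h
    rw [whiskerLeft_comp, assoc, whiskerLeft_relπ_act, assoc, assoc,
      BraidedCategory.braiding_naturality_left_assoc, ← h, BraidedCategory.braiding_tensor_left_hom]
    simp only [rightAct, whiskerLeft_id, id_comp, assoc, comp_whiskerRight,
      Iso.hom_inv_id_assoc, Iso.inv_hom_id_assoc]
    rw [← comp_whiskerRight_assoc (β_ A N.X).hom, SymmetricCategory.symmetry, id_whiskerRight,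
      id_comp]
  · refine ⟨relι (𝟙 A) N M ≫ (β_ N.X M.X).hom ≫ relπ (𝟙 A) M N, ?_⟩
    rw [assoc, relπ_factors (𝟙 A) _ (braiding_relπ_condition N M),
      SymmetricCategory.symmetry_assoc]

/-- The right action on `M` sees `B` only through `f`, so both sides impose the same relations on `M
⊗ N`. -/
lemma nonempty_resMod_relTensor {B : K} [MonObj B] [IsCommMonObj B] (f : A ⟶ B) [IsMonHom f]
    (M : Mod K B) (N : Mod K A) :
    Nonempty (resMod f (relTensor f M N) ≅ relTensor (𝟙 A) (resMod f M) N) := by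
  have h : rightAct (𝟙 A) (resMod f M) = rightAct f M := by
    rw [rightAct_resMod, id_comp]
  have : IsSplitEpi (Y := (resMod f (relTensor f M N)).X) (relπ f M N) :=
    inferInstanceAs (IsSplitEpi (relπ f M N))
  have : IsSplitEpi (X := M.X ⊗ N.X) (relπ (𝟙 A) (resMod f M) N) :=
    inferInstanceAs (IsSplitEpi (relπ (𝟙 A) (resMod f M) N))
  have h₁ := relπ_condition (𝟙 A) (resMod f M) N
  rw [h] at h₁
  refine nonempty_iso_of_factors _ (W := M.X ⊗ N.X) (M := resMod f (relTensor f M N)) (relπ f M N)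
    (relπ (𝟙 A) (resMod f M) N) ?_ (whiskerLeft_relπ_act _ _ _) ⟨_, relπ_factors f _ h₁⟩
    ⟨_, relπ_factors (𝟙 A) (M := resMod f M) (relπ f M N) ?_⟩
  · change A ◁ relπ f M N ≫ f ▷ _ ≫ act (relTensor f M N) =
      ((α_ A M.X N.X).inv ≫ (f ▷ M.X ≫ act M) ▷ N.X) ≫ relπ f M N
    rw [whisker_exchange_assoc, whiskerLeft_relπ_act]
    simp
  · rw [h]
    exact relπ_condition f M N

lemma nonempty_regular_relTensor (M : Mod K A) :
    Nonempty (relTensor (𝟙 A) (Mod.regular A) M ≅ M) :=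
  ⟨(nonempty_relTensor_comm _ _).some ≪≫ (nonempty_relTensor_regular (𝟙 A) M).some⟩

end Comm

end Isos

/-! ### Extension of scalars, restriction and the projection formula -/

section Extension

variable {K : Type u} [Category.{v} K] [MonoidalCategory K] [SymmetricCategory K]
  [IsIdempotentComplete K] {A B C : K} [MonObj A] [IsCommMonObj A] [IsSeparableRing A]
  [MonObj B] [IsCommMonObj B] [IsSeparableRing B] [MonObj C] [IsCommMonObj C]
  [IsSeparableRing C] (f : A ⟶ B) [IsMonHom f] (g : B ⟶ C) [IsMonHom g]

lemma nonempty_relTensor_extendScalars (M : Mod K B) (N : Mod K A) :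
    Nonempty (relTensor (𝟙 B) M (extendScalars f N) ≅ relTensor f M N) := by
  obtain ⟨i⟩ := nonempty_relTensor_assoc f (𝟙 B) M (Mod.regular B) N
  obtain ⟨j⟩ := nonempty_relTensor_regular (𝟙 B) M
  rw [relTensor_congr (comp_id f)] at i
  exact ⟨i ≪≫ relTensorIsoLeft f j N⟩

lemma nonempty_extendScalars_regular :
    Nonempty (extendScalars f (Mod.regular A) ≅ Mod.regular B) :=
  nonempty_relTensor_regular f (Mod.regular B)

lemma nonempty_extendScalars_relTensor (M N : Mod K A) :
    Nonempty (extendScalars f (relTensor (𝟙 A) M N) ≅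
      relTensor (𝟙 B) (extendScalars f M) (extendScalars f N)) := by
  obtain ⟨i⟩ := nonempty_relTensor_assoc (𝟙 A) f (Mod.regular B) M N
  obtain ⟨j⟩ := nonempty_relTensor_extendScalars f (extendScalars f M) N
  rw [relTensor_congr (id_comp f)] at i
  exact ⟨i ≪≫ j.symm⟩

lemma nonempty_extendScalars_comp (N : Mod K A) :
    Nonempty (extendScalars g (extendScalars f N) ≅ extendScalars (f ≫ g) N) := by
  obtain ⟨i⟩ := nonempty_relTensor_assoc f g (Mod.regular C) (Mod.regular B) N
  obtain ⟨j⟩ := nonempty_relTensor_regular g (Mod.regular C)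
  exact ⟨i ≪≫ relTensorIsoLeft (f ≫ g) j N⟩

/-- The isomorphism on underlying objects. -/
def forgetIso {M N : Mod K A} (i : M ≅ N) : M.X ≅ N.X where
  hom := i.hom.hom
  inv := i.inv.hom
  hom_inv_id := congrArg Mod.Hom.hom i.hom_inv_id
  inv_hom_id := congrArg Mod.Hom.hom i.inv_hom_id

/-- The retract on underlying objects. -/
def forgetRetract {M N : Mod K A} (r : Retract M N) : Retract M.X N.X where
  i := r.i.hom
  r := r.r.hom
  retract := congrArg Mod.Hom.hom r.retract

/-- Restriction of scalars of linear maps. -/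
def resModMap {M N : Mod K B} (g : M ⟶ N) : resMod f M ⟶ resMod f N :=
  mkHom (M := resMod f M) (N := resMod f N) g.hom (by
    change (f ▷ M.X ≫ act M) ≫ g.hom = A ◁ g.hom ≫ f ▷ N.X ≫ act N
    rw [assoc, act_hom, whisker_exchange_assoc])

/-- Restriction of scalars of retracts. -/
def resModRetract {M N : Mod K B} (r : Retract M N) : Retract (resMod f M) (resMod f N) where
  i := resModMap f r.i
  r := resModMap f r.r
  retract := by ext; exact (forgetRetract r).retract

/-- Restriction of scalars of isomorphisms. -/
def resModIso {M N : Mod K B} (i : M ≅ N) : resMod f M ≅ resMod f N where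
  hom := resModMap f i.hom
  inv := resModMap f i.inv
  hom_inv_id := by ext; exact (forgetIso i).hom_inv_id
  inv_hom_id := by ext; exact (forgetIso i).inv_hom_id

/-- After commuting the factors, `M ⊗_B (B ⊗_A N)` contracts to `M ⊗_A N`, and this is compatible
with restriction to `A`. -/
lemma nonempty_resMod_projection (N : Mod K A) (M : Mod K B) :
    Nonempty (resMod f (relTensor (𝟙 B) (extendScalars f N) M) ≅
      relTensor (𝟙 A) N (resMod f M)) := by
  obtain ⟨i⟩ := nonempty_relTensor_comm (extendScalars f N) M
  obtain ⟨j⟩ := nonempty_relTensor_extendScalars f M N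
  obtain ⟨k⟩ := nonempty_resMod_relTensor f M N
  obtain ⟨l⟩ := nonempty_relTensor_comm (resMod f M) N
  exact ⟨resModIso f (i ≪≫ j) ≪≫ k ≪≫ l⟩

lemma rightAct_regular : rightAct f (Mod.regular B) = B ◁ f ≫ μ := by
  change B ◁ f ≫ (β_ B B).hom ≫ μ = _
  rw [IsCommMonObj.mul_comm]

/-- The multiplication `B ⊗_A M ⟶ M` and a section of it. -/
lemma nonempty_retract_extendScalars (M : Mod K B) :
    Nonempty (Retract M (extendScalars f (resMod f M))) := by
  let p : B ⊗ M.X ⟶ (extendScalars f (resMod f M)).X := relπ f (Mod.regular B) (resMod f M)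
  have hp : B ◁ p ≫ act (extendScalars f (resMod f M)) = ((α_ B B M.X).inv ≫ μ ▷ M.X) ≫ p :=
    whiskerLeft_relπ_act f (Mod.regular B) (resMod f M)
  have hM : μ ▷ M.X ≫ act M = (α_ B B M.X).hom ≫ B ◁ act M ≫ act M := mul_act M
  have h₁ : p ≫ relι f (Mod.regular B) (resMod f M) ≫ act M = act M :=
    relπ_factors f (M := Mod.regular B) (N := resMod f M) (act M) (by
      rw [rightAct_regular]
      change (B ◁ f ≫ μ) ▷ M.X ≫ act M = ((α_ B A M.X).hom ≫ B ◁ (f ▷ M.X ≫ act M)) ≫ act M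
      rw [comp_whiskerRight, assoc, hM]
      simp)
  let k : (extendScalars f (resMod f M)).X ⟶ M.X :=
    relι f (Mod.regular B) (resMod f M) ≫ act M
  have : IsSplitEpi p := inferInstanceAs (IsSplitEpi (relπ f (Mod.regular B) (resMod f M)))
  refine ⟨⟨mkHom (linSection M ≫ p) ?_, mkHom k ?_, ?_⟩⟩
  -- The retract is `M ⟶ B ⊗ M ⟶ B ⊗_A M`, using separability of `B`, followed by the action. The
  -- section is linear for the first factor `B`.
  · rw [reassoc_of% (act_linSection M), whiskerLeft_comp, assoc, hp, assoc]
  · rw [← cancel_epi (B ◁ p), reassoc_of% hp, ← whiskerLeft_comp_assoc, h₁, hM,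
      Iso.inv_hom_id_assoc]
  · ext
    change (linSection M ≫ p) ≫ k = 𝟙 _
    rw [assoc, h₁, linSection_act]

/-- `M ⊗ X` depends functorially on the module `M`. -/
def tensorObjectIso {M N : Mod K A} (i : M ≅ N) (X : K) : tensorObject M X ≅ tensorObject N X :=
  isoMod (M := tensorObject M X) (N := tensorObject N X)
    (whiskerRightIso (forgetIso i) X) (by
    change ((α_ A M.X X).inv ≫ act M ▷ X) ≫ i.hom.hom ▷ X =
      A ◁ i.hom.hom ▷ X ≫ (α_ A N.X X).inv ≫ act N ▷ X
    rw [assoc, ← comp_whiskerRight, act_hom]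
    simp)

lemma nonempty_relTensor_freeMod (M : Mod K A) (X : K) :
    Nonempty (relTensor (𝟙 A) M (freeMod A X) ≅ tensorObject M X) := by
  obtain ⟨i⟩ := nonempty_relTensor_tensorObject (𝟙 A) M (Mod.regular A) X
  obtain ⟨j⟩ := nonempty_relTensor_regular (𝟙 A) M
  exact ⟨i ≪≫ tensorObjectIso j X⟩

lemma nonempty_freeMod_unit : Nonempty (freeMod A (𝟙_ K) ≅ Mod.regular A) :=
  ⟨isoMod (M := freeMod A (𝟙_ K)) (N := Mod.regular A) (ρ_ A) (by
    change ((α_ A A (𝟙_ K)).inv ≫ μ ▷ 𝟙_ K) ≫ (ρ_ A).hom = A ◁ (ρ_ A).hom ≫ μ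
    simp)⟩

lemma nonempty_freeMod_tensor (X Y : K) :
    Nonempty (freeMod A (X ⊗ Y) ≅ relTensor (𝟙 A) (freeMod A X) (freeMod A Y)) := by
  obtain ⟨i⟩ := nonempty_relTensor_freeMod (freeMod A X) Y
  refine ⟨isoMod (M := freeMod A (X ⊗ Y)) (N := tensorObject (freeMod A X) Y)
    (α_ A X Y).symm ?_ ≪≫ i.symm⟩
  change ((α_ A A (X ⊗ Y)).inv ≫ μ ▷ (X ⊗ Y)) ≫ (α_ A X Y).inv =
    A ◁ (α_ A X Y).inv ≫ (α_ A (A ⊗ X) Y).inv ≫ ((α_ A A X).inv ≫ μ ▷ X) ▷ Y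
  simp

lemma nonempty_freeMod_projection (X : K) (M : Mod K A) :
    Nonempty ((relTensor (𝟙 A) (freeMod A X) M).X ≅ X ⊗ M.X) := by
  obtain ⟨i⟩ := nonempty_relTensor_comm (freeMod A X) M
  obtain ⟨j⟩ := nonempty_relTensor_freeMod M X
  exact ⟨forgetIso (i ≪≫ j) ≪≫ β_ M.X X⟩

lemma nonempty_retract_freeMod (M : Mod K A) : Nonempty (Retract M (freeMod A M.X)) :=
  ⟨⟨mkHom (M := M) (N := freeMod A M.X) (linSection M) (act_linSection M),
    mkHom (M := freeMod A M.X) (N := M) (act M) (by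
      change ((α_ A A M.X).inv ≫ μ ▷ M.X) ≫ act M = A ◁ act M ≫ act M
      rw [assoc, mul_act, Iso.inv_hom_id_assoc]), by ext; exact linSection_act M⟩⟩

lemma nonempty_extendScalars_freeMod (X : K) :
    Nonempty (extendScalars f (freeMod A X) ≅ freeMod B X) := by
  obtain ⟨i⟩ := nonempty_relTensor_tensorObject f (Mod.regular B) (Mod.regular A) X
  obtain ⟨j⟩ := nonempty_relTensor_regular f (Mod.regular B)
  exact ⟨i ≪≫ tensorObjectIso j X⟩

/-- If `η` is invertible, a module is determined by its underlying object. This will identify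
modules over `A^[0]` with objects of `K`. -/
lemma nonempty_freeMod_iso_of_isIso [IsIso (η : 𝟙_ K ⟶ A)] (M : Mod K A) :
    Nonempty (freeMod A M.X ≅ M) := by
  have : IsIso (act M) := by
    have h : act M = (inv η ▷ M.X) ≫ (λ_ M.X).hom := by
      rw [← one_act, ← comp_whiskerRight_assoc, IsIso.inv_hom_id, id_whiskerRight, id_comp]
    rw [h]; infer_instance
  exact ⟨isoMod (M := freeMod A M.X) (N := M) (@asIso _ _ (A ⊗ M.X) M.X (act M) this) (by
    change ((α_ A A M.X).inv ≫ μ ▷ M.X) ≫ act M = A ◁ act M ≫ act M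
    rw [assoc, mul_act, Iso.inv_hom_id_assoc])⟩

end Extension

/-! ### Permanence of separability -/

section Separable

variable {K : Type u} [Category.{v} K] [MonoidalCategory K]

instance isSeparableRing_unit : IsSeparableRing (𝟙_ K) := by
  refine ⟨(λ_ (𝟙_ K)).inv, ?_, ?_, ?_⟩
  all_goals simp [unitors_equal, unitors_inv_equal]

instance isSplitEpi_tensorHom {X Y X' Y' : K} (p : X ⟶ Y) (q : X' ⟶ Y') [IsSplitEpi p]
    [IsSplitEpi q] : IsSplitEpi (p ⊗ₘ q) := by
  rw [MonoidalCategory.tensorHom_def]; infer_instance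

/-- A quotient ring object of a separable ring object is separable, if the quotient map splits. -/
lemma isSeparableRing_of_isSplitEpi {A B : K} [MonObj A] [MonObj B] [IsSeparableRing A] (q : A ⟶ B)
    [IsMonHom q] [IsSplitEpi q] : IsSeparableRing B := by
  obtain ⟨σ, h₁, h₂, h₃⟩ := IsSeparableRing.exists_section (A := A)
  obtain ⟨s, hs⟩ : ∃ s : B ⟶ A, s ≫ q = 𝟙 B := ⟨section_ q, IsSplitEpi.id q⟩
  have e₃ : (ρ_ A).inv ≫ A ◁ (η ≫ σ) ≫ (α_ A A A).inv ≫ μ ▷ A = σ := by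
    rw [whiskerLeft_comp, assoc, h₃, MonObj.mul_one_assoc, Iso.inv_hom_id_assoc]
  -- By left linearity, the image of `σ(a)` in `B ⊗ B` is `q(a)` times the image of `σ(1)`. It
  -- depends only on `q(a)`, so the choice of the section `s` is harmless even though `s` need not
  -- be multiplicative.
  have key : q ≫ s ≫ σ ≫ (q ⊗ₘ q) = σ ≫ (q ⊗ₘ q) := by
    have h : σ ≫ (q ⊗ₘ q) = q ≫ (ρ_ B).inv ≫ B ◁ (η ≫ σ ≫ (q ⊗ₘ q)) ≫ (α_ B B B).inv ≫ μ ▷ B := by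
      have hμ : μ ▷ A ≫ (q ⊗ₘ q) = ((q ⊗ₘ q) ⊗ₘ q) ≫ μ ▷ B := by
        rw [← tensorHom_id, ← tensorHom_id, tensorHom_comp_tensorHom, tensorHom_comp_tensorHom,
          IsMonHom.mul_hom, id_comp, comp_id]
      conv_lhs => rw [← e₃]
      rw [assoc, assoc, assoc, hμ, ← associator_inv_naturality_assoc, rightUnitor_inv_naturality_assoc,
        ← whisker_exchange_assoc, ← assoc η, whiskerLeft_comp_assoc,
        MonoidalCategory.tensorHom_def' q (q ⊗ₘ q)]
      simp only [assoc, whiskerLeft_comp]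
    rw [h, reassoc_of% hs]
  refine ⟨s ≫ σ ≫ (q ⊗ₘ q), ?_, ?_, ?_⟩
  · rw [assoc, assoc, ← IsMonHom.mul_hom, reassoc_of% h₁, hs]
  · have e : (q ⊗ₘ q) ≫ (s ≫ σ ≫ (q ⊗ₘ q)) ▷ B = σ ▷ A ≫ ((q ⊗ₘ q) ⊗ₘ q) := by
      rw [← tensorHom_id, ← tensorHom_id, tensorHom_comp_tensorHom, tensorHom_comp_tensorHom, key,
        id_comp, comp_id]
    have e' : (q ⊗ₘ (q ⊗ₘ q)) ≫ B ◁ μ = A ◁ μ ≫ (q ⊗ₘ q) := by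
      rw [← id_tensorHom, ← id_tensorHom, tensorHom_comp_tensorHom, tensorHom_comp_tensorHom,
        IsMonHom.mul_hom, id_comp, comp_id]
    rw [← cancel_epi (q ⊗ₘ q), reassoc_of% e, associator_naturality_assoc, e', reassoc_of% h₂,
      ← IsMonHom.mul_hom_assoc, key]
  · have e : (q ⊗ₘ q) ≫ B ◁ (s ≫ σ ≫ (q ⊗ₘ q)) = A ◁ σ ≫ (q ⊗ₘ (q ⊗ₘ q)) := by
      rw [← id_tensorHom, ← id_tensorHom, tensorHom_comp_tensorHom, tensorHom_comp_tensorHom, key,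
        id_comp, comp_id]
    have e' : ((q ⊗ₘ q) ⊗ₘ q) ≫ μ ▷ B = μ ▷ A ≫ (q ⊗ₘ q) := by
      rw [← tensorHom_id, ← tensorHom_id, tensorHom_comp_tensorHom, tensorHom_comp_tensorHom,
        IsMonHom.mul_hom, id_comp, comp_id]
    rw [← cancel_epi (q ⊗ₘ q), reassoc_of% e, associator_inv_naturality_assoc, e',
      reassoc_of% h₃, ← IsMonHom.mul_hom_assoc, key]

end Separable

/-! ### Retracts of distinguished triangles -/

section Triangle

variable {K : Type u} [Category.{v} K] [Preadditive K] [HasZeroObject K] [HasShift K ℤ]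
  [∀ n : ℤ, (shiftFunctor K n).Additive] [Pretriangulated K]

/-- A retract of a distinguished triangle is distinguished. -/
lemma distinguished_of_retract {X Y Z X' Y' Z' : K} {f : X ⟶ Y} {g : Y ⟶ Z} {h : Z ⟶ X⟦(1 : ℤ)⟧}
    {f' : X' ⟶ Y'} {g' : Y' ⟶ Z'} {h' : Z' ⟶ X'⟦(1 : ℤ)⟧} (hT : Triangle.mk f g h ∈ distTriang K)
    (r₁ : Retract X' X) (r₂ : Retract Y' Y) (r₃ : Retract Z' Z)
    (hi₁ : f' ≫ r₂.i = r₁.i ≫ f) (hi₂ : g' ≫ r₃.i = r₂.i ≫ g) (hi₃ : h' ≫ r₁.i⟦1⟧' = r₃.i ≫ h)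
    (hr₁ : f ≫ r₂.r = r₁.r ≫ f') (hr₂ : g ≫ r₃.r = r₂.r ≫ g') (hr₃ : h ≫ r₁.r⟦1⟧' = r₃.r ≫ h') :
    Triangle.mk f' g' h' ∈ distTriang K := by
  -- Compare `Z'` with a cone `W` of `f'` through the ambient `Z`. The comparison maps are `a ≫
  -- r₃.r` and `r₃.i ≫ b`, and both composites will be shown invertible.
  obtain ⟨W, u, v, hT'⟩ := distinguished_cocone_triangle f'
  obtain ⟨a, ha₂, ha₃⟩ : ∃ a : W ⟶ Z, u ≫ a = r₂.i ≫ g ∧ v ≫ r₁.i⟦1⟧' = a ≫ h :=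
    complete_distinguished_triangle_morphism _ _ hT' hT r₁.i r₂.i hi₁
  obtain ⟨b, hb₂, hb₃⟩ : ∃ b : Z ⟶ W, g ≫ b = r₂.r ≫ u ∧ h ≫ r₁.r⟦1⟧' = b ≫ v :=
    complete_distinguished_triangle_morphism _ _ hT hT' r₁.r r₂.r hr₁
  have hr₁' : r₁.i⟦(1 : ℤ)⟧' ≫ r₁.r⟦(1 : ℤ)⟧' = 𝟙 _ := by
    rw [← CategoryTheory.Functor.map_comp, r₁.retract, CategoryTheory.Functor.map_id]
  have hφ₂ : u ≫ a ≫ r₃.r = g' := by rw [reassoc_of% ha₂, hr₂, r₂.retract_assoc]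
  have hφ₃ : (a ≫ r₃.r) ≫ h' = v := by rw [assoc, ← hr₃, ← reassoc_of% ha₃, hr₁', comp_id]
  have hχ₂ : g' ≫ r₃.i ≫ b = u := by rw [reassoc_of% hi₂, hb₂, r₂.retract_assoc]
  have hχ₃ : (r₃.i ≫ b) ≫ v = h' := by rw [assoc, ← hb₃, ← reassoc_of% hi₃, hr₁', comp_id]
  have i₁ : IsIso ((a ≫ r₃.r) ≫ r₃.i ≫ b) := by
    let ψ : Triangle.mk f' u v ⟶ Triangle.mk f' u v :=
      { hom₁ := 𝟙 X'
        hom₂ := 𝟙 Y'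
        hom₃ := (a ≫ r₃.r) ≫ r₃.i ≫ b
        comm₁ := (comp_id f').trans (id_comp f').symm
        comm₂ := by
          change u ≫ (a ≫ r₃.r) ≫ r₃.i ≫ b = 𝟙 Y' ≫ u
          rw [id_comp, assoc, reassoc_of% hφ₂, hχ₂]
        comm₃ := by
          change v ≫ (𝟙 X')⟦1⟧' = ((a ≫ r₃.r) ≫ r₃.i ≫ b) ≫ v
          rw [CategoryTheory.Functor.map_id, comp_id, assoc, hχ₃, hφ₃] }
    exact isIso₃_of_isIso₁₂ ψ hT' hT' (inferInstanceAs (IsIso (𝟙 X')))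
      (inferInstanceAs (IsIso (𝟙 Y')))
  -- The triangle on `Z'` is not yet known to be distinguished, so the five lemma is unavailable.
  -- Instead `z - 1` factors through `g'`, by exactness of the ambient triangle, and `g' ≫ z = g'`
  -- then gives `(z - 1)² = 0`. So `2 - z` is inverse to `z`.
  have i₂ : IsIso ((r₃.i ≫ b) ≫ a ≫ r₃.r) := by
    set z := (r₃.i ≫ b) ≫ a ≫ r₃.r with hz
    have hz₂ : g' ≫ z = g' := by rw [hz, assoc, reassoc_of% hχ₂, hφ₂]
    have hz₃ : z ≫ h' = h' := by rw [hz, assoc, hφ₃, hχ₃]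
    obtain ⟨c, hc⟩ : ∃ c : Z' ⟶ Y', z - 𝟙 _ = c ≫ g' := by
      obtain ⟨c, hc⟩ : ∃ c : Z' ⟶ Y, (z - 𝟙 _) ≫ r₃.i = c ≫ g :=
        Triangle.coyoneda_exact₃ _ hT ((z - 𝟙 _) ≫ r₃.i) (by
          change ((z - 𝟙 _) ≫ r₃.i) ≫ h = 0
          rw [assoc, ← hi₃, Preadditive.sub_comp, reassoc_of% hz₃, id_comp, sub_self])
      refine ⟨c ≫ r₂.r, ?_⟩
      rw [assoc, ← hr₂, ← reassoc_of% hc, r₃.retract, comp_id]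
    have hsq : (z - 𝟙 _) ≫ (z - 𝟙 _) = 0 := by
      nth_rewrite 1 [hc]
      rw [assoc, Preadditive.comp_sub, hz₂, comp_id, sub_self, comp_zero]
    simp only [Preadditive.sub_comp, Preadditive.comp_sub, comp_id, id_comp] at hsq
    have h₁ : z ≫ ((2 : ℤ) • 𝟙 _ - z) = 𝟙 _ := by
      rw [Preadditive.comp_sub, Preadditive.comp_zsmul, comp_id, ← sub_eq_zero,
        ← neg_eq_zero, ← hsq]
      abel
    have h₂ : ((2 : ℤ) • 𝟙 _ - z) ≫ z = 𝟙 _ := by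
      rw [Preadditive.sub_comp, Preadditive.zsmul_comp, id_comp, ← sub_eq_zero,
        ← neg_eq_zero, ← hsq]
      abel
    exact ⟨_, h₁, h₂⟩
  have i₃ : IsIso (a ≫ r₃.r) := by
    have : IsSplitMono (a ≫ r₃.r) := ⟨⟨⟨(r₃.i ≫ b) ≫ inv ((a ≫ r₃.r) ≫ r₃.i ≫ b), by
      rw [← assoc, IsIso.hom_inv_id]⟩⟩⟩
    have : Epi (a ≫ r₃.r) := epi_of_epi (r₃.i ≫ b) (a ≫ r₃.r)
    exact isIso_of_epi_of_isSplitMono _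
  refine isomorphic_distinguished _ hT' _ (Triangle.isoMk (Triangle.mk f' g' h')
    (Triangle.mk f' u v) (Iso.refl X') (Iso.refl Y') (asIso (a ≫ r₃.r)).symm ?_ ?_ ?_)
  · exact (comp_id f').trans (id_comp f').symm
  · change g' ≫ inv (a ≫ r₃.r) = 𝟙 Y' ≫ u
    rw [IsIso.comp_inv_eq, id_comp, hφ₂]
  · change h' ≫ (𝟙 X')⟦1⟧' = inv (a ≫ r₃.r) ≫ v
    rw [CategoryTheory.Functor.map_id, comp_id, IsIso.eq_inv_comp, hφ₃]

end Triangle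

/-! ### Compatibility of relative tensor products with shifts -/

section Shift

variable {K : Type u} [Category.{v} K] [Preadditive K] [HasZeroObject K] [HasShift K ℤ]
  [∀ n : ℤ, (shiftFunctor K n).Additive] [Pretriangulated K] [MonoidalCategory K]
  [TensorTriangulated K]

/-- The isomorphism `X ⊗ Y⟦n⟧ ≅ (X ⊗ Y)⟦n⟧`. -/
def tensorShift (X : K) (n : ℤ) (Y : K) : X ⊗ Y⟦n⟧ ≅ (X ⊗ Y)⟦n⟧ :=
  ((tensorLeft X).commShiftIso n).app Y

lemma tensorShift_naturality_left {X X' : K} (f : X ⟶ X') (n : ℤ) (Y : K) :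
    f ▷ Y⟦n⟧ ≫ (tensorShift X' n Y).hom = (tensorShift X n Y).hom ≫ (f ▷ Y)⟦n⟧' :=
  TensorTriangulated.natural f n Y

lemma tensorShift_naturality_right (X : K) (n : ℤ) {Y Y' : K} (g : Y ⟶ Y') :
    X ◁ g⟦n⟧' ≫ (tensorShift X n Y').hom = (tensorShift X n Y).hom ≫ (X ◁ g)⟦n⟧' :=
  (tensorLeft X).commShiftIso_hom_naturality g n

lemma tensorShift_unit (n : ℤ) (Y : K) :
    (tensorShift (𝟙_ K) n Y).hom ≫ (λ_ Y).hom⟦n⟧' = (λ_ (Y⟦n⟧)).hom :=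
  TensorTriangulated.unit n Y

lemma tensorShift_assoc (X X' : K) (n : ℤ) (Y : K) :
    (tensorShift (X ⊗ X') n Y).hom ≫ (α_ X X' Y).hom⟦n⟧' =
      (α_ X X' (Y⟦n⟧)).hom ≫ X ◁ (tensorShift X' n Y).hom ≫ (tensorShift X n (X' ⊗ Y)).hom :=
  TensorTriangulated.assoc X X' n Y

lemma tensorShift_unit_inv (n : ℤ) (Y : K) :
    (λ_ (Y⟦n⟧)).inv ≫ (tensorShift (𝟙_ K) n Y).hom = (λ_ Y).inv⟦n⟧' := by
  rw [Iso.inv_comp_eq, ← tensorShift_unit, assoc, ← Functor.map_comp, Iso.hom_inv_id,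
    CategoryTheory.Functor.map_id, comp_id]

lemma tensorShift_assoc_inv (X X' : K) (n : ℤ) (Y : K) :
    (α_ X X' (Y⟦n⟧)).inv ≫ (tensorShift (X ⊗ X') n Y).hom =
      X ◁ (tensorShift X' n Y).hom ≫ (tensorShift X n (X' ⊗ Y)).hom ≫ (α_ X X' Y).inv⟦n⟧' := by
  rw [Iso.inv_comp_eq, ← assoc (X ◁ _), ← assoc, ← tensorShift_assoc, assoc, ← Functor.map_comp,
    Iso.hom_inv_id, CategoryTheory.Functor.map_id, comp_id]

lemma linSection_shiftMod {A : K} [MonObj A] [IsSeparableRing A] (n : ℤ) (N : Mod K A) :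
    linSection (shiftMod n N) ≫ (tensorShift A n N.X).hom = (linSection N)⟦n⟧' := by
  have h (u : 𝟙_ K ⟶ A ⊗ A) : ((λ_ (N.X⟦n⟧)).inv ≫ u ▷ (N.X⟦n⟧) ≫ (α_ A A (N.X⟦n⟧)).hom ≫
      A ◁ ((tensorShift A n N.X).hom ≫ (act N)⟦n⟧')) ≫ (tensorShift A n N.X).hom =
      ((λ_ N.X).inv ≫ u ▷ N.X ≫ (α_ A A N.X).hom ≫ A ◁ act N)⟦n⟧' := by
    simp only [assoc, whiskerLeft_comp, CategoryTheory.Functor.map_comp]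
    rw [tensorShift_naturality_right, ← reassoc_of% (tensorShift_assoc A A n N.X),
      reassoc_of% (tensorShift_naturality_left u n N.X), reassoc_of% (tensorShift_unit_inv n N.X)]
  exact h _

variable [SymmetricCategory K] [IsIdempotentComplete K] {A B : K} [MonObj A] [MonObj B]
  [IsCommMonObj B] [IsSeparableRing A] (f : A ⟶ B) [IsMonHom f] (M : Mod K B) (n : ℤ)
  (N : Mod K A)

/-- The section of the action on the shifted module is the shifted section, and `tensorShift` is
natural and associative. Hence the images of the two idempotents correspond under `tensorShift`. -/
lemma relIdem_shiftMod : relIdem f M (shiftMod n N) ≫ (tensorShift M.X n N.X).hom =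
    (tensorShift M.X n N.X).hom ≫ (relIdem f M N)⟦n⟧' := by
  have h (s : N.X⟦n⟧ ⟶ A ⊗ N.X⟦n⟧) (hs : s ≫ (tensorShift A n N.X).hom = (linSection N)⟦n⟧') :
      (M.X ◁ s ≫ (α_ M.X A (N.X⟦n⟧)).inv ≫ rightAct f M ▷ (N.X⟦n⟧)) ≫
        (tensorShift M.X n N.X).hom = (tensorShift M.X n N.X).hom ≫
        (M.X ◁ linSection N ≫ (α_ M.X A N.X).inv ≫ rightAct f M ▷ N.X)⟦n⟧' := by
    simp only [assoc, CategoryTheory.Functor.map_comp]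
    rw [tensorShift_naturality_left, reassoc_of% (tensorShift_assoc_inv M.X A n N.X),
      ← whiskerLeft_comp_assoc, hs,
      reassoc_of% (tensorShift_naturality_right M.X n (linSection N))]
  exact h _ (linSection_shiftMod n N)

/-- The projection `M ⊗ N⟦n⟧ ⟶ M ⊗_A N⟦n⟧`. -/
def relπShift : M.X ⊗ N.X⟦n⟧ ⟶ (relTensor f M (shiftMod n N)).X := relπ f M (shiftMod n N)

instance : IsSplitEpi (relπShift f M n N) :=
  inferInstanceAs (IsSplitEpi (relπ f M (shiftMod n N)))

/-- The relative tensor product commutes with shifts, in the second variable. -/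
lemma exists_relTensorShift :
    ∃ θ : relTensor f M (shiftMod n N) ≅ shiftMod n (relTensor f M N),
      relπShift f M n N ≫ (forgetIso θ).hom =
        (tensorShift M.X n N.X).hom ≫ (relπ f M N)⟦n⟧' := by
  let p := relπShift f M n N
  let i : (relTensor f M (shiftMod n N)).X ⟶ M.X ⊗ N.X⟦n⟧ := relι f M (shiftMod n N)
  let e : M.X ⊗ N.X⟦n⟧ ⟶ M.X ⊗ N.X⟦n⟧ := relIdem f M (shiftMod n N)
  have hpi₀ : p ≫ i = e := relπ_relι f M (shiftMod n N)
  have he : e ≫ (tensorShift M.X n N.X).hom = (tensorShift M.X n N.X).hom ≫ (relIdem f M N)⟦n⟧' :=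
    relIdem_shiftMod f M n N
  have hpi : p ≫ i ≫ (tensorShift M.X n N.X).hom =
      (tensorShift M.X n N.X).hom ≫ (relIdem f M N)⟦n⟧' := by
    rw [reassoc_of% hpi₀, he]
  have hip : i ≫ p = 𝟙 _ := relι_relπ f M (shiftMod n N)
  have hπ : (relι f M N)⟦n⟧' ≫ (relπ f M N)⟦n⟧' = 𝟙 ((relTensor f M N).X⟦n⟧) := by
    rw [← CategoryTheory.Functor.map_comp, relι_relπ, CategoryTheory.Functor.map_id]
  have hπ' : (relIdem f M N)⟦n⟧' ≫ (relπ f M N)⟦n⟧' = (relπ f M N)⟦n⟧' := by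
    rw [← CategoryTheory.Functor.map_comp, relIdem_relπ]
  have hp : p ≫ i ≫ (tensorShift M.X n N.X).hom ≫ (relπ f M N)⟦n⟧' =
      (tensorShift M.X n N.X).hom ≫ (relπ f M N)⟦n⟧' := by
    rw [reassoc_of% hpi, hπ']
  let θ : (relTensor f M (shiftMod n N)).X ≅ (relTensor f M N).X⟦n⟧ :=
    { hom := i ≫ (tensorShift M.X n N.X).hom ≫ (relπ f M N)⟦n⟧'
      inv := (relι f M N)⟦n⟧' ≫ (tensorShift M.X n N.X).inv ≫ p
      hom_inv_id := by
        have h : (relπ f M N)⟦n⟧' ≫ (relι f M N)⟦n⟧' = (relIdem f M N)⟦n⟧' := by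
          rw [← CategoryTheory.Functor.map_comp, relπ_relι]
        have h' : (tensorShift M.X n N.X).hom ≫ (relIdem f M N)⟦n⟧' ≫
            (tensorShift M.X n N.X).inv = p ≫ i := by
          rw [← reassoc_of% hpi, Iso.hom_inv_id, comp_id]
        simp only [assoc]
        rw [reassoc_of% h, reassoc_of% h', hip, comp_id, hip]
      inv_hom_id := by
        simp only [assoc]
        rw [hp, Iso.inv_hom_id_assoc, hπ] }
  have hθ : p ≫ θ.hom = (tensorShift M.X n N.X).hom ≫ (relπ f M N)⟦n⟧' := hp
  refine ⟨isoMod (N := shiftMod n (relTensor f M N)) θ ?_, hp⟩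
  have ha : B ◁ p ≫ act (relTensor f M (shiftMod n N)) =
      ((α_ B M.X (N.X⟦n⟧)).inv ≫ act M ▷ (N.X⟦n⟧)) ≫ p :=
    whiskerLeft_relπ_act f M (shiftMod n N)
  have hb := congrArg (shiftFunctor K n).map (whiskerLeft_relπ_act f M N)
  simp only [CategoryTheory.Functor.map_comp, assoc] at hb
  have hc : B ◁ (tensorShift M.X n N.X).hom ≫ (tensorShift B n (M.X ⊗ N.X)).hom =
      (α_ B M.X (N.X⟦n⟧)).inv ≫ (tensorShift (B ⊗ M.X) n N.X).hom ≫
        (α_ B M.X N.X).hom⟦n⟧' := by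
    rw [tensorShift_assoc, Iso.inv_hom_id_assoc]
  change act _ ≫ θ.hom =
    B ◁ θ.hom ≫ (tensorShift B n (relTensor f M N).X).hom ≫ (act (relTensor f M N))⟦n⟧'
  rw [← cancel_epi (B ◁ p), reassoc_of% ha, hθ, ← whiskerLeft_comp_assoc, hθ,
    reassoc_of% (tensorShift_naturality_left (act M) n N.X), whiskerLeft_comp_assoc,
    reassoc_of% (tensorShift_naturality_right B n (relπ f M N)), hb, reassoc_of% hc,
    ← CategoryTheory.Functor.map_comp_assoc, Iso.hom_inv_id, CategoryTheory.Functor.map_id,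
    id_comp]

end Shift

/-! ### Exactness of relative tensor products and scalar functors -/

section Exactness

variable {K : Type u} [Category.{v} K] [Preadditive K] [HasZeroObject K] [HasShift K ℤ]
  [∀ n : ℤ, (shiftFunctor K n).Additive] [Pretriangulated K] [MonoidalCategory K]
  [TensorTriangulated K]

lemma isZero_tensor (X : K) {Y : K} (h : IsZero Y) : IsZero (X ⊗ Y) :=
  (tensorLeft X).map_isZero h

lemma isZero_of_retract {X Y : K} (r : Retract X Y) (h : IsZero Y) : IsZero X := by
  rw [IsZero.iff_id_eq_zero, ← r.retract, h.eq_of_tgt r.i 0, zero_comp]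

lemma isZero_mod_of_isZero {A : K} [MonObj A] {M : Mod K A} (h : IsZero M.X) : IsZero M where
  unique_to N := ⟨
    { default := mkHom (h.to_ N.X) ((isZero_tensor A h).eq_of_src _ _)
      uniq := fun g ↦ by ext; exact h.eq_of_src _ _ }⟩
  unique_from N := ⟨
    { default := mkHom (h.from_ N.X) (h.eq_of_tgt _ _)
      uniq := fun g ↦ by ext; exact h.eq_of_tgt _ _ }⟩

lemma exists_isZero_mod (A : K) [MonObj A] : ∃ M : Mod K A, IsZero M.X := by
  obtain ⟨Z, hZ⟩ := HasZeroObject.zero (C := K)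
  exact ⟨mkMod Z (hZ.from_ _) (hZ.eq_of_tgt _ _) (hZ.eq_of_tgt _ _), hZ⟩

lemma isZero_X_of_isZero {A : K} [MonObj A] {M : Mod K A} (h : IsZero M) : IsZero M.X := by
  obtain ⟨N, hN⟩ := exists_isZero_mod A
  exact hN.of_iso (forgetIso (h.iso (isZero_mod_of_isZero hN)))

variable [SymmetricCategory K] [IsIdempotentComplete K]

section RelTensor

variable {A B : K} [MonObj A] [IsCommMonObj A] [IsSeparableRing A] [MonObj B]
  [IsCommMonObj B] [IsSeparableRing B] (f : A ⟶ B) [IsMonHom f] (M : Mod K B)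

lemma relIdem_naturality {N N' : Mod K A} (g : N ⟶ N') :
    relIdem f M N ≫ M.X ◁ g.hom = M.X ◁ g.hom ≫ relIdem f M N' := by
  simp only [relIdem, assoc]
  rw [← whiskerLeft_comp_assoc, linSection_naturality, whiskerLeft_comp_assoc,
    associator_inv_naturality_right_assoc, whisker_exchange]

lemma relMapRight_relι {N N' : Mod K A} (g : N ⟶ N') :
    (relMapRight f M g).hom ≫ relι f M N' = relι f M N ≫ M.X ◁ g.hom := by
  rw [← cancel_epi (relπ f M N), reassoc_of% (relπ_relMapRight f M g), relπ_relι,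
    ← relIdem_naturality, ← relπ_relι, assoc]

/-- The retract `M ⊗_A N` of `M ⊗ N`. -/
def retractRelTensor (N : Mod K A) : Retract (relTensor f M N).X (M.X ⊗ N.X) where
  i := relι f M N
  r := relπ f M N
  retract := relι_relπ f M N

/-- The relative tensor product is exact in the second variable. -/
lemma isExactOn_relTensor : IsExactOn (modTTData A) (modTTData B) (relTensor f M) where
  zero N hN := isZero_mod_of_isZero (isZero_of_retract (retractRelTensor f M N)
    (isZero_tensor _ (isZero_X_of_isZero hN)))
  shift n N := ⟨(exists_relTensorShift f M n N).choose⟩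
  dist {N₁ N₂ N₃} u v w hd := by
    obtain ⟨θ, hθ₀⟩ := exists_relTensorShift f M 1 N₁
    let t : (relTensor f M (shiftMod 1 N₁)).X ⟶ (relTensor f M N₁).X⟦(1 : ℤ)⟧ := (forgetIso θ).hom
    have hθ : relπShift f M 1 N₁ ≫ t = (tensorShift M.X 1 N₁.X).hom ≫ (relπ f M N₁)⟦1⟧' := hθ₀
    let w' : N₃.X ⟶ N₁.X⟦(1 : ℤ)⟧ := w.hom
    let k : (relTensor f M N₃).X ⟶ (relTensor f M (shiftMod 1 N₁)).X := (relMapRight f M w).hom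
    have hw : relπ f M N₃ ≫ k = M.X ◁ w' ≫ relπShift f M 1 N₁ := relπ_relMapRight f M w
    let e : M.X ⊗ N₁.X⟦(1 : ℤ)⟧ ⟶ M.X ⊗ N₁.X⟦(1 : ℤ)⟧ := relIdem f M (shiftMod 1 N₁)
    have he : e ≫ (tensorShift M.X 1 N₁.X).hom =
        (tensorShift M.X 1 N₁.X).hom ≫ (relIdem f M N₁)⟦1⟧' := relIdem_shiftMod f M 1 N₁
    have he' : relIdem f M N₃ ≫ M.X ◁ w' = M.X ◁ w' ≫ e := relIdem_naturality f M w
    -- This triangle in `K` is distinguished, and naturality of the idempotents exhibits the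
    -- triangle of relative tensor products as a retract of it. The equations `hk` and `hk'` are
    -- compatibility with the connecting maps.
    have hT : Triangle.mk (M.X ◁ u.hom) (M.X ◁ v.hom)
        (M.X ◁ w' ≫ (tensorShift M.X 1 N₁.X).hom) ∈ distTriang K :=
      (tensorLeft M.X).map_distinguished _ hd
    have hk : (k ≫ t) ≫ (relι f M N₁)⟦1⟧' =
        relι f M N₃ ≫ M.X ◁ w' ≫ (tensorShift M.X 1 N₁.X).hom := by
      rw [← cancel_epi (relπ f M N₃), assoc, reassoc_of% hw, reassoc_of% hθ,
        ← CategoryTheory.Functor.map_comp, relπ_relι, ← he, ← assoc (relπ f M N₃), relπ_relι,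
        reassoc_of% he']
    have hk' : (M.X ◁ w' ≫ (tensorShift M.X 1 N₁.X).hom) ≫ (relπ f M N₁)⟦1⟧' =
        relπ f M N₃ ≫ k ≫ t := by
      rw [assoc, ← hθ, reassoc_of% hw]
    exact ⟨relMapRight f M u, relMapRight f M v, relMapRight f M w ≫ θ.hom,
      distinguished_of_retract hT (retractRelTensor f M N₁) (retractRelTensor f M N₂)
        (retractRelTensor f M N₃) (relMapRight_relι f M u) (relMapRight_relι f M v) hk
        (relπ_relMapRight f M u).symm (relπ_relMapRight f M v).symm hk'⟩
  retract r := ⟨relTensorRetract f M r⟩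

end RelTensor

lemma isExactOn_tensor (X : K) : IsExactOn (ttData K) (ttData K) (X ⊗ ·) where
  zero Y hY := isZero_tensor X hY
  shift n Y := ⟨tensorShift X n Y⟩
  dist f g h hd := ⟨_, _, _, (tensorLeft X).map_distinguished _ hd⟩
  retract r := ⟨r.map (tensorLeft X)⟩

section Scalars

variable (A : K) [MonObj A] [IsCommMonObj A] [IsSeparableRing A]

lemma isExactOn_forget : IsExactOn (modTTData A) (ttData K) (fun M ↦ M.X) where
  zero M hM := isZero_X_of_isZero hM
  shift n M := ⟨Iso.refl _⟩
  dist f g h hd := ⟨f.hom, g.hom, h.hom, hd⟩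
  retract r := ⟨forgetRetract r⟩

lemma isExactOn_resMod {A B : K} [MonObj A] [IsCommMonObj A] [IsSeparableRing A] [MonObj B]
    [IsCommMonObj B] [IsSeparableRing B] (f : A ⟶ B) [IsMonHom f] :
    IsExactOn (modTTData B) (modTTData A) (resMod f) where
  zero M hM := isZero_mod_of_isZero (M := resMod f M) (isZero_X_of_isZero (M := M) hM)
  shift n M := ⟨isoMod (M := resMod f (shiftMod n M)) (N := shiftMod n (resMod f M))
    (Iso.refl (M.X⟦n⟧)) (by
      change (f ▷ (M.X⟦n⟧) ≫ (tensorShift B n M.X).hom ≫ (act M)⟦n⟧') ≫ 𝟙 _ =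
        A ◁ 𝟙 (M.X⟦n⟧) ≫ (tensorShift A n M.X).hom ≫ (f ▷ M.X ≫ act M)⟦n⟧'
      rw [comp_id, whiskerLeft_id, id_comp, reassoc_of% (tensorShift_naturality_left f n M.X),
        CategoryTheory.Functor.map_comp])⟩
  dist {L _ N} u v w hd := by
    let w' : N.X ⟶ L.X⟦(1 : ℤ)⟧ := w.hom
    have hw : act N ≫ w' = B ◁ w' ≫ (tensorShift B 1 L.X).hom ≫ (act L)⟦1⟧' := act_hom w
    have hw' : (f ▷ N.X ≫ act N) ≫ w' =
        A ◁ w' ≫ (tensorShift A 1 L.X).hom ≫ (f ▷ L.X ≫ act L)⟦1⟧' := by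
      rw [assoc, hw, CategoryTheory.Functor.map_comp,
        ← reassoc_of% (tensorShift_naturality_left f 1 L.X), whisker_exchange_assoc]
    exact ⟨resModMap f u, resModMap f v,
      mkHom (M := resMod f N) (N := shiftMod 1 (resMod f L)) w' hw', hd⟩
  retract r := ⟨resModRetract f r⟩

/-- Free modules commute with shifts. -/
def freeModShift (n : ℤ) (X : K) : freeMod A (X⟦n⟧) ≅ shiftMod n (freeMod A X) :=
  isoMod (M := freeMod A (X⟦n⟧)) (N := shiftMod n (freeMod A X)) (tensorShift A n X) (by
    change ((α_ A A (X⟦n⟧)).inv ≫ (μ : A ⊗ A ⟶ A) ▷ (X⟦n⟧)) ≫ (tensorShift A n X).hom =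
      A ◁ (tensorShift A n X).hom ≫ (tensorShift A n (A ⊗ X)).hom ≫
        ((α_ A A X).inv ≫ μ ▷ X)⟦n⟧'
    rw [assoc, tensorShift_naturality_left, reassoc_of% (tensorShift_assoc_inv A A n X),
      CategoryTheory.Functor.map_comp])

/-- The functoriality of free modules. -/
def freeModMap {X Y : K} (g : X ⟶ Y) : freeMod A X ⟶ freeMod A Y :=
  mkHom (M := freeMod A X) (N := freeMod A Y) (A ◁ g) (by
    change ((α_ A A X).inv ≫ (μ : A ⊗ A ⟶ A) ▷ X) ≫ A ◁ g =
      A ◁ A ◁ g ≫ (α_ A A Y).inv ≫ μ ▷ Y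
    rw [assoc, ← whisker_exchange, associator_inv_naturality_right_assoc])

lemma isExactOn_freeMod : IsExactOn (ttData K) (modTTData A) (freeMod A) where
  zero X hX := isZero_mod_of_isZero (isZero_tensor A hX)
  shift n X := ⟨freeModShift A n X⟩
  dist f g h hd := ⟨freeModMap A f, freeModMap A g, freeModMap A h ≫ (freeModShift A 1 _).hom,
    (tensorLeft A).map_distinguished _ hd⟩
  retract {X Y} r := ⟨{
    i := freeModMap A r.i
    r := freeModMap A r.r
    retract := by
      ext
      change A ◁ r.i ≫ A ◁ r.r = 𝟙 _
      rw [← whiskerLeft_comp, r.retract, whiskerLeft_id] }⟩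

end Scalars

end Exactness

/-! ### Direct sums of modules and the resulting scalar extensions -/

section TensorTriangulatedModules

variable {K : Type u} [Category.{v} K] [Preadditive K] [HasZeroObject K] [HasShift K ℤ]
  [∀ n : ℤ, (shiftFunctor K n).Additive] [Pretriangulated K] [MonoidalCategory K]
  [TensorTriangulated K]

lemma whiskerLeft_zero (X : K) {Y Z : K} : X ◁ (0 : Y ⟶ Z) = 0 :=
  (tensorLeft X).map_zero Y Z

lemma whiskerLeft_add (X : K) {Y Z : K} (f g : Y ⟶ Z) : X ◁ (f + g) = X ◁ f + X ◁ g :=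
  (tensorLeft X).map_add

/-- The direct sum of modules. -/
def biprodMod {A : K} [MonObj A] (M N : Mod K A) : Mod K A :=
  mkMod (M.X ⊞ N.X) (biprod.lift (A ◁ biprod.fst ≫ act M) (A ◁ biprod.snd ≫ act N))
    (by
      ext
      · rw [assoc, biprod.lift_fst, ← whisker_exchange_assoc, one_act, leftUnitor_naturality]
      · rw [assoc, biprod.lift_snd, ← whisker_exchange_assoc, one_act, leftUnitor_naturality])
    (by
      ext
      · rw [assoc, assoc, assoc, biprod.lift_fst, ← whisker_exchange_assoc, mul_act,
          ← whiskerLeft_comp_assoc, biprod.lift_fst, whiskerLeft_comp_assoc,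
          associator_naturality_right_assoc]
      · rw [assoc, assoc, assoc, biprod.lift_snd, ← whisker_exchange_assoc, mul_act,
          ← whiskerLeft_comp_assoc, biprod.lift_snd, whiskerLeft_comp_assoc,
          associator_naturality_right_assoc])

section

variable {A : K} [MonObj A] (M N : Mod K A)

/-- The first inclusion. -/
def biprodModInl : M ⟶ biprodMod M N :=
  mkHom (N := biprodMod M N) (biprod.inl : M.X ⟶ M.X ⊞ N.X) (by
    change act M ≫ biprod.inl =
      A ◁ biprod.inl ≫ biprod.lift (A ◁ biprod.fst ≫ act M) (A ◁ biprod.snd ≫ act N)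
    ext
    · simp [← whiskerLeft_comp_assoc]
    · simp [← whiskerLeft_comp_assoc, whiskerLeft_zero])

/-- The second inclusion. -/
def biprodModInr : N ⟶ biprodMod M N :=
  mkHom (N := biprodMod M N) (biprod.inr : N.X ⟶ M.X ⊞ N.X) (by
    change act N ≫ biprod.inr =
      A ◁ biprod.inr ≫ biprod.lift (A ◁ biprod.fst ≫ act M) (A ◁ biprod.snd ≫ act N)
    ext
    · simp [← whiskerLeft_comp_assoc, whiskerLeft_zero]
    · simp [← whiskerLeft_comp_assoc])

/-- The first projection. -/
def biprodModFst : biprodMod M N ⟶ M :=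
  mkHom (M := biprodMod M N) (biprod.fst : M.X ⊞ N.X ⟶ M.X) (biprod.lift_fst _ _)

/-- The second projection. -/
def biprodModSnd : biprodMod M N ⟶ N :=
  mkHom (M := biprodMod M N) (biprod.snd : M.X ⊞ N.X ⟶ N.X) (biprod.lift_snd _ _)

/-- The first summand. -/
def biprodModRetractLeft : Retract M (biprodMod M N) where
  i := biprodModInl M N
  r := biprodModFst M N
  retract := by ext; exact biprod.inl_fst

/-- The second summand. -/
def biprodModRetractRight : Retract N (biprodMod M N) where
  i := biprodModInr M N
  r := biprodModSnd M N
  retract := by ext; exact biprod.inr_snd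

end

variable [SymmetricCategory K] [IsIdempotentComplete K]

section

variable {A : K} [MonObj A] [IsCommMonObj A] [IsSeparableRing A]

/-- Summands are retracts; conversely, the direct sum is the middle term of a triangle with zero
connecting map. -/
lemma biprodMod_mem_iff {I : Set (Mod K A)} (hI : IsThickIdeal (modTTData A) I) (M N : Mod K A) :
    biprodMod M N ∈ I ↔ M ∈ I ∧ N ∈ I := by
  refine ⟨fun h ↦ ⟨hI.retract_mem (biprodModRetractLeft M N) h,
    hI.retract_mem (biprodModRetractRight M N) h⟩, fun h ↦ ?_⟩
  let z : N ⟶ shiftMod 1 M := mkHom (N := shiftMod 1 M) (0 : N.X ⟶ M.X⟦(1 : ℤ)⟧) (by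
    change act N ≫ 0 = A ◁ (0 : N.X ⟶ M.X⟦(1 : ℤ)⟧) ≫ (tensorShift A 1 M.X).hom ≫ (act M)⟦1⟧'
    rw [whiskerLeft_zero, comp_zero, zero_comp])
  exact hI.dist_mem₂ (biprodModInl M N) (biprodModSnd M N) z
    (binaryBiproductTriangle_distinguished M.X N.X) h.1 h.2

end

instance isTensorTriangulated_ttData : IsTensorTriangulated (ttData K) where
  unit := 𝟙_ K
  unit_tensor X := ⟨λ_ X⟩
  comm X Y := ⟨β_ X Y⟩
  assoc X Y Z := ⟨α_ X Y Z⟩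
  exact := isExactOn_tensor
  exists_zero := HasZeroObject.zero
  exists_sum X Y := ⟨X ⊞ Y, fun I hI ↦ ⟨fun h ↦
    ⟨hI.retract_mem ⟨biprod.inl, biprod.fst, biprod.inl_fst⟩ h,
      hI.retract_mem ⟨biprod.inr, biprod.snd, biprod.inr_snd⟩ h⟩, fun h ↦
    hI.dist_mem₂ _ _ _ (binaryBiproductTriangle_distinguished X Y) h.1 h.2⟩⟩

instance isTensorTriangulated_modTTData (A : K) [MonObj A] [IsCommMonObj A] [IsSeparableRing A] :
    IsTensorTriangulated (modTTData A) where
  unit := Mod.regular A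
  unit_tensor := nonempty_regular_relTensor
  comm := nonempty_relTensor_comm
  assoc M N L := by
    obtain ⟨i⟩ := nonempty_relTensor_assoc (𝟙 A) (𝟙 A) M N L
    rw [relTensor_congr (comp_id (𝟙 A))] at i
    exact ⟨i.symm⟩
  exact := isExactOn_relTensor (𝟙 A)
  exists_zero := by
    obtain ⟨M, hM⟩ := exists_isZero_mod A
    exact ⟨M, isZero_mod_of_isZero hM⟩
  exists_sum M N := ⟨biprodMod M N, fun I hI ↦ biprodMod_mem_iff hI M N⟩

/-- Extension of scalars along a homomorphism of separable commutative ring objects. -/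
def extensionTT {A B : K} [MonObj A] [IsCommMonObj A] [IsSeparableRing A] [MonObj B]
    [IsCommMonObj B] [IsSeparableRing B] (f : A ⟶ B) [IsMonHom f] :
    TTExtension (modTTData A) (modTTData B) where
  F := extendScalars f
  U := resMod f
  exact_F := isExactOn_relTensor f (Mod.regular B)
  exact_U := isExactOn_resMod f
  F_unit := nonempty_extendScalars_regular f
  F_tensor := nonempty_extendScalars_relTensor f
  U_tensor := nonempty_resMod_projection f
  retract_F_U := nonempty_retract_extendScalars f

/-- Extension of scalars from `K` to the category of modules over a separable commutative ring
object. -/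
def freeTT (A : K) [MonObj A] [IsCommMonObj A] [IsSeparableRing A] :
    TTExtension (ttData K) (modTTData A) where
  F := freeMod A
  U M := M.X
  exact_F := isExactOn_freeMod A
  exact_U := isExactOn_forget A
  F_unit := nonempty_freeMod_unit
  F_tensor := nonempty_freeMod_tensor
  U_tensor := nonempty_freeMod_projection
  retract_F_U := nonempty_retract_freeMod

end TensorTriangulatedModules

/-! ### Base change of `K ⟶ A-Mod` along itself -/

section BaseChange

variable {K : Type u} [Category.{v} K] [MonoidalCategory K] [SymmetricCategory K]

lemma inclRight_mul (A : K) [MonObj A] :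
    inclRight A ▷ (A ⊗ A) ≫ μ = (α_ A A A).inv ≫ (β_ A A).hom ▷ A ≫ (α_ A A A).hom ≫ A ◁ μ := by
  change inclRight A ▷ (A ⊗ A) ≫ tensorμ A A A A ≫ (μ ⊗ₘ μ) = _
  have h := tensorμ_natural_left (η : 𝟙_ K ⟶ A) (𝟙 A) A A
  simp only [tensorHom_id, id_whiskerRight] at h
  rw [inclRight, comp_whiskerRight, assoc, reassoc_of% h, MonoidalCategory.tensorHom_def,
    ← comp_whiskerRight_assoc, one_mul, tensorμ]
  simp only [assoc]
  monoidal

lemma inclLeft_mul (A : K) [MonObj A] :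
    (A ⊗ A) ◁ inclLeft A ≫ μ = (α_ A A A).hom ≫ A ◁ (β_ A A).hom ≫ (α_ A A A).inv ≫ μ ▷ A := by
  change (A ⊗ A) ◁ inclLeft A ≫ tensorμ A A A A ≫ (μ ⊗ₘ μ) = _
  have h := tensorμ_natural_right A A (𝟙 A) (η : 𝟙_ K ⟶ A)
  simp only [id_tensorHom, whiskerLeft_id] at h
  rw [inclLeft, whiskerLeft_comp, assoc, reassoc_of% h, MonoidalCategory.tensorHom_def',
    ← whiskerLeft_comp_assoc, MonObj.mul_one, tensorμ]
  simp only [assoc]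
  monoidal

lemma inclRight_inclLeft_mul (A : K) [MonObj A] :
    inclRight A ▷ A ≫ (A ⊗ A) ◁ inclLeft A ≫ μ = (β_ A A).hom := by
  rw [inclLeft_mul, inclRight, comp_whiskerRight, assoc, associator_naturality_left_assoc,
    ← whisker_exchange_assoc, associator_inv_naturality_left_assoc, ← comp_whiskerRight, one_mul]
  monoidal

variable [IsIdempotentComplete K] {A : K} [MonObj A] [IsCommMonObj A] [IsSeparableRing A]

/-- Base change of extension of scalars `K ⟶ A-Mod` along itself. -/
lemma nonempty_resMod_extendScalars (M : Mod K A) :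
    Nonempty (freeMod A M.X ≅ resMod (inclRight A) (extendScalars (inclLeft A) M)) := by
  let E := extendScalars (inclLeft A) M
  let p : (A ⊗ A) ⊗ M.X ⟶ E.X := relπ (inclLeft A) (Mod.regular (A ⊗ A)) M
  have : IsSplitEpi p := inferInstanceAs (IsSplitEpi (relπ (inclLeft A) (Mod.regular (A ⊗ A)) M))
  -- On elements, `(a ⊗ b) ⊗ m ↦ b ⊗ a m`: the first factor is the one contracted with `M` along
  -- `inclLeft`, and the second retains the action through `inclRight`.
  let q : (A ⊗ A) ⊗ M.X ⟶ A ⊗ M.X := (β_ A A).hom ▷ M.X ≫ (α_ A A M.X).hom ≫ A ◁ act M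
  have hs : IsSplitEpi q := by dsimp only [q]; infer_instance
  have : @IsSplitEpi K _ ((A ⊗ A) ⊗ M.X) (freeMod A M.X).X q := hs
  have : @IsSplitEpi K _ ((A ⊗ A) ⊗ M.X) (resMod (inclRight A) E).X p :=
    inferInstanceAs (IsSplitEpi p)
  have hR : rightAct (inclLeft A) (Mod.regular (A ⊗ A)) =
      (α_ A A A).hom ≫ A ◁ (β_ A A).hom ≫ (α_ A A A).inv ≫ μ ▷ A := by
    rw [rightAct_regular, inclLeft_mul]
  have hp : (A ⊗ A) ◁ p ≫ act E = ((α_ (A ⊗ A) (A ⊗ A) M.X).inv ≫ μ ▷ M.X) ≫ p :=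
    whiskerLeft_relπ_act (inclLeft A) (Mod.regular (A ⊗ A)) M
  have hc : ((A ⊗ A) ◁ inclLeft A ≫ μ) ▷ M.X ≫ p =
      ((α_ (A ⊗ A) A M.X).hom ≫ (A ⊗ A) ◁ act M) ≫ p := by
    rw [← rightAct_regular]
    exact relπ_condition (inclLeft A) (Mod.regular (A ⊗ A)) M
  have hq : ((α_ A A A).hom ≫ A ◁ (β_ A A).hom ≫ (α_ A A A).inv ≫ μ ▷ A) ▷ M.X ≫ q =
      ((α_ (A ⊗ A) A M.X).hom ≫ (A ⊗ A) ◁ act M) ≫ q := by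
    have h₁ : μ ▷ A ≫ (β_ A A).hom = (α_ A A A).hom ≫ A ◁ (β_ A A).hom ≫ (α_ A A A).inv ≫
        (β_ A A).hom ▷ A ≫ (α_ A A A).hom ≫ A ◁ μ := by
      rw [BraidedCategory.braiding_naturality_left, BraidedCategory.braiding_tensor_left_hom]
      simp only [assoc]
    have h₂ : ((α_ A A A).hom ≫ A ◁ (β_ A A).hom ≫ (α_ A A A).inv ≫ μ ▷ A) ≫ (β_ A A).hom =
        (β_ A A).hom ▷ A ≫ (α_ A A A).hom ≫ A ◁ μ := by
      simp only [assoc]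
      rw [h₁, Iso.inv_hom_id_assoc, ← whiskerLeft_comp_assoc, SymmetricCategory.symmetry]
      simp
    dsimp only [q]
    rw [← comp_whiskerRight_assoc, h₂]
    have h₃ := whisker_exchange (β_ A A).hom (act M)
    simp only [comp_whiskerRight, assoc, associator_naturality_middle_assoc,
      ← whiskerLeft_comp, mul_act, reassoc_of% h₃]
    simp
  have hqa : A ◁ q ≫ (α_ A A M.X).inv ≫ μ ▷ M.X =
      (inclRight A ▷ ((A ⊗ A) ⊗ M.X) ≫ (α_ (A ⊗ A) (A ⊗ A) M.X).inv ≫ μ ▷ M.X) ≫ q := by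
    have h₁ : (α_ A A A).inv ≫ (β_ A A).hom ▷ A ≫ (α_ A A A).hom ≫ A ◁ μ ≫ (β_ A A).hom =
        A ◁ (β_ A A).hom ≫ (α_ A A A).inv ≫ μ ▷ A := by
      rw [BraidedCategory.braiding_naturality_right, BraidedCategory.braiding_tensor_right_hom]
      simp only [assoc, Iso.hom_inv_id_assoc]
      rw [← comp_whiskerRight_assoc, SymmetricCategory.symmetry]
      simp
    rw [associator_inv_naturality_left_assoc, ← comp_whiskerRight, inclRight_mul]
    dsimp only [q]
    rw [assoc, ← comp_whiskerRight_assoc]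
    simp only [assoc]
    rw [h₁]
    simp only [whiskerLeft_comp, assoc, associator_inv_naturality_right_assoc,
      whisker_exchange]
    monoidal
  -- In the quotient, `(1 ⊗ b) ⊗ a m = (1 ⊗ b)(a ⊗ 1) ⊗ m = (a ⊗ b) ⊗ m`.
  have hqp : q ≫ inclRight A ▷ M.X ≫ p = p := by
    have h₁ : A ◁ act M ≫ inclRight A ▷ M.X ≫ p = (α_ A A M.X).inv ≫
        (inclRight A ▷ A ≫ (A ⊗ A) ◁ inclLeft A ≫ μ) ▷ M.X ≫ p := by
      rw [comp_whiskerRight_assoc, hc, whisker_exchange_assoc]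
      simp
    dsimp only [q]
    rw [assoc, assoc, h₁, inclRight_inclLeft_mul, Iso.hom_inv_id_assoc, ← comp_whiskerRight_assoc,
      SymmetricCategory.symmetry, id_whiskerRight, id_comp]
  refine nonempty_iso_of_factors (M := freeMod A M.X) (N := resMod (inclRight A) E)
    (inclRight A ▷ ((A ⊗ A) ⊗ M.X) ≫ (α_ (A ⊗ A) (A ⊗ A) M.X).inv ≫ μ ▷ M.X) q p hqa ?_
    ⟨inclRight A ▷ M.X ≫ p, hqp⟩ ?_
  · change A ◁ p ≫ inclRight A ▷ E.X ≫ act E =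
      (inclRight A ▷ ((A ⊗ A) ⊗ M.X) ≫ (α_ (A ⊗ A) (A ⊗ A) M.X).inv ≫ μ ▷ M.X) ≫ p
    rw [whisker_exchange_assoc, hp, assoc, assoc, assoc]
  · refine ⟨_, relπ_factors (inclLeft A) (M := Mod.regular (A ⊗ A)) (N := M) q ?_⟩
    rw [hR]
    exact hq

end BaseChange

/-! ### Maps between `C ⊗_B M` and `D ⊗_C M` -/

section Splitting

variable {K : Type u} [Category.{v} K] [MonoidalCategory K] [SymmetricCategory K]
  [IsIdempotentComplete K] {B C D : K} [MonObj B] [IsCommMonObj B] [IsSeparableRing B]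
  [MonObj C] [IsCommMonObj C] [IsSeparableRing C] [MonObj D] [IsCommMonObj D]
  [IsSeparableRing D]
  (f : B ⟶ C) [IsMonHom f]

/-- The idempotent on `C ⊗ C` with image `C ⊗_B C`. -/
def baseIdem : C ⊗ C ⟶ C ⊗ C := relIdem f (Mod.regular C) (resMod f (Mod.regular C))

lemma map_baseIdem_comp {L : Type*} [Category* L] (G : K ⥤ L) {Z : L} (k : G.obj (C ⊗ C) ⟶ Z)
    (hk : G.map ((C ◁ f ≫ μ) ▷ C) ≫ k = G.map ((α_ C B C).hom ≫ C ◁ (f ▷ C ≫ μ)) ≫ k) :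
    G.map (baseIdem f) ≫ k = k := by
  refine map_relIdem_comp (M := Mod.regular C) (N := resMod f (Mod.regular C)) f G k ?_
  rw [rightAct_regular]
  exact hk

/-- The map `(C ⊗ C) ⊗ M ⟶ C ⊗_B M` given by the action of the second factor. -/
def baseAct (M : Mod K C) : (C ⊗ C) ⊗ M.X ⟶ (extendScalars f (resMod f M)).X :=
  (α_ C C M.X).hom ≫ C ◁ act M ≫ relπ f (Mod.regular C) (resMod f M)

/-- The projection `C ⊗ M ⟶ C ⊗_B M`. -/
def baseπ (M : Mod K C) : C ⊗ M.X ⟶ (extendScalars f (resMod f M)).X :=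
  relπ f (Mod.regular C) (resMod f M)

instance (M : Mod K C) : IsSplitEpi (baseπ f M) :=
  inferInstanceAs (IsSplitEpi (relπ f (Mod.regular C) (resMod f M)))

lemma baseAct_eq (M : Mod K C) : baseAct f M = (α_ C C M.X).hom ≫ C ◁ act M ≫ baseπ f M := rfl

lemma baseπ_condition (M : Mod K C) : (C ◁ f ≫ μ) ▷ M.X ≫ baseπ f M =
    ((α_ C B M.X).hom ≫ C ◁ (f ▷ M.X ≫ act M)) ≫ baseπ f M := by
  rw [← rightAct_regular]
  exact relπ_condition f (Mod.regular C) (resMod f M)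

lemma whiskerLeft_baseπ_act (M : Mod K C) : C ◁ baseπ f M ≫ act (extendScalars f (resMod f M)) =
    ((α_ C C M.X).inv ≫ μ ▷ M.X) ≫ baseπ f M :=
  whiskerLeft_relπ_act f (Mod.regular C) (resMod f M)

/-- The map `c ⊗ c' ⊗ m ↦ c ⊗ c' m` already identifies the two actions of `B` on `C ⊗ C`. Hence maps
into `C ⊗ C` need only be linear modulo `baseIdem`. -/
lemma baseIdem_baseAct (M : Mod K C) : baseIdem f ▷ M.X ≫ baseAct f M = baseAct f M := by
  refine map_baseIdem_comp f (tensorRight M.X) (baseAct f M) ?_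
  change (C ◁ f ≫ μ) ▷ C ▷ M.X ≫ baseAct f M =
    ((α_ C B C).hom ≫ C ◁ (f ▷ C ≫ μ)) ▷ M.X ≫ baseAct f M
  rw [baseAct_eq, associator_naturality_left_assoc, ← whisker_exchange_assoc, baseπ_condition]
  simp only [comp_whiskerRight, whiskerLeft_comp, assoc, associator_naturality_middle_assoc]
  rw [← whiskerLeft_comp_assoc C (μ ▷ M.X), mul_act, associator_naturality_right_assoc,
    ← whiskerLeft_comp_assoc C (B ◁ act M), whisker_exchange]
  simp

lemma baseAct_right (M : Mod K C) : ((α_ C C C).hom ≫ C ◁ μ) ▷ M.X ≫ baseAct f M =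
    (α_ (C ⊗ C) C M.X).hom ≫ (C ⊗ C) ◁ act M ≫ baseAct f M := by
  rw [baseAct_eq]
  simp only [comp_whiskerRight, assoc, associator_naturality_middle_assoc]
  rw [← whiskerLeft_comp_assoc C (μ ▷ M.X), mul_act]
  simp

lemma baseAct_left (M : Mod K C) : C ◁ baseAct f M ≫ act (extendScalars f (resMod f M)) =
    (α_ C (C ⊗ C) M.X).inv ≫ ((α_ C C C).inv ≫ μ ▷ C) ▷ M.X ≫ baseAct f M := by
  rw [baseAct_eq, whiskerLeft_comp, whiskerLeft_comp, assoc, assoc, whiskerLeft_baseπ_act]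
  simp only [comp_whiskerRight, assoc, associator_naturality_left_assoc, ← whisker_exchange_assoc]
  monoidal

lemma inclLeft_baseAct (M : Mod K C) : inclLeft C ▷ M.X ≫ baseAct f M = baseπ f M := by
  rw [baseAct_eq, inclLeft, comp_whiskerRight, assoc, associator_naturality_middle_assoc,
    ← whiskerLeft_comp_assoc, one_act]
  simp

variable (s t : C ⟶ D) [IsMonHom s] [IsMonHom t]

/-- The projection `D ⊗ M ⟶ D ⊗_C M`. -/
def extπ (M : Mod K C) : D ⊗ M.X ⟶ (extendScalars t M).X := relπ t (Mod.regular D) M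

/-- The section of `D ⊗ M ⟶ D ⊗_C M`. -/
def extι (M : Mod K C) : (extendScalars t M).X ⟶ D ⊗ M.X := relι t (Mod.regular D) M

instance (M : Mod K C) : IsSplitEpi (extπ t M) :=
  inferInstanceAs (IsSplitEpi (relπ t (Mod.regular D) M))

lemma extπ_condition (M : Mod K C) : (D ◁ t ≫ μ) ▷ M.X ≫ extπ t M =
    ((α_ D C M.X).hom ≫ D ◁ act M) ≫ extπ t M := by
  rw [← rightAct_regular]
  exact relπ_condition t (Mod.regular D) M

lemma whiskerLeft_extπ_act (M : Mod K C) : D ◁ extπ t M ≫ act (extendScalars t M) =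
    ((α_ D D M.X).inv ≫ μ ▷ M.X) ≫ extπ t M :=
  whiskerLeft_relπ_act t (Mod.regular D) M

lemma extπ_factors (M : Mod K C) {Z : K} (k : D ⊗ M.X ⟶ Z)
    (hk : (D ◁ t ≫ μ) ▷ M.X ≫ k = ((α_ D C M.X).hom ≫ D ◁ act M) ≫ k) :
    extπ t M ≫ extι t M ≫ k = k := by
  rw [← rightAct_regular] at hk
  exact relπ_factors (M := Mod.regular D) (N := M) t k hk

/-- The map `C ⊗_B M ⟶ D ⊗_C M` over `s`, for homomorphisms `s, t : C ⟶ D` which agree on `B`. -/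
lemma exists_extend_base_hom (hst : f ≫ s = f ≫ t) (M : Mod K C) :
    ∃ b : extendScalars f (resMod f M) ⟶ resMod s (extendScalars t M),
      baseπ f M ≫ b.hom = s ▷ M.X ≫ extπ t M := by
  obtain ⟨k, hk⟩ : ∃ k, baseπ f M ≫ k = s ▷ M.X ≫ extπ t M := by
    refine ⟨_, relπ_factors (M := Mod.regular C) (N := resMod f M) f (s ▷ M.X ≫ extπ t M) ?_⟩
    rw [rightAct_regular]
    change (C ◁ f ≫ μ) ▷ M.X ≫ s ▷ M.X ≫ extπ t M =
      ((α_ C B M.X).hom ≫ C ◁ (f ▷ M.X ≫ act M)) ≫ s ▷ M.X ≫ extπ t M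
    have h₁ : (C ◁ f ≫ μ) ≫ s = s ▷ B ≫ D ◁ f ≫ D ◁ t ≫ μ := by
      rw [assoc, IsMonHom.mul_hom, MonoidalCategory.tensorHom_def, assoc, whisker_exchange_assoc,
        ← whiskerLeft_comp_assoc, hst, whiskerLeft_comp_assoc]
    have h₂ : (D ◁ t ≫ μ) ▷ M.X ≫ extπ t M =
      ((α_ D C M.X).hom ≫ D ◁ act M) ≫ extπ t M := extπ_condition t M
    rw [← comp_whiskerRight_assoc, h₁, comp_whiskerRight_assoc, comp_whiskerRight_assoc, h₂]
    simp only [whiskerLeft_comp, assoc, whisker_exchange_assoc, associator_naturality_left_assoc,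
      associator_naturality_middle_assoc]
  refine ⟨mkHom (N := resMod s (extendScalars t M)) k ?_, hk⟩
  change act (extendScalars f (resMod f M)) ≫ k = C ◁ k ≫ s ▷ _ ≫ act (extendScalars t M)
  rw [← cancel_epi (C ◁ baseπ f M), reassoc_of% (whiskerLeft_baseπ_act f M), hk,
    ← whiskerLeft_comp_assoc, hk, whisker_exchange_assoc, whiskerLeft_comp_assoc,
    whiskerLeft_extπ_act, ← comp_whiskerRight_assoc, IsMonHom.mul_hom,
    MonoidalCategory.tensorHom_def']
  simp [whisker_exchange_assoc]

/-- The map `D ⊗_C M ⟶ C ⊗_B M` over `s` which is induced by a bilinear map `D ⟶ C ⊗_B C`. -/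
lemma exists_base_extend_hom (v : D ⟶ C ⊗ C)
    (hr : v ▷ C ≫ ((α_ C C C).hom ≫ C ◁ μ) ≫ baseIdem f = (D ◁ t ≫ μ) ≫ v)
    (hl : C ◁ v ≫ ((α_ C C C).inv ≫ μ ▷ C) ≫ baseIdem f = (s ▷ D ≫ μ) ≫ v) (M : Mod K C) :
    ∃ d : resMod s (extendScalars t M) ⟶ extendScalars f (resMod f M),
      extπ t M ≫ d.hom = v ▷ M.X ≫ baseAct f M := by
  obtain ⟨k, hk⟩ : ∃ k, extπ t M ≫ k = v ▷ M.X ≫ baseAct f M := by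
    refine ⟨_, extπ_factors t M (v ▷ M.X ≫ baseAct f M) ?_⟩
    rw [← comp_whiskerRight_assoc, ← hr, comp_whiskerRight_assoc, comp_whiskerRight_assoc,
      baseIdem_baseAct, baseAct_right]
    simp [whisker_exchange_assoc]
  refine ⟨mkHom (M := resMod s (extendScalars t M)) k ?_, hk⟩
  change (s ▷ _ ≫ act (extendScalars t M)) ≫ k = C ◁ k ≫ act (extendScalars f (resMod f M))
  have h : s ▷ (D ⊗ M.X) ≫ (α_ D D M.X).inv ≫ μ ▷ M.X ≫ v ▷ M.X ≫ baseAct f M =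
      (α_ C D M.X).inv ≫ ((s ▷ D ≫ μ) ≫ v) ▷ M.X ≫ baseAct f M := by
    simp
  rw [← cancel_epi (C ◁ extπ t M), assoc, whisker_exchange_assoc,
    reassoc_of% (whiskerLeft_extπ_act t M), hk, h, ← hl, ← whiskerLeft_comp_assoc, hk,
    whiskerLeft_comp_assoc, baseAct_left, comp_whiskerRight_assoc, comp_whiskerRight_assoc,
    baseIdem_baseAct, associator_inv_naturality_middle_assoc]

end Splitting

/-! ### Homomorphisms out of `C ⊗ C` -/

section Multiplication

variable {K : Type u} [Category.{v} K] [MonoidalCategory K] [SymmetricCategory K]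
  {B C D : K} [MonObj B] [MonObj C] [IsCommMonObj C] [MonObj D]

lemma incl_tensor_mul : (inclLeft C ⊗ₘ inclRight C) ≫ μ = 𝟙 (C ⊗ C) := by
  rw [← IsCommMonObj.mul_comm, BraidedCategory.braiding_naturality_assoc,
    MonoidalCategory.tensorHom_def, assoc, inclRight_inclLeft_mul, SymmetricCategory.symmetry]

/-- Since `c ⊗ c' = (c ⊗ 1)(1 ⊗ c')`, a homomorphism is determined by its restrictions to the two
factors. -/
lemma eq_incl_tensor_mul (h : C ⊗ C ⟶ D) [IsMonHom h] :
    h = ((inclLeft C ≫ h) ⊗ₘ (inclRight C ≫ h)) ≫ μ := by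
  rw [← tensorHom_comp_tensorHom, assoc, ← IsMonHom.mul_hom, ← assoc, incl_tensor_mul, id_comp]

variable (s t : C ⟶ D) [IsMonHom s] [IsMonHom t]

lemma mul_right_tensor_mul : (α_ C C C).hom ≫ C ◁ μ ≫ (s ⊗ₘ t) ≫ μ =
    ((s ⊗ₘ t) ≫ μ) ▷ C ≫ D ◁ t ≫ μ := by
  have h₁ : C ◁ μ ≫ (s ⊗ₘ t) = (s ⊗ₘ (t ⊗ₘ t)) ≫ D ◁ μ := by
    rw [← id_tensorHom, ← id_tensorHom, tensorHom_comp_tensorHom, tensorHom_comp_tensorHom,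
      IsMonHom.mul_hom, id_comp, comp_id]
  have h₂ : ((s ⊗ₘ t) ≫ μ) ▷ C ≫ D ◁ t = ((s ⊗ₘ t) ⊗ₘ t) ≫ μ ▷ D := by
    rw [← id_tensorHom, ← tensorHom_id, ← tensorHom_id, tensorHom_comp_tensorHom,
      tensorHom_comp_tensorHom, assoc, id_comp, comp_id, comp_id]
  rw [reassoc_of% h₁, reassoc_of% h₂, MonObj.mul_assoc, associator_naturality_assoc]

lemma mul_left_tensor_mul : (α_ C C C).inv ≫ μ ▷ C ≫ (s ⊗ₘ t) ≫ μ =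
    C ◁ ((s ⊗ₘ t) ≫ μ) ≫ s ▷ D ≫ μ := by
  have h₁ : μ ▷ C ≫ (s ⊗ₘ t) = ((s ⊗ₘ s) ⊗ₘ t) ≫ μ ▷ D := by
    rw [← tensorHom_id, ← tensorHom_id, tensorHom_comp_tensorHom, tensorHom_comp_tensorHom,
      IsMonHom.mul_hom, id_comp, comp_id]
  have h₂ : C ◁ ((s ⊗ₘ t) ≫ μ) ≫ s ▷ D = (s ⊗ₘ (s ⊗ₘ t)) ≫ D ◁ μ := by
    rw [← id_tensorHom, ← tensorHom_id, ← id_tensorHom, tensorHom_comp_tensorHom,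
      tensorHom_comp_tensorHom, assoc, id_comp, comp_id, comp_id]
  rw [reassoc_of% h₁, reassoc_of% h₂, MonObj.mul_assoc, ← associator_inv_naturality_assoc,
    Iso.inv_hom_id_assoc]

/-- Evaluate the relation `w` on `1 ⊗ b ⊗ 1`. -/
lemma comp_incl_eq (f : B ⟶ C) (h : C ⊗ C ⟶ D)
    (w : (C ◁ f ≫ μ) ▷ C ≫ h = ((α_ C B C).hom ≫ C ◁ (f ▷ C ≫ μ)) ≫ h) :
    f ≫ inclLeft C ≫ h = f ≫ inclRight C ≫ h := by
  have hl : (ρ_ B).inv ≫ ((λ_ B).inv ≫ η ▷ B) ▷ 𝟙_ K ≫ (C ⊗ B) ◁ η ≫ (C ◁ f ≫ μ) ▷ C =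
      f ≫ inclLeft C := by
    have h : (λ_ B).inv ≫ η ▷ B ≫ C ◁ f ≫ μ = f := by
      rw [← whisker_exchange_assoc, MonObj.one_mul, leftUnitor_naturality, Iso.inv_hom_id_assoc]
    rw [whisker_exchange, ← comp_whiskerRight_assoc, assoc, h, inclLeft,
      rightUnitor_inv_naturality_assoc]
  have hr : (ρ_ B).inv ≫ ((λ_ B).inv ≫ η ▷ B) ▷ 𝟙_ K ≫ (C ⊗ B) ◁ η ≫
      (α_ C B C).hom ≫ C ◁ (f ▷ C ≫ μ) = f ≫ inclRight C := by
    have h : B ◁ η ≫ f ▷ C ≫ μ = (ρ_ B).hom ≫ f := by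
      rw [whisker_exchange_assoc, MonObj.mul_one, rightUnitor_naturality]
    rw [associator_naturality_right_assoc, ← whiskerLeft_comp, h, inclRight,
      leftUnitor_inv_naturality_assoc, whisker_exchange]
    monoidal
  rw [← reassoc_of% hl, w, ← reassoc_of% hr]
  simp only [assoc]

end Multiplication

/-! ### The summand decomposition coming from `C ⊗_B C ≅ C × D` -/

section Splitting

variable {K : Type u} [Category.{v} K] [Preadditive K] [HasZeroObject K] [HasShift K ℤ]
  [∀ n : ℤ, (shiftFunctor K n).Additive] [Pretriangulated K] [MonoidalCategory K]
  [TensorTriangulated K]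

/-- Maps into a direct sum of modules. -/
def biprodModLift {A : K} [MonObj A] {L M N : Mod K A} (f : L ⟶ M) (g : L ⟶ N) :
    L ⟶ biprodMod M N :=
  mkHom (N := biprodMod M N) (biprod.lift f.hom g.hom) (by
    change act L ≫ biprod.lift f.hom g.hom = A ◁ biprod.lift f.hom g.hom ≫
      biprod.lift (A ◁ biprod.fst ≫ act M) (A ◁ biprod.snd ≫ act N)
    ext
    · simp [← whiskerLeft_comp_assoc]
    · simp [← whiskerLeft_comp_assoc])

lemma whiskerRight_zero [SymmetricCategory K] (X : K) {Y Z : K} : (0 : Y ⟶ Z) ▷ X = 0 := by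
  rw [← cancel_mono (β_ Z X).hom, BraidedCategory.braiding_naturality_left, whiskerLeft_zero,
    comp_zero, zero_comp]

lemma whiskerRight_add [SymmetricCategory K] (X : K) {Y Z : K} (f g : Y ⟶ Z) :
    (f + g) ▷ X = f ▷ X + g ▷ X := by
  rw [← cancel_mono (β_ Z X).hom, BraidedCategory.braiding_naturality_left, whiskerLeft_add,
    Preadditive.comp_add, Preadditive.add_comp, BraidedCategory.braiding_naturality_left,
    BraidedCategory.braiding_naturality_left]

/-- Maps out of a direct sum of modules. -/
def biprodModDesc {A : K} [MonObj A] {L M N : Mod K A} (f : M ⟶ L) (g : N ⟶ L) :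
    biprodMod M N ⟶ L :=
  mkHom (M := biprodMod M N) (biprod.desc f.hom g.hom) (by
    change biprod.lift (A ◁ biprod.fst ≫ act M) (A ◁ biprod.snd ≫ act N) ≫
      biprod.desc f.hom g.hom = A ◁ biprod.desc f.hom g.hom ≫ act L
    rw [biprod.lift_desc, biprod.desc_eq, whiskerLeft_add, Preadditive.add_comp, assoc, assoc,
      act_hom, act_hom, whiskerLeft_comp_assoc, whiskerLeft_comp_assoc])

variable [SymmetricCategory K] [IsIdempotentComplete K] {B C D D' : K} [MonObj B] [IsCommMonObj B]
  [IsSeparableRing B] [MonObj C] [IsCommMonObj C] [IsSeparableRing C] [MonObj D] [IsCommMonObj D]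
  [IsSeparableRing D] [MonObj D'] [IsCommMonObj D'] [IsSeparableRing D'] (f : B ⟶ C) [IsMonHom f]

/-- The component `D ⊗_C M ⟶ C ⊗_B M` for a direct factor `D` of `C ⊗_B C`. -/
lemma exists_factor_hom (s t : C ⟶ D) [IsMonHom s] [IsMonHom t] (s' t' : C ⟶ D') [IsMonHom s']
    [IsMonHom t'] (v : D ⟶ C ⊗ C) (v' : D' ⟶ C ⊗ C) (h₁ : v ≫ (s ⊗ₘ t) ≫ μ = 𝟙 D)
    (h₂ : v ≫ (s' ⊗ₘ t') ≫ μ = 0)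
    (hv : ((s ⊗ₘ t) ≫ μ) ≫ v + ((s' ⊗ₘ t') ≫ μ) ≫ v' = baseIdem f) (M : Mod K C) :
    ∃ d : resMod s (extendScalars t M) ⟶ extendScalars f (resMod f M),
      extπ t M ≫ d.hom = v ▷ M.X ≫ baseAct f M := by
  refine exists_base_extend_hom f s t v ?_ ?_ M
  -- Right linearity of `v` modulo the idempotent: after expanding `baseIdem` into the two factors,
  -- the factor `D` contributes the required term and `D'` contributes zero, because `v` is a
  -- section of the first projection and is killed by the second. Left linearity is the same with
  -- sides exchanged.
  · rw [← hv, Preadditive.comp_add, Preadditive.comp_add]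
    simp only [assoc]
    rw [reassoc_of% (mul_right_tensor_mul s t),
      reassoc_of% (mul_right_tensor_mul s' t'), ← comp_whiskerRight_assoc,
      ← comp_whiskerRight_assoc, h₁, h₂, whiskerRight_zero, zero_comp, add_zero, id_whiskerRight,
      id_comp]
  · rw [← hv, Preadditive.comp_add, Preadditive.comp_add]
    simp only [assoc]
    rw [reassoc_of% (mul_left_tensor_mul s t),
      reassoc_of% (mul_left_tensor_mul s' t'), ← whiskerLeft_comp_assoc,
      ← whiskerLeft_comp_assoc, h₁, h₂, whiskerLeft_zero, zero_comp, add_zero, whiskerLeft_id,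
      id_comp]

/-- If `C ⊗_B C ≅ C × D`, then `C ⊗_B M` is a direct summand of `M ⊕ (D ⊗_C M)`. -/
lemma nonempty_retract_of_splitting (h : C ⊗ C ⟶ D) [IsMonHom h]
    (w : (C ◁ f ≫ μ) ▷ C ≫ h = ((α_ C B C).hom ≫ C ◁ (f ▷ C ≫ μ)) ≫ h)
    (x : C ⊞ D ⟶ C ⊗ C) (hx : biprod.lift μ h ≫ x = baseIdem f)
    (hx' : x ≫ biprod.lift μ h = 𝟙 (C ⊞ D)) (M : Mod K C) :
    Nonempty (Retract (extendScalars f (resMod f M))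
      (biprodMod (resMod (𝟙 C) (extendScalars (𝟙 C) M))
        (resMod (inclLeft C ≫ h) (extendScalars (inclRight C ≫ h) M)))) := by
  have hμ : (𝟙 C ⊗ₘ 𝟙 C) ≫ μ = μ := by rw [id_tensorHom_id, id_comp]
  have hh := (eq_incl_tensor_mul h).symm
  have hxμ : x ≫ μ = biprod.fst := by
    have := hx' =≫ biprod.fst
    rwa [assoc, biprod.lift_fst, id_comp] at this
  have hxh : x ≫ h = biprod.snd := by
    have := hx' =≫ biprod.snd
    rwa [assoc, biprod.lift_snd, id_comp] at this
  have hsum : μ ≫ biprod.inl ≫ x + h ≫ biprod.inr ≫ x = baseIdem f := by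
    rw [← hx, biprod.lift_eq, Preadditive.add_comp, assoc, assoc]
  -- The factor `C` is treated on the same footing as `D`, with both structure maps equal to the
  -- identity and `μ` as its projection.
  obtain ⟨b₁, hb₁⟩ := exists_extend_base_hom f (𝟙 C) (𝟙 C) rfl M
  obtain ⟨b₂, hb₂⟩ := exists_extend_base_hom f (inclLeft C ≫ h) (inclRight C ≫ h)
    (comp_incl_eq f h w) M
  obtain ⟨d₁, hd₁⟩ := exists_factor_hom f (𝟙 C) (𝟙 C) (inclLeft C ≫ h) (inclRight C ≫ h)
    (biprod.inl ≫ x) (biprod.inr ≫ x) (by rw [hμ, assoc, hxμ, biprod.inl_fst])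
    (by rw [hh, assoc, hxh, biprod.inl_snd]) (by rw [hμ, hh, hsum]) M
  obtain ⟨d₂, hd₂⟩ := exists_factor_hom f (inclLeft C ≫ h) (inclRight C ≫ h) (𝟙 C) (𝟙 C)
    (biprod.inr ≫ x) (biprod.inl ≫ x) (by rw [hh, assoc, hxh, biprod.inr_snd])
    (by rw [hμ, assoc, hxμ, biprod.inr_fst]) (by rw [hμ, hh, add_comm, hsum]) M
  refine ⟨⟨biprodModLift b₁ b₂, biprodModDesc d₁ d₂, ?_⟩⟩
  ext
  have hone : 𝟙 C = inclLeft C ≫ μ := by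
    simp [inclLeft]
  have e₁ : baseπ f M ≫ b₁.hom ≫ d₁.hom = (inclLeft C ≫ μ ≫ biprod.inl ≫ x) ▷ M.X ≫ baseAct f M := by
    rw [← reassoc_of% hone]
    refine ((reassoc_of% hb₁) d₁.hom).trans ((assoc _ _ _).trans
      ((congrArg (𝟙 C ▷ M.X ≫ ·) hd₁).trans ?_))
    simp only [id_whiskerRight, id_comp]
  have e₂ : baseπ f M ≫ b₂.hom ≫ d₂.hom = (inclLeft C ≫ h ≫ biprod.inr ≫ x) ▷ M.X ≫ baseAct f M := by
    refine ((reassoc_of% hb₂) d₂.hom).trans ((assoc _ _ _).trans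
      ((congrArg ((inclLeft C ≫ h) ▷ M.X ≫ ·) hd₂).trans ?_))
    simp only [comp_whiskerRight, assoc]
  -- On `c ⊗ m`, the two composites apply the two components of `c ⊗ 1 ∈ C ⊗_B C` to `m`. The
  -- components add up to `c ⊗ 1`, so the sum is the identity.
  have e : b₁.hom ≫ d₁.hom + b₂.hom ≫ d₂.hom = 𝟙 (extendScalars f (resMod f M)).X := by
    rw [← cancel_epi (baseπ f M), Preadditive.comp_add, e₁, e₂, ← Preadditive.add_comp,
      ← whiskerRight_add, ← Preadditive.comp_add, hsum, comp_whiskerRight_assoc, baseIdem_baseAct,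
      inclLeft_baseAct, comp_id]
  exact (biprod.lift_desc).trans e

end Splitting

/-! ### Exchanging the two factors of `C ⊗_B C` -/

section Twist

variable {K : Type u} [Category.{v} K] [Preadditive K] [HasBinaryBiproducts K]
  [MonoidalCategory K] [SymmetricCategory K] [IsIdempotentComplete K]
  {B C D : K} [MonObj B] [IsCommMonObj B]
  [IsSeparableRing B] [MonObj C] [IsCommMonObj C] [IsSeparableRing C] (f : B ⟶ C) [IsMonHom f]

lemma inclLeft_braiding (A : K) [MonObj A] : inclLeft A ≫ (β_ A A).hom = inclRight A := by
  rw [inclLeft, inclRight, assoc, BraidedCategory.braiding_naturality_right]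
  simp

lemma inclRight_braiding (A : K) [MonObj A] : inclRight A ≫ (β_ A A).hom = inclLeft A := by
  rw [← inclLeft_braiding, assoc, SymmetricCategory.symmetry, comp_id]

/-- A coequalizer `C ⊗ C ⟶ C × D` of the two actions of `B`, precomposed with the braiding, still is
a quotient map onto `C ⊗_B C`. -/
lemma exists_section_of_isColimit (h : C ⊗ C ⟶ D)
    (w : (C ◁ f ≫ μ) ▷ C ≫ biprod.lift μ h =
      ((α_ C B C).hom ≫ C ◁ (f ▷ C ≫ μ)) ≫ biprod.lift μ h)
    (hc : IsColimit (Cofork.ofπ (biprod.lift μ h) w)) :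
    (C ◁ f ≫ μ) ▷ C ≫ (β_ C C).hom ≫ h =
      ((α_ C B C).hom ≫ C ◁ (f ▷ C ≫ μ)) ≫ (β_ C C).hom ≫ h ∧
    ∃ x : C ⊞ D ⟶ C ⊗ C, biprod.lift μ ((β_ C C).hom ≫ h) ≫ x = baseIdem f ∧
      x ≫ biprod.lift μ ((β_ C C).hom ≫ h) = 𝟙 (C ⊞ D) := by
  -- Viewing both factors as `B`-modules makes the construction symmetric, so the braiding descends
  -- to `R ⊗_B R`. The associated idempotent is still `baseIdem`.
  let R := resMod f (Mod.regular C)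
  let P : C ⊗ C ⟶ (relTensor (𝟙 B) R R).X := relπ (𝟙 B) R R
  let i : (relTensor (𝟙 B) R R).X ⟶ C ⊗ C := relι (𝟙 B) R R
  have hR : rightAct (𝟙 B) R = C ◁ f ≫ μ := by
    rw [rightAct_resMod, id_comp, rightAct_regular]
  have hPi : P ≫ i = baseIdem f := by
    refine (relπ_relι (𝟙 B) R R).trans ?_
    change C ◁ linSection R ≫ (α_ C B C).inv ≫ rightAct (𝟙 B) R ▷ C =
      C ◁ linSection R ≫ (α_ C B C).inv ≫ rightAct f (Mod.regular C) ▷ C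
    rw [hR, rightAct_regular]
    rfl
  have hfac {Z : K} (k : C ⊗ C ⟶ Z)
      (hk : (C ◁ f ≫ μ) ▷ C ≫ k = ((α_ C B C).hom ≫ C ◁ (f ▷ C ≫ μ)) ≫ k) : P ≫ i ≫ k = k := by
    rw [reassoc_of% hPi]
    exact map_baseIdem_comp f (𝟭 K) k hk
  have hP : (C ◁ f ≫ μ) ▷ C ≫ P = ((α_ C B C).hom ≫ C ◁ (f ▷ C ≫ μ)) ≫ P := by
    rw [← hR]
    exact relπ_condition (𝟙 B) R R
  have hβP : (C ◁ f ≫ μ) ▷ C ≫ (β_ C C).hom ≫ P =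
      ((α_ C B C).hom ≫ C ◁ (f ▷ C ≫ μ)) ≫ (β_ C C).hom ≫ P := by
    rw [← hR]
    exact braiding_relπ_condition R R
  obtain ⟨u, hu⟩ : ∃ u, biprod.lift μ h ≫ u = P :=
    ⟨hc.desc (Cofork.ofπ P hP), hc.fac (Cofork.ofπ P hP) WalkingParallelPair.one⟩
  have : Epi (biprod.lift μ h) := epi_of_isColimit_cofork hc
  have hβ : biprod.lift μ ((β_ C C).hom ≫ h) = (β_ C C).hom ≫ biprod.lift μ h := by
    ext <;> simp [IsCommMonObj.mul_comm]
  have hw : (C ◁ f ≫ μ) ▷ C ≫ biprod.lift μ ((β_ C C).hom ≫ h) =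
      ((α_ C B C).hom ≫ C ◁ (f ▷ C ≫ μ)) ≫ biprod.lift μ ((β_ C C).hom ≫ h) := by
    rw [hβ, ← hfac _ w, reassoc_of% hβP]
    simp only [assoc]
  -- The universal map `u` undoes the original quotient map. The braiding now occurs twice,
  -- separated by an idempotent that the descended braiding absorbs, and so cancels.
  have hx : biprod.lift μ ((β_ C C).hom ≫ h) ≫ u ≫ i ≫ (β_ C C).hom ≫ P ≫ i = P ≫ i := by
    rw [hβ, assoc, reassoc_of% hu, reassoc_of% (hfac _ hβP), SymmetricCategory.symmetry_assoc]
  refine ⟨by simpa using hw =≫ biprod.snd, u ≫ i ≫ (β_ C C).hom ≫ P ≫ i, hx.trans hPi, ?_⟩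
  have : Epi (biprod.lift μ ((β_ C C).hom ≫ h)) := by rw [hβ]; infer_instance
  rw [← cancel_epi (biprod.lift μ ((β_ C C).hom ≫ h)), ← assoc, hx, assoc, hfac _ hw, comp_id]

end Twist

/-! ### Induction along the splitting tower -/

section Tower

variable {K : Type u} [Category.{v} K] [Preadditive K] [HasZeroObject K] [HasShift K ℤ]
  [∀ n : ℤ, (shiftFunctor K n).Additive] [Pretriangulated K] [MonoidalCategory K]
  [TensorTriangulated K] [SymmetricCategory K] [IsIdempotentComplete K]

open IdealMonoid

/-- The underlying map of a homomorphism of commutative ring objects. -/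
def ringHom {B C : CommMon K} (f : B ⟶ C) : B.X ⟶ C.X := f.hom.hom

instance {B C : CommMon K} (f : B ⟶ C) : IsMonHom (ringHom f) :=
  inferInstanceAs (IsMonHom f.hom.hom)

instance {B C : CommMon K} (f : B ⟶ C) [IsIso f] : IsIso (ringHom f) :=
  inferInstanceAs (IsIso f.hom.hom)

/-- Restriction of scalars along the identity. -/
def resModId {A : K} [MonObj A] (M : Mod K A) : resMod (𝟙 A) M ≅ M :=
  isoMod (M := resMod (𝟙 A) M) (Iso.refl M.X) (by
    change (𝟙 A ▷ M.X ≫ act M) ≫ 𝟙 M.X = A ◁ 𝟙 M.X ≫ act M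
    simp)

lemma incomparable_congr {A B : K} [MonObj A] [IsCommMonObj A] [IsSeparableRing A] [MonObj B]
    [IsCommMonObj B] [IsSeparableRing B] {f f' : A ⟶ B} [IsMonHom f] [IsMonHom f'] (h : f = f')
    (hf : (extensionTT f).toExtension.Incomparable) :
    (extensionTT f').toExtension.Incomparable := by
  subst h; exact hf

/-- In the tower, `g` is restricted from the first factor of `C ⊗ C`, while in
`nonempty_retract_of_splitting` the extension of scalars uses the second. Precomposing with the
braiding reconciles the two conventions. -/
lemma exists_section_of_isSplitting {B C D : CommMon K} {f : B ⟶ C} {g : C ⟶ D}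
    (hs : IsSplitting f g) [IsSeparableRing B.X] [IsSeparableRing C.X] :
    ∃ (h : C.X ⊗ C.X ⟶ D.X) (_ : IsMonHom h) (x : C.X ⊞ D.X ⟶ C.X ⊗ C.X),
      inclRight C.X ≫ h = (ringHom g) ∧
      (C.X ◁ (ringHom f) ≫ μ) ▷ C.X ≫ h =
        ((α_ C.X B.X C.X).hom ≫ C.X ◁ ((ringHom f) ▷ C.X ≫ μ)) ≫ h ∧
      biprod.lift μ h ≫ x = baseIdem (ringHom f) ∧ x ≫ biprod.lift μ h = 𝟙 (C.X ⊞ D.X) := by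
  obtain ⟨h, hm, w, hg, ⟨hc⟩⟩ := hs
  obtain ⟨h₁, x, h₂, h₃⟩ := exists_section_of_isColimit (ringHom f) h w hc
  exact ⟨(β_ C.X C.X).hom ≫ h, inferInstance, x,
    by rw [← assoc, inclRight_braiding]; exact hg, h₁, h₂, h₃⟩

lemma isSeparableRing_of_isSplitting {B C D : CommMon K} {f : B ⟶ C} {g : C ⟶ D}
    (hs : IsSplitting f g) [IsSeparableRing B.X] [IsSeparableRing C.X] : IsSeparableRing D.X := by
  obtain ⟨h, hm, x, -, -, -, hx⟩ := exists_section_of_isSplitting hs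
  have : IsSplitEpi h := ⟨⟨⟨biprod.inr ≫ x, by
    have := biprod.inr ≫= hx =≫ biprod.snd
    simpa using this⟩⟩⟩
  exact isSeparableRing_of_isSplitEpi h

/-- Incomparability descends along the splitting tower. -/
lemma incomparable_of_isSplitting {B C D : CommMon K} {f : B ⟶ C} {g : C ⟶ D}
    (hs : IsSplitting f g) [IsSeparableRing B.X] [IsSeparableRing C.X] [IsSeparableRing D.X]
    (hg : (extensionTT (ringHom g)).toExtension.Incomparable) :
    (extensionTT (ringHom f)).toExtension.Incomparable := by
  obtain ⟨h, hm, x, hgh, w, hx, hx'⟩ := exists_section_of_isSplitting hs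
  have hfh := comp_incl_eq (ringHom f) h w
  refine (extensionTT (ringHom f)).toExtension.incomparable_of_splitting
    (extensionTT (inclRight C.X ≫ h)).toExtension (extensionTT (inclLeft C.X ≫ h)).toExtension
    ?_ ?_ (incomparable_congr hgh.symm hg)
  · rintro ⟨N⟩
    obtain ⟨i⟩ := nonempty_extendScalars_comp (ringHom f) (inclRight C.X ≫ h) N
    obtain ⟨j⟩ := nonempty_extendScalars_comp (ringHom f) (inclLeft C.X ≫ h) N
    have e : extendScalars ((ringHom f) ≫ inclRight C.X ≫ h) N =
      extendScalars ((ringHom f) ≫ inclLeft C.X ≫ h) N := relTensor_congr hfh.symm _ N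
    exact Obj.sound_iso ⟨i ≪≫ eqToIso e ≪≫ j.symm⟩
  · rintro I hI ⟨M⟩ hM hM'
    have hI' : IsThickIdeal (modTTData C.X) (Obj.mk _ ⁻¹' I) := hI
    obtain ⟨r⟩ := nonempty_retract_of_splitting (ringHom f) h w x hx hx' M
    -- The summand for the factor `C` is `C ⊗_C M ≅ M`, which accounts for the hypothesis `m ∈ I` in
    -- the abstract descent.
    refine hI'.retract_mem r ((biprodMod_mem_iff hI' _ _).2 ⟨?_, hM'⟩)
    obtain ⟨i⟩ := nonempty_regular_relTensor M
    exact (hI'.iso_mem ⟨resModId (extendScalars (𝟙 C.X) M) ≪≫ i⟩).2 hM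

namespace SplittingTower

variable {A : CommMon K} (T : SplittingTower A)

/-- Each step needs separability of two consecutive rings, as `A^[n+2]` is a split quotient of
`A^[n+1] ⊗ A^[n+1]` constructed relative to `A^[n]`; hence the induction on pairs. -/
lemma isSeparableRing [IsSeparableRing A.X] (n : ℕ) : IsSeparableRing (T.ring n).X := by
  suffices IsSeparableRing (T.ring n).X ∧ IsSeparableRing (T.ring (n + 1)).X from this.1
  induction n with
  | zero =>
    have : IsSeparableRing (CommMon.trivial K).X := inferInstanceAs (IsSeparableRing (𝟙_ K))
    exact ⟨isSeparableRing_of_isSplitEpi (ringHom T.isoZero.inv),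
      isSeparableRing_of_isSplitEpi (ringHom T.isoOne.inv)⟩
  | succ n ih =>
    obtain ⟨_, _⟩ := ih
    exact ⟨inferInstance, isSeparableRing_of_isSplitting (T.isSplitting n)⟩

lemma isIso_one : IsIso (η : 𝟙_ K ⟶ (T.ring 0).X) := by
  have h : (η : 𝟙_ K ⟶ (T.ring 0).X) = (ringHom T.isoZero.inv) :=
    ((IsMonHom.one_hom (ringHom T.isoZero.inv)).symm.trans (id_comp _))
  rw [h]
  exact inferInstanceAs (IsIso (ringHom T.isoZero.inv))

end SplittingTower

lemma SplittingTower.incomparable {A : CommMon K} (T : SplittingTower A)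
    [∀ n, IsSeparableRing (T.ring n).X] {n : ℕ} (hn : IsZero (T.ring n).X) :
    (extensionTT (ringHom (T.map 0))).toExtension.Incomparable := by
  have h : ∀ k, (extensionTT (ringHom (T.map k))).toExtension.Incomparable →
      (extensionTT (ringHom (T.map 0))).toExtension.Incomparable := by
    intro k
    induction k with
    | zero => exact id
    | succ k ih => exact fun h ↦ ih (incomparable_of_isSplitting (T.isSplitting k) h)
  -- The descent starts at `A^[n] ⟶ A^[n+1]`: since `A^[n] = 0`, the unit over `A^[n+1]` is extended
  -- from a zero object, so it lies in every ideal.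
  refine h n ((extensionTT (ringHom (T.map n))).toExtension.incomparable_of_one_mem fun I hI ↦ ?_)
  have hI' := (extensionTT (ringHom (T.map n))).toExtension.isIdeal_F hI
  rw [← map_one (extensionTT (ringHom (T.map n))).toExtension.F]
  have hz : IsZero (Mod.regular (T.ring n).X) := isZero_mod_of_isZero hn
  exact IsThickIdeal.zero_mem hI' _ hz

end Tower

/-! ### Incomparability for a ring object of finite degree -/

section Incomparability

variable {K : Type u} [Category.{v} K] [Preadditive K] [HasZeroObject K] [HasShift K ℤ]
  [∀ n : ℤ, (shiftFunctor K n).Additive] [Pretriangulated K] [MonoidalCategory K]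
  [TensorTriangulated K] [SymmetricCategory K] [IsIdempotentComplete K]

open IdealMonoid

/-- Incomparability only depends on the ring object up to isomorphism. -/
lemma freeTT_incomparable {R S A : K} [MonObj R] [IsCommMonObj R] [IsSeparableRing R] [MonObj S]
    [IsCommMonObj S] [IsSeparableRing S] [MonObj A] [IsCommMonObj A] [IsSeparableRing A]
    [IsIso (η : 𝟙_ K ⟶ R)] (f : R ⟶ S) [IsMonHom f] (a : S ⟶ A) [IsMonHom a] (b : A ⟶ S)
    [IsMonHom b] (hba : b ≫ a = 𝟙 A) (h : (extensionTT f).toExtension.Incomparable) :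
    (freeTT A).toExtension.Incomparable := by
  intro Q' Q hQ' hQ hle heq
  -- Every `A`-module is extended from `S` because `b ≫ a = 𝟙 A`. So primes over `A` are determined
  -- by their restrictions to `S`, and incomparability may be tested there.
  have hsurj : Function.Surjective (extensionTT a).toExtension.F := by
    rintro ⟨M⟩
    refine ⟨Obj.mk _ (extendScalars b M), Obj.sound_iso ?_⟩
    obtain ⟨i⟩ := nonempty_extendScalars_comp b a M
    have e : extendScalars (b ≫ a) M = extendScalars (𝟙 A) M := relTensor_congr hba _ M
    obtain ⟨j⟩ := nonempty_regular_relTensor M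
    exact ⟨i ≪≫ eqToIso e ≪≫ j⟩
  have hfree (X : K) : (extensionTT a).toExtension.F ((extensionTT f).toExtension.F
      (Obj.mk (modTTData R) (freeMod R X))) = (freeTT A).toExtension.F (Obj.mk (ttData K) X) := by
    obtain ⟨i⟩ := nonempty_extendScalars_comp f a (freeMod R X)
    obtain ⟨j⟩ := nonempty_extendScalars_freeMod (f ≫ a) X
    exact Obj.sound_iso ⟨i ≪≫ j⟩
  -- All `R`-modules are free on their underlying objects, so equality of restrictions to `R`
  -- follows from equality of restrictions to `K`.
  have key := h ((extensionTT a).toExtension.isPrime_F hQ')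
    ((extensionTT a).toExtension.isPrime_F hQ) (Set.preimage_mono hle) (by
      ext n
      obtain ⟨N, rfl⟩ := Obj.mk_surjective n
      rw [← Obj.sound_iso (D := modTTData R) (nonempty_freeMod_iso_of_isIso N),
        Set.mem_preimage, Set.mem_preimage, Set.mem_preimage, Set.mem_preimage, hfree]
      exact Set.ext_iff.1 heq (Obj.mk (ttData K) N.X))
  exact Set.preimage_injective.2 hsurj key

lemma HasFiniteDegree.incomparable {A : K} [MonObj A] [IsCommMonObj A] [IsSeparableRing A]
    (hA : HasFiniteDegree A) : (freeTT A).toExtension.Incomparable := by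
  obtain ⟨T, n, hn⟩ := hA
  have : IsSeparableRing (CommMon.mk A).X := inferInstanceAs (IsSeparableRing A)
  have := T.isSeparableRing
  have := T.isIso_one
  exact freeTT_incomparable (ringHom (T.map 0)) (ringHom T.isoOne.hom) (ringHom T.isoOne.inv)
    (congrArg ringHom T.isoOne.inv_hom_id) (T.incomparable hn)

end Incomparability
end
end TTGeometry

/-! ### The coequalizer theorem -/

theorem theorem3p9 {K : Type u} [Category.{v} K] [Preadditive K] [Limits.HasZeroObject K]
    [HasShift K ℤ] [∀ n : ℤ, (shiftFunctor K n).Additive] [Pretriangulated K] [IsTriangulated K]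
    [IsIdempotentComplete K] [MonoidalCategory K] [SymmetricCategory K] [TensorTriangulated K]
    (A : K) [MonObj A] [IsCommMonObj A] [IsSeparableRing A] (hA : HasFiniteDegree A) :
    ∃ (φ₁ φ₂ : C(Spc (modTTData (A ⊗ A)), Spc (modTTData A)))
      (φ : C(Spc (modTTData A), supp (ttData K) A)),
      (∀ Q, (φ₁ Q).carrier = {M | extendScalars (inclLeft A) M ∈ Q.carrier}) ∧
      (∀ Q, (φ₂ Q).carrier = {M | extendScalars (inclRight A) M ∈ Q.carrier}) ∧
      (∀ P, (φ P).1.carrier = {X | freeMod A X ∈ P.carrier}) ∧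
      IsTopCoequalizer.{w} φ₁ φ₂ φ := by
  refine ⟨(extensionTT (inclLeft A)).spcMap, (extensionTT (inclRight A)).spcMap,
    (freeTT A).spcMapSupp ⟨Iso.refl A⟩, fun _ ↦ rfl, fun _ ↦ rfl, fun _ ↦ rfl,
    (freeTT A).isTopCoequalizer _ _ _ (fun X ↦ ?_) (fun M ↦ ?_) hA.incomparable⟩
  · obtain ⟨i⟩ := nonempty_extendScalars_freeMod (inclLeft A) X
    obtain ⟨j⟩ := nonempty_extendScalars_freeMod (inclRight A) X
    exact ⟨i ≪≫ j.symm⟩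
  · exact (nonempty_resMod_extendScalars M).map Retract.ofIso
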